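/- Let $K$ be an algebraically closed field of characteristic zero and let $\ell=\mathfrak{sl}(2,K)$ with basis $x,y,h$, $[x,y]=h$, $[h,x]=2x$, $[h,y]=-2y$, and dual basis $x',y',h'$ of $\ell'$. In the sums below $u,v$ run over this basis. For $n\in\mathbb Z$ let $\beta_n^u,\ b_n^u$ (linear in $u\in\ell$) and $\gamma_n^{f},\ c_n^{f}$ (linear in $f\in\ell'$) be the generators of the Weyl and Clifford algebras with $[\gamma_n^{f},\beta_m^v]=\langle f,v\rangle\delta_{n+m,0}=\{c_n^{f},b_m^v\}$ and all other supercommutators zero. Let $W=S\otimes\Lambda$ be the Fock module spanned by the strings of creation operators ($\beta_n,b_n$ with $n\le -1$; $\gamma_n,c_n$ with $n\le 0$) applied to the vacuum $\mathbf 1$, which is killed by all other generators (annihilation operators). With $:\ :$ denoting normal ordering (annihilation operators to the right, with sign), define on $W$ $$\theta(u_n)=\sum_{v,m}\bigl(:\beta_{n+m}^{[u,v]}\gamma_{-m}^{v'}:+:b_{n+m}^{[u,v]}c_{-m}^{v'}:\bigr),\qquad L_n=-\sum_{u,m}m\bigl(:b_{n+m}^{u}c_{-m}^{u'}:+:\beta_{n+m}^{u}\gamma_{-m}^{u'}:\bigr),$$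 $$Q=\sum_{u,v;\,i,j}:\beta_{i+j}^{[u,v]}\gamma_{-i}^{v'}c_{-j}^{u'}:+\tfrac12\sum_{u,v;\,i,j}:b_{i+j}^{[u,v]}c_{-i}^{v'}c_{-j}^{u'}:,\qquad h=\sum_{u,n}\gamma_{-n}^{u'}b_n^u,\qquad k=\sum_{u,n}n\,\beta_n^u c_{-n}^{u'} .$$ A state $w\neq0$ of $W$ is called a purely symmetric invariant generator of degree $d$ if $\theta(u_0)w=0$ for all $u\in\ell$ and there are $d$ (not necessarily distinct) copies of $\ell$ or $\ell'$ among the bosonic creation operators, i.e. among the spaces $\{\beta_{-n}^u:u\in\ell\}$ ($n\ge1$) and $\{\gamma_{-n}^{f}:f\in\ell'\}$ ($n\ge0$), such that $w$ lies in the span of the products $g_1\cdots g_d\mathbf 1$ with $g_i$ in the $i$-th copy. **Theorem.** There are infinitely many pairwise non-proportional purely symmetric invariant generators of degree $2$, and likewise of degree $3$. Among all those of degree $2$ or $3$, the ones in $\operatorname{Ker}Q$ are, up to nonzero scalars, exactly the following five linearly independent states: $$v^{(1)}\mathbf 1=\{(\beta_{-1}^h)^2+4\beta_{-1}^x\beta_{-1}^y\}\mathbf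 1,\qquad v^{(2)}\mathbf 1=\{\beta_{-1}^h\beta_{-2}^h+2\beta_{-1}^x\beta_{-2}^y+2\beta_{-1}^y\beta_{-2}^x\}\mathbf 1,$$ $$v^{(3)}\mathbf 1=\{(\gamma_0^{h'})^2+\gamma_0^{x'}\gamma_0^{y'}\}\mathbf 1,\qquad v^{(4)}\mathbf 1=\{\gamma_0^{h'}\gamma_{-1}^{h'}+\tfrac12\gamma_0^{x'}\gamma_{-1}^{y'}+\tfrac12\gamma_0^{y'}\gamma_{-1}^{x'}\}\mathbf 1,$$ $$v^{(5)}\mathbf 1=\{\beta_{-1}^h\gamma_0^{h'}+\beta_{-1}^x\gamma_0^{x'}+\beta_{-1}^y\gamma_0^{y'}\}\mathbf 1 .$$ None of the $v^{(i)}\mathbf 1$ is $Q$-exact, i.e. none lies in $Q(W)$. Moreover $$h\,v^{(1)}\mathbf 1=2\mathbf t,\qquad L_1v^{(2)}\mathbf 1=2v^{(1)}\mathbf 1,\qquad k\,v^{(4)}\mathbf 1=-\mathbf r,\qquad h\,v^{(5)}\mathbf 1=\mathbf h,$$ and $v^{(3)}\mathbf 1$ lies in the classical Weil algebra (the span of the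 monomials in the $c_0^{f}$ and $\gamma_0^{f}$ applied to $\mathbf 1$). Here $$\mathbf h=\sum_u\gamma_0^{u'}b_{-1}^u\mathbf 1,\qquad \mathbf r=\sum_u\gamma_0^{\phi(u)}c_{-1}^{u'}\mathbf 1,\qquad \mathbf t=\sum_u\beta_{-1}^{\phi^{-1}(u')}b_{-1}^u\mathbf 1,$$ where $\phi:\ell\to\ell'$ is $x\mapsto\tfrac12y'$, $y\mapsto\tfrac12x'$, $h\mapsto h'$. The states $\mathbf h,\mathbf r,\mathbf t$ are in $\operatorname{Ker}Q$ and none of them is $Q$-exact. -/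

import Mathlib

open scoped TensorProduct

noncomputable section

namespace VOWA

/-- Labels of the creation operators of one statistics (bosonic or fermionic), for a basis indexed
by `ι`: in the bosonic case `inl (u, n)` labels `β_{-n-1}^u` and `inr (u, n)` labels `γ_{-n}^{u'}`;
in the fermionic case `inl (u, n)` labels `b_{-n-1}^u` and `inr (u, n)` labels `c_{-n}^{u'}`. -/
abbrev Var (ι : Type*) := (ι × ℕ) ⊕ (ι × ℕ)

/-- The semi-infinite symmetric module: polynomials in the creation operators `β`, `γ`. -/
abbrev SymMod (K ι : Type*) [Field K] := MvPolynomial (Var ι) K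

/-- The semi-infinite exterior module: exterior algebra on the creation operators `b`, `c`. -/
abbrev ExtMod (K ι : Type*) [Field K] := ExteriorAlgebra K (Var ι →₀ K)

/-- The underlying space of the semi-infinite Weil complex of the loop algebra. -/
abbrev W (K ι : Type*) [Field K] := SymMod K ι ⊗[K] ExtMod K ι

/-- The vacuum vector `1 = 1_sym ⊗ 1_ext`. -/
def vac (K ι : Type*) [Field K] : W K ι := (1 : SymMod K ι) ⊗ₜ[K] (1 : ExtMod K ι)

section Basic

variable {K ι : Type*} [Field K]

/-- Multiplication by a polynomial generator. -/
def symMul (i : Var ι) : Module.End K (W K ι) :=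
  LinearMap.rTensor (ExtMod K ι) (LinearMap.mulLeft K (MvPolynomial.X i : SymMod K ι))

/-- Partial derivative with respect to a polynomial generator. -/
def symDer (i : Var ι) : Module.End K (W K ι) :=
  LinearMap.rTensor (ExtMod K ι)
    ((MvPolynomial.pderiv i : Derivation K (SymMod K ι) (SymMod K ι)) : SymMod K ι →ₗ[K] SymMod K ι)

/-- Left exterior multiplication by a generator. -/
def extMul (i : Var ι) : Module.End K (W K ι) :=
  LinearMap.lTensor (SymMod K ι)
    (LinearMap.mulLeft K (ExteriorAlgebra.ι K (Finsupp.single i (1 : K)) : ExtMod K ι))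

/-- Contraction with the coordinate functional of a generator. -/
def extDer (i : Var ι) : Module.End K (W K ι) :=
  LinearMap.lTensor (SymMod K ι)
    (CliffordAlgebra.contractLeft (Q := (0 : QuadraticForm K (Var ι →₀ K)))
      (Finsupp.lapply i : (Var ι →₀ K) →ₗ[K] K))

/-- `β_n^u` for a basis vector `u`. -/
def betaB (n : ℤ) (u : ι) : Module.End K (W K ι) :=
  if n < 0 then symMul (Sum.inl (u, (-n - 1).toNat)) else -symDer (Sum.inr (u, n.toNat))

/-- `γ_n^{u'}` for a dual basis vector `u'`. -/
def gammaB (n : ℤ) (u : ι) : Module.End K (W K ι) :=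
  if n ≤ 0 then symMul (Sum.inr (u, (-n).toNat)) else symDer (Sum.inl (u, (n - 1).toNat))

/-- `b_n^u` for a basis vector `u`. -/
def bB (n : ℤ) (u : ι) : Module.End K (W K ι) :=
  if n < 0 then extMul (Sum.inl (u, (-n - 1).toNat)) else extDer (Sum.inr (u, n.toNat))

/-- `c_n^{u'}` for a dual basis vector `u'`. -/
def cB (n : ℤ) (u : ι) : Module.End K (W K ι) :=
  if n ≤ 0 then extMul (Sum.inr (u, (-n).toNat)) else extDer (Sum.inl (u, (n - 1).toNat))

/-! ### Boundedness of the level -/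


/-- The level of a generator label. -/
def lvl {ι : Type*} : Var ι → ℕ := Sum.elim Prod.snd Prod.snd

/-- Vectors killed by all derivatives and contractions of level at least `N`. -/
def low (K ι : Type*) [Field K] (N : ℕ) : Submodule K (W K ι) :=
  ⨅ i : {i : Var ι // N ≤ lvl i}, LinearMap.ker (symDer (K := K) i.1) ⊓ LinearMap.ker (extDer i.1)

theorem mem_low {N : ℕ} {w : W K ι} :
    w ∈ low K ι N ↔ ∀ i : Var ι, N ≤ lvl i → symDer i w = 0 ∧ extDer i w = 0 := by
  simp [low, Submodule.mem_iInf]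

theorem low_mono {N M : ℕ} (h : N ≤ M) : low K ι N ≤ low K ι M := fun _ hw =>
  mem_low.2 fun i hi => mem_low.1 hw i (h.trans hi)

theorem pderiv_comm (i j : Var ι) (p : SymMod K ι) :
    MvPolynomial.pderiv i (MvPolynomial.pderiv j p) =
      MvPolynomial.pderiv j (MvPolynomial.pderiv i p) := by
  classical
  have h : ⁅(MvPolynomial.pderiv i : Derivation K (SymMod K ι) (SymMod K ι)),
      (MvPolynomial.pderiv j : Derivation K (SymMod K ι) (SymMod K ι))⁆ = 0 := by
    refine MvPolynomial.derivation_ext fun k => ?_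
    rw [Derivation.commutator_apply]
    simp [MvPolynomial.pderiv_X, Pi.single_apply, apply_ite]
  have h2 := congrArg
    (fun D : Derivation K (SymMod K ι) (SymMod K ι) => D p) h
  simpa [Derivation.commutator_apply, sub_eq_zero] using h2

theorem symDer_symDer (i j : Var ι) (w : W K ι) :
    symDer i (symDer j w) = symDer j (symDer i w) := by
  induction w using TensorProduct.induction_on with
  | zero => simp
  | tmul p q => simp [symDer, pderiv_comm i j p]
  | add a b ha hb => simp only [map_add, ha, hb]

theorem extDer_extDer (i j : Var ι) (w : W K ι) :
    extDer i (extDer j w) = -extDer j (extDer i w) := by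
  induction w using TensorProduct.induction_on with
  | zero => simp
  | tmul p q =>
    simp only [extDer, LinearMap.lTensor_tmul]
    rw [CliffordAlgebra.contractLeft_comm, TensorProduct.tmul_neg]
  | add a b ha hb => simp only [map_add, ha, hb, neg_add]

theorem symDer_extDer (i j : Var ι) (w : W K ι) :
    symDer i (extDer j w) = extDer j (symDer i w) := by
  induction w using TensorProduct.induction_on with
  | zero => simp
  | tmul p q => simp [symDer, extDer]
  | add a b ha hb => simp only [map_add, ha, hb]

theorem symDer_mem_low {N : ℕ} {w : W K ι} (hw : w ∈ low K ι N) (j : Var ι) :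
    symDer j w ∈ low K ι N := mem_low.2 fun i hi => by
  rw [symDer_symDer, ← symDer_extDer, (mem_low.1 hw i hi).1, (mem_low.1 hw i hi).2]
  simp

theorem extDer_mem_low {N : ℕ} {w : W K ι} (hw : w ∈ low K ι N) (j : Var ι) :
    extDer j w ∈ low K ι N := mem_low.2 fun i hi => by
  rw [extDer_extDer, symDer_extDer, (mem_low.1 hw i hi).1, (mem_low.1 hw i hi).2]
  simp

theorem exists_ext_bound (q : ExtMod K ι) : ∃ N : ℕ, ∀ i : Var ι, N ≤ lvl i →
    CliffordAlgebra.contractLeft (Q := (0 : QuadraticForm K (Var ι →₀ K)))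
      (Finsupp.lapply i : (Var ι →₀ K) →ₗ[K] K) q = 0 := by
  induction q using CliffordAlgebra.left_induction with
  | algebraMap r => exact ⟨0, fun i _ =>
    CliffordAlgebra.contractLeft_algebraMap (Q := (0 : QuadraticForm K (Var ι →₀ K)))
    (Finsupp.lapply i : (Var ι →₀ K) →ₗ[K] K) r⟩
  | add x y hx hy =>
    obtain ⟨N, hN⟩ := hx
    obtain ⟨M, hM⟩ := hy
    refine ⟨max N M, fun i hi => ?_⟩
    rw [map_add, hN i (le_trans (le_max_left _ _) hi), hM i (le_trans (le_max_right _ _) hi),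
      add_zero]
  | ι_mul x m hx =>
    obtain ⟨N, hN⟩ := hx
    refine ⟨max N (m.support.sup lvl + 1), fun i hi => ?_⟩
    have hm : m i = 0 := by
      by_contra hne
      have h1 : lvl i ≤ m.support.sup lvl := Finset.le_sup (Finsupp.mem_support_iff.2 hne)
      have h2 := le_trans (le_max_right _ _) hi
      omega
    rw [CliffordAlgebra.contractLeft_ι_mul, hN i (le_trans (le_max_left _ _) hi)]
    simp [hm]

theorem exists_sym_bound (p : SymMod K ι) : ∃ N : ℕ, ∀ i : Var ι, N ≤ lvl i →
    MvPolynomial.pderiv i p = 0 := by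
  refine ⟨p.vars.sup lvl + 1, fun i hi => MvPolynomial.pderiv_eq_zero_of_notMem_vars fun h => ?_⟩
  have h1 : lvl i ≤ p.vars.sup lvl := Finset.le_sup h
  omega

theorem exists_mem_low (w : W K ι) : ∃ N : ℕ, w ∈ low K ι N := by
  induction w using TensorProduct.induction_on with
  | zero => exact ⟨0, zero_mem _⟩
  | tmul p q =>
    obtain ⟨N, hN⟩ := exists_sym_bound p
    obtain ⟨M, hM⟩ := exists_ext_bound q
    refine ⟨max N M, mem_low.2 fun i hi => ⟨?_, ?_⟩⟩
    · simp [symDer, hN i (le_trans (le_max_left _ _) hi)]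
    · simp [extDer, hM i (le_trans (le_max_right _ _) hi)]
  | add a b ha hb =>
    obtain ⟨N, hN⟩ := ha
    obtain ⟨M, hM⟩ := hb
    exact ⟨max N M, add_mem (low_mono (le_max_left _ _) hN) (low_mono (le_max_right _ _) hM)⟩

/-- A family of operators is locally finite if every vector is killed by all but finitely many. -/
def LocFin {α : Type*} (T : α → Module.End K (W K ι)) : Prop :=
  ∀ w, (Function.support fun a => T a w).Finite

/-- The sum of a locally finite family of operators. -/
def locSum {α : Type*} (T : α → Module.End K (W K ι)) (hT : LocFin T) : Module.End K (W K ι) where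
  toFun w := ∑ᶠ a, T a w
  map_add' v w := by
    simp only [map_add]
    exact finsum_add_distrib (hT v) (hT w)
  map_smul' r w := by
    simp only [map_smul, RingHom.id_apply]
    exact (smul_finsum' r (hT w)).symm

theorem locFin_of_bound {α : Type*} {T : α → Module.End K (W K ι)} (S : ℕ → Set α)
    (hS : ∀ N, (S N).Finite) (hT : ∀ N a w, a ∉ S N → w ∈ low K ι N → T a w = 0) : LocFin T := by
  intro w
  obtain ⟨N, hN⟩ := exists_mem_low w
  refine (hS N).subset fun a ha => ?_
  by_contra hna
  exact ha (hT N a w hna hN)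

end Basic

/-- The generators `β_n^u`, `γ_n^f`, `b_n^u`, `c_n^f` of the Weyl and Clifford algebras, where `u`
is in the Lie algebra `L` and `f` in its dual. -/
inductive Gen (K L : Type*) [Field K] [AddCommGroup L] [Module K L] where
  | beta (n : ℤ) (u : L)
  | gamma (n : ℤ) (f : Module.Dual K L)
  | b (n : ℤ) (u : L)
  | c (n : ℤ) (f : Module.Dual K L)

namespace Gen

variable {K L : Type*} [Field K] [AddCommGroup L] [Module K L]

/-- The mode of a generator. -/
def mode : Gen K L → ℤ
  | beta n _ => n
  | gamma n _ => n
  | b n _ => n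
  | c n _ => n

/-- Creation operators: `b_n`, `β_n` with `n ≤ -1`, and `c_n`, `γ_n` with `n ≤ 0`. -/
def isCreation : Gen K L → Bool
  | beta n _ => decide (n < 0)
  | gamma n _ => decide (n ≤ 0)
  | b n _ => decide (n < 0)
  | c n _ => decide (n ≤ 0)

/-- The odd generators are the `b`'s and the `c`'s. -/
def isOdd : Gen K L → Bool
  | beta _ _ => false
  | gamma _ _ => false
  | b _ _ => true
  | c _ _ => true

end Gen

section Operators

variable {K ι L : Type*} [Field K] [Fintype ι] [LieRing L] [LieAlgebra K L]

/-- The action of the generators on the module; `β_n^u` and `b_n^u` are linear in `u`, and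
`γ_n^f` and `c_n^f` are linear in `f`. -/
def op (e : Module.Basis ι K L) : Gen K L → Module.End K (W K ι)
  | .beta n u => ∑ i, e.repr u i • betaB n i
  | .gamma n f => ∑ i, f (e i) • gammaB n i
  | .b n u => ∑ i, e.repr u i • bB n i
  | .c n f => ∑ i, f (e i) • cB n i

/-- The string of operators `g₁ g₂ ⋯ g_r`. -/
def str (e : Module.Basis ι K L) (l : List (Gen K L)) : Module.End K (W K ι) :=
  (l.map (op e)).prod

/-- The normally ordered product `:g₁ g₂ ⋯ g_r:`: annihilation operators are moved to the right,
with the appropriate sign. -/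
def nord (e : Module.Basis ι K L) : List (Gen K L) → Module.End K (W K ι)
  | [] => 1
  | g :: l =>
    if g.isCreation then op e g * nord e l
    else (if g.isOdd then (-1 : K) ^ l.countP Gen.isOdd else 1) • (nord e l * op e g)

/-! ### Local finiteness of normally ordered products -/

theorem op_mem_low (e : Module.Basis ι K L) {g : Gen K L} (hg : g.isCreation = false) {N : ℕ}
    {w : W K ι} (hw : w ∈ low K ι N) : op e g w ∈ low K ι N := by
  cases g <;> simp only [Gen.isCreation, decide_eq_false_iff_not] at hg <;>
    simp only [op, LinearMap.sum_apply, LinearMap.smul_apply] <;>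
    refine sum_mem fun i _ => Submodule.smul_mem _ _ ?_
  · simpa [betaB, hg] using symDer_mem_low hw _
  · simpa [gammaB, hg] using symDer_mem_low hw _
  · simpa [bB, hg] using extDer_mem_low hw _
  · simpa [cB, hg] using extDer_mem_low hw _

theorem op_eq_zero_of_mem_low (e : Module.Basis ι K L) {g : Gen K L} {N : ℕ}
    (hg : (N : ℤ) < g.mode) {w : W K ι} (hw : w ∈ low K ι N) : op e g w = 0 := by
  rw [mem_low] at hw
  cases g with
  | beta n u =>
    simp only [Gen.mode] at hg
    have h : ¬ n < 0 := by omega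
    simp only [op, LinearMap.sum_apply, LinearMap.smul_apply, betaB, if_neg h]
    exact Finset.sum_eq_zero fun i _ => by
      simp [(hw (Sum.inr (i, n.toNat)) (by simp only [lvl, Sum.elim_inr]; omega)).1]
  | gamma n u =>
    simp only [Gen.mode] at hg
    have h : ¬ n ≤ 0 := by omega
    simp only [op, LinearMap.sum_apply, LinearMap.smul_apply, gammaB, if_neg h]
    exact Finset.sum_eq_zero fun i _ => by
      rw [(hw (Sum.inl (i, (n - 1).toNat)) (by simp only [lvl, Sum.elim_inl]; omega)).1, smul_zero]
  | b n u =>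
    simp only [Gen.mode] at hg
    have h : ¬ n < 0 := by omega
    simp only [op, LinearMap.sum_apply, LinearMap.smul_apply, bB, if_neg h]
    exact Finset.sum_eq_zero fun i _ => by
      simp [(hw (Sum.inr (i, n.toNat)) (by simp only [lvl, Sum.elim_inr]; omega)).2]
  | c n u =>
    simp only [Gen.mode] at hg
    have h : ¬ n ≤ 0 := by omega
    simp only [op, LinearMap.sum_apply, LinearMap.smul_apply, cB, if_neg h]
    exact Finset.sum_eq_zero fun i _ => by
      rw [(hw (Sum.inl (i, (n - 1).toNat)) (by simp only [lvl, Sum.elim_inl]; omega)).2, smul_zero]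

theorem mode_le_zero_of_isCreation {g : Gen K L} (hg : g.isCreation = true) : g.mode ≤ 0 := by
  cases g <;> simp only [Gen.isCreation, decide_eq_true_eq] at hg <;> simp only [Gen.mode] <;> omega

theorem nord_eq_zero (e : Module.Basis ι K L) {N : ℕ} : ∀ (l : List (Gen K L)) {w : W K ι},
    w ∈ low K ι N → (∃ g ∈ l, (N : ℤ) < g.mode) → nord e l w = 0
  | [], _, _, h => by simp at h
  | g :: l, w, hw, h => by
    by_cases hc : g.isCreation = true
    · have hm := mode_le_zero_of_isCreation hc
      have hl : ∃ g' ∈ l, (N : ℤ) < g'.mode := by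
        obtain ⟨g', h1, h2⟩ := h
        rcases List.mem_cons.1 h1 with rfl | h1
        · omega
        · exact ⟨g', h1, h2⟩
      simp [nord, hc, nord_eq_zero e l hw hl]
    · rw [Bool.not_eq_true] at hc
      simp only [nord, hc, Bool.false_eq_true, if_false, LinearMap.smul_apply, Module.End.mul_apply]
      by_cases hg : (N : ℤ) < g.mode
      · simp [op_eq_zero_of_mem_low e hg hw]
      · have hl : ∃ g' ∈ l, (N : ℤ) < g'.mode := by
          obtain ⟨g', h1, h2⟩ := h
          rcases List.mem_cons.1 h1 with rfl | h1
          · exact absurd h2 hg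
          · exact ⟨g', h1, h2⟩
        simp [nord_eq_zero e l (op_mem_low e hc hw) hl]

/-! ### The operators -/

/-- The term of `θ(u_n)` with summation index `m`. -/
def thetaTerm (e : Module.Basis ι K L) (u : L) (n m : ℤ) : Module.End K (W K ι) :=
  ∑ v, (nord e [.beta (n + m) ⁅u, e v⁆, .gamma (-m) (e.coord v)] +
    nord e [.b (n + m) ⁅u, e v⁆, .c (-m) (e.coord v)])

theorem locFin_theta (e : Module.Basis ι K L) (u : L) (n : ℤ) : LocFin (thetaTerm e u n) := by
  refine locFin_of_bound (fun N => Set.Icc (-(N : ℤ)) (N - n)) (fun N => Set.finite_Icc _ _) ?_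
  intro N m w hm hw
  have hm' : (N : ℤ) < n + m ∨ (N : ℤ) < -m := by
    simp only [Set.mem_Icc, not_and_or] at hm
    omega
  simp only [thetaTerm, LinearMap.sum_apply, LinearMap.add_apply]
  refine Finset.sum_eq_zero fun v _ => ?_
  rw [nord_eq_zero e _ hw (by simpa [Gen.mode] using hm'),
    nord_eq_zero e _ hw (by simpa [Gen.mode] using hm'), add_zero]

/-- The action `θ(u_n) = ∑ :β_{n+m}^{[u,v]} γ_{-m}^{v'}: + ∑ :b_{n+m}^{[u,v]} c_{-m}^{v'}:` of the
loop algebra, where `u_n = u ⊗ t^n`. -/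
def theta (e : Module.Basis ι K L) (u : L) (n : ℤ) : Module.End K (W K ι) :=
  locSum (thetaTerm e u n) (locFin_theta e u n)

/-- The term of `L_n` with summation index `m`. -/
def virTerm (e : Module.Basis ι K L) (n m : ℤ) : Module.End K (W K ι) :=
  -∑ u, (m : K) • (nord e [.b (n + m) (e u), .c (-m) (e.coord u)] +
    nord e [.beta (n + m) (e u), .gamma (-m) (e.coord u)])

theorem locFin_vir (e : Module.Basis ι K L) (n : ℤ) : LocFin (virTerm e n) := by
  refine locFin_of_bound (fun N => Set.Icc (-(N : ℤ)) (N - n)) (fun N => Set.finite_Icc _ _) ?_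
  intro N m w hm hw
  have hm' : (N : ℤ) < n + m ∨ (N : ℤ) < -m := by
    simp only [Set.mem_Icc, not_and_or] at hm
    omega
  simp only [virTerm, LinearMap.sum_apply, LinearMap.add_apply, LinearMap.neg_apply,
    LinearMap.smul_apply]
  rw [neg_eq_zero]
  refine Finset.sum_eq_zero fun v _ => ?_
  rw [nord_eq_zero e _ hw (by simpa [Gen.mode] using hm'),
    nord_eq_zero e _ hw (by simpa [Gen.mode] using hm'), add_zero, smul_zero]

/-- The Virasoro operator `L_n = -∑ m :b_{n+m}^u c_{-m}^{u'}: - ∑ m :β_{n+m}^u γ_{-m}^{u'}:`. -/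
def vir (e : Module.Basis ι K L) (n : ℤ) : Module.End K (W K ι) :=
  locSum (virTerm e n) (locFin_vir e n)

/-- The term of `Q` with summation indices `i`, `j`. -/
def QTerm (e : Module.Basis ι K L) (ij : ℤ × ℤ) : Module.End K (W K ι) :=
  ∑ u, ∑ v,
    (nord e [.beta (ij.1 + ij.2) ⁅e u, e v⁆, .gamma (-ij.1) (e.coord v), .c (-ij.2) (e.coord u)] +
      (1 / 2 : K) •
        nord e [.b (ij.1 + ij.2) ⁅e u, e v⁆, .c (-ij.1) (e.coord v), .c (-ij.2) (e.coord u)])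

theorem locFin_Q (e : Module.Basis ι K L) : LocFin (QTerm e) := by
  refine locFin_of_bound (fun N => Set.Icc (-(N : ℤ)) (2 * N) ×ˢ Set.Icc (-(N : ℤ)) (2 * N))
    (fun N => (Set.finite_Icc _ _).prod (Set.finite_Icc _ _)) ?_
  intro N ij w hm hw
  have hm' : (N : ℤ) < ij.1 + ij.2 ∨ (N : ℤ) < -ij.1 ∨ (N : ℤ) < -ij.2 := by
    simp only [Set.mem_prod, Set.mem_Icc, not_and_or] at hm
    omega
  simp only [QTerm, LinearMap.sum_apply, LinearMap.add_apply, LinearMap.smul_apply]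
  refine Finset.sum_eq_zero fun u _ => Finset.sum_eq_zero fun v _ => ?_
  rw [nord_eq_zero e _ hw (by simpa [Gen.mode] using hm'),
    nord_eq_zero e _ hw (by simpa [Gen.mode] using hm'), smul_zero, add_zero]

/-- The semi-infinite cohomology differential
`Q = ∑ :β_{i+j}^{[u,v]} γ_{-i}^{v'} c_{-j}^{u'}: + (1/2) ∑ :b_{i+j}^{[u,v]} c_{-i}^{v'} c_{-j}^{u'}:`,
the sums being over all basis vectors `u`, `v` and all integers `i`, `j`. -/
def Q (e : Module.Basis ι K L) : Module.End K (W K ι) := locSum (QTerm e) (locFin_Q e)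

/-- The term of the Koszul differential with summation index `n`. -/
def koszulTerm (e : Module.Basis ι K L) (n : ℤ) : Module.End K (W K ι) :=
  ∑ u, nord e [.gamma (-n) (e.coord u), .b n (e u)]

theorem locFin_koszul (e : Module.Basis ι K L) : LocFin (koszulTerm e) := by
  refine locFin_of_bound (fun N => Set.Icc (-(N : ℤ)) N) (fun N => Set.finite_Icc _ _) ?_
  intro N n w hn hw
  have hn' : (N : ℤ) < -n ∨ (N : ℤ) < n := by
    simp only [Set.mem_Icc, not_and_or] at hn
    omega
  simp only [koszulTerm, LinearMap.sum_apply]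
  exact Finset.sum_eq_zero fun v _ => nord_eq_zero e _ hw (by simpa [Gen.mode] using hn')

/-- The Koszul differential `h = ∑ γ_{-n}^{u'} b_n^u`. -/
def koszul (e : Module.Basis ι K L) : Module.End K (W K ι) :=
  locSum (koszulTerm e) (locFin_koszul e)

/-- The term of the homotopy operator `k` with summation index `n`. -/
def homotTerm (e : Module.Basis ι K L) (n : ℤ) : Module.End K (W K ι) :=
  ∑ u, (n : K) • nord e [.beta n (e u), .c (-n) (e.coord u)]

theorem locFin_homot (e : Module.Basis ι K L) : LocFin (homotTerm e) := by
  refine locFin_of_bound (fun N => Set.Icc (-(N : ℤ)) N) (fun N => Set.finite_Icc _ _) ?_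
  intro N n w hn hw
  have hn' : (N : ℤ) < n ∨ (N : ℤ) < -n := by
    simp only [Set.mem_Icc, not_and_or] at hn
    omega
  simp only [homotTerm, LinearMap.sum_apply, LinearMap.smul_apply]
  exact Finset.sum_eq_zero fun v _ => by
    rw [nord_eq_zero e _ hw (by simpa [Gen.mode] using hn'), smul_zero]

/-- The homotopy operator `k = ∑ n β_n^u c_{-n}^{u'}`. -/
def homot (e : Module.Basis ι K L) : Module.End K (W K ι) :=
  locSum (homotTerm e) (locFin_homot e)

/-! ### Invariants -/

/-- The classical Weil algebra: the span of the monomials in `c_0^f` and `γ_0^f`. -/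
def classical (e : Module.Basis ι K L) : Submodule K (W K ι) :=
  Submodule.span K {w | ∃ l : List (Gen K L),
    (∀ g ∈ l, ∃ f : Module.Dual K L, g = .c 0 f ∨ g = .gamma 0 f) ∧ w = str e l (vac K ι)}

/-- A copy of the adjoint or coadjoint module among the bosonic creation operators: `beta n` stands
for `{β_{-n-1}^u : u ∈ L}` and `gamma n` for `{γ_{-n}^f : f ∈ L'}`, with `n ≥ 0`. -/
inductive SymCopy where
  | beta (n : ℕ)
  | gamma (n : ℕ)

/-- The generator belongs to the given copy. -/
def Gen.InCopy (g : Gen K L) : SymCopy → Prop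
  | .beta n => ∃ u : L, g = .beta (-(n : ℤ) - 1) u
  | .gamma n => ∃ f : Module.Dual K L, g = .gamma (-(n : ℤ)) f

/-- The span of the states `g₁ ⋯ g_d 1` with `g_i` in the `i`-th copy of the list `s`. -/
def multiHom (e : Module.Basis ι K L) (s : List SymCopy) : Submodule K (W K ι) :=
  Submodule.span K {w | ∃ l : List (Gen K L), List.Forall₂ Gen.InCopy l s ∧ w = str e l (vac K ι)}

/-- Invariance under the action of `L ⊗ t^0 = L`. -/
def IsInvariant (e : Module.Basis ι K L) (w : W K ι) : Prop := ∀ u : L, theta e u 0 w = 0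

/-- A purely symmetric invariant generator of degree `d`: a nonzero invariant state that is
multihomogeneous of degree `d` in the `β` and `γ` creation operators, that is, linear in each of `d`
prescribed (not necessarily distinct) copies of the adjoint or coadjoint module. -/
def IsPureSymGen (e : Module.Basis ι K L) (d : ℕ) (w : W K ι) : Prop :=
  w ≠ 0 ∧ IsInvariant e w ∧ ∃ s : List SymCopy, s.length = d ∧ w ∈ multiHom e s

end Operators

/-! ### The case of `sl(2)`: a basis `e` with `e 0 = x`, `e 1 = y`, `e 2 = h` -/

section SL2

variable {K L : Type*} [Field K] [LieRing L] [LieAlgebra K L]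

/-- The states `v^{(1)}1, …, v^{(5)}1` (indexed from `0`). -/
def v (e : Module.Basis (Fin 3) K L) : Fin 5 → W K (Fin 3) :=
  let x := e 0
  let y := e 1
  let h := e 2
  let x' := e.coord 0
  let y' := e.coord 1
  let h' := e.coord 2
  let one := vac K (Fin 3)
  ![str e [.beta (-1) h, .beta (-1) h] one + (4 : K) • str e [.beta (-1) x, .beta (-1) y] one,
    str e [.beta (-1) h, .beta (-2) h] one + (2 : K) • str e [.beta (-1) x, .beta (-2) y] one
      + (2 : K) • str e [.beta (-1) y, .beta (-2) x] one,
    str e [.gamma 0 h', .gamma 0 h'] one + str e [.gamma 0 x', .gamma 0 y'] one,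
    str e [.gamma 0 h', .gamma (-1) h'] one + (1 / 2 : K) • str e [.gamma 0 x', .gamma (-1) y'] one
      + (1 / 2 : K) • str e [.gamma 0 y', .gamma (-1) x'] one,
    str e [.beta (-1) h, .gamma 0 h'] one + str e [.beta (-1) x, .gamma 0 x'] one
      + str e [.beta (-1) y, .gamma 0 y'] one]

/-- The isomorphism `φ : L → L'` given by the invariant form with `⟨x, y⟩ = 1/2`, `⟨h, h⟩ = 1`:
`x ↦ y'/2`, `y ↦ x'/2`, `h ↦ h'`. -/
def phi (e : Module.Basis (Fin 3) K L) : L →ₗ[K] Module.Dual K L :=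
  e.constr K ![(1 / 2 : K) • e.coord 1, (1 / 2 : K) • e.coord 0, e.coord 2]

/-- The inverse isomorphism `φ⁻¹ : L' → L`: `x' ↦ 2y`, `y' ↦ 2x`, `h' ↦ h`. -/
def phiInv (e : Module.Basis (Fin 3) K L) : Module.Dual K L →ₗ[K] L :=
  e.dualBasis.constr K ![(2 : K) • e 1, (2 : K) • e 0, e 2]

/-- The state `h = ∑ γ_0^{u'} b_{-1}^u 1`. -/
def hState (e : Module.Basis (Fin 3) K L) : W K (Fin 3) :=
  ∑ u, str e [.gamma 0 (e.coord u), .b (-1) (e u)] (vac K (Fin 3))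

/-- The state `r = ∑ γ_0^{φ(u)} c_{-1}^{u'} 1`. -/
def rState (e : Module.Basis (Fin 3) K L) : W K (Fin 3) :=
  ∑ u, str e [.gamma 0 (phi e (e u)), .c (-1) (e.coord u)] (vac K (Fin 3))

/-- The state `t = ∑ β_{-1}^{φ⁻¹(u')} b_{-1}^u 1`. -/
def tState (e : Module.Basis (Fin 3) K L) : W K (Fin 3) :=
  ∑ u, str e [.beta (-1) (phiInv e (e.coord u)), .b (-1) (e u)] (vac K (Fin 3))

end SL2

end VOWA

end

/-! On a state w without fermions every term of Q with a fermionic annihilation operator drops out,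
so Q w is the sum of c_{-j}^{u'} θ(u_j) w over j ≥ 0 and the basis (`IsBosonic.Q_apply`). Conversely
{Q, b_j^u} = θ(u_j) (`op_b_Q`), and b_j kills w for j ≥ 0. Hence a purely symmetric state is
Q-closed exactly when θ(u_j) w = 0 for all u and all j ≥ 0, that is, when it is invariant under
ℓ[t].

The invariant form `phi` identifies ℓ' with ℓ, so that β and γ both become currents X_n^a with
[θ(u_j), X_n^a] = X_{n-j}^{[u,a]}; negative levels kill the vacuum. The coefficients of a
multihomogeneous state, read off by dual annihilation operators, are multilinear forms on ℓ, and j =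
0 makes them invariant.

In degree 2 the form is a multiple of `phi`, so the state is a multiple of `quad e s t`. The
condition for j = 1 can hold only if a copy of positive level is lowered onto the other copy, where
symmetry of the product cancels the result; this leaves five pairs of copies
(`IsSL2Basis.exists_eq_smul_v`). In degree 3 the form is a multiple of the determinant. It vanishes
unless the three copies are distinct; then one of them has positive level, and j = 1 kills the
coefficient (`IsSL2Basis.eq_zero_of_cubic`).

Non-exactness is detected by functionals "apply annihilation operators, then take the vacuum
coefficient". The modes in each term of Q add up to zero, so each term contains a creation operator
and has no vacuum coefficient; only contractions with the applied operators can contribute, and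
pairing with the invariant tensor cancels those that remain. Closedness of t and h follows from {Q,
b_{-1}^a} = θ(a_{-1}), that of r from {Q, c_{-1}^f}. The infinite families are separated by the
operators `num`, which count the factors from each copy. -/

noncomputable section

namespace VOWA

/-- The additive group structure of `W`, with an additive monoid structure that unifies with that
of the tensor product without unfolding. -/
scoped instance instAddCommGroupW {K ι : Type*} [Field K] : AddCommGroup (W K ι) :=
  { (TensorProduct.addCommMonoid : AddCommMonoid (W K ι)) with
    neg := fun a => -a
    sub := fun a b => a - b
    sub_eq_add_neg := fun a b => sub_eq_add_neg a b
    zsmul := fun n a => n • a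
    zsmul_zero' := fun a => zero_zsmul a
    zsmul_succ' := fun n a => SubNegMonoid.zsmul_succ' n a
    zsmul_neg' := fun n a => SubNegMonoid.zsmul_neg' n a
    neg_add_cancel := fun a => neg_add_cancel a }

/-! ### Canonical relations for the generators attached to basis vectors. -/

section Fock

variable {K ι : Type*} [Field K]

theorem symMul_symMul (i j : Var ι) (w : W K ι) :
    symMul i (symMul j w) = symMul j (symMul i w) := by
  induction w using TensorProduct.induction_on with
  | zero => simp
  | tmul p q => simp [symMul, mul_left_comm]
  | add a b ha hb => simp only [map_add, ha, hb]

theorem symDer_symMul (i j : Var ι) (w : W K ι) :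
    symDer i (symMul j w) =
      symMul j (symDer i w) + (Finsupp.single j (1 : K) i) • w := by
  classical
  induction w using TensorProduct.induction_on with
  | zero => simp
  | tmul p q =>
    simp [symMul, symDer, Derivation.leibniz, MvPolynomial.pderiv_X, Pi.single_apply,
      Finsupp.single_apply, TensorProduct.add_tmul]
    split_ifs <;> simp_all
  | add a b ha hb => simp only [map_add, ha, hb, smul_add]; abel

theorem extMul_extMul (i j : Var ι) (w : W K ι) :
    extMul i (extMul j w) = -extMul j (extMul i w) := by
  induction w using TensorProduct.induction_on with
  | zero => simp
  | tmul p q =>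
    have h : (ExteriorAlgebra.ι K (Finsupp.single i (1 : K) : Var ι →₀ K)) *
        ExteriorAlgebra.ι K (Finsupp.single j (1 : K)) =
        -(ExteriorAlgebra.ι K (Finsupp.single j (1 : K)) *
          ExteriorAlgebra.ι K (Finsupp.single i (1 : K))) :=
      eq_neg_of_add_eq_zero_left (ExteriorAlgebra.ι_add_mul_swap _ _)
    simp only [extMul, LinearMap.lTensor_tmul, LinearMap.mulLeft_apply]
    rw [← mul_assoc, ← mul_assoc, h, neg_mul, TensorProduct.tmul_neg]
  | add a b ha hb => simp only [map_add, ha, hb, neg_add]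

theorem extDer_extMul (i j : Var ι) (w : W K ι) :
    extDer i (extMul j w) =
      -extMul j (extDer i w) + (Finsupp.single j (1 : K) i) • w := by
  induction w using TensorProduct.induction_on with
  | zero => simp
  | tmul p q =>
    simp only [extMul, extDer, LinearMap.lTensor_tmul, LinearMap.mulLeft_apply]
    have h := CliffordAlgebra.contractLeft_ι_mul (Q := (0 : QuadraticForm K (Var ι →₀ K)))
      (d := (Finsupp.lapply i : (Var ι →₀ K) →ₗ[K] K)) (Finsupp.single j (1 : K)) q
    erw [h]
    rw [TensorProduct.tmul_sub, TensorProduct.tmul_smul, Finsupp.lapply_apply, sub_eq_neg_add]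
  | add a b ha hb => simp only [map_add, ha, hb, smul_add]; abel

theorem symMul_extMul (i j : Var ι) (w : W K ι) :
    symMul i (extMul j w) = extMul j (symMul i w) := by
  induction w using TensorProduct.induction_on with
  | zero => simp
  | tmul p q => simp [symMul, extMul]
  | add a b ha hb => simp only [map_add, ha, hb]

theorem symMul_extDer (i j : Var ι) (w : W K ι) :
    symMul i (extDer j w) = extDer j (symMul i w) := by
  induction w using TensorProduct.induction_on with
  | zero => simp
  | tmul p q => simp [symMul, extDer]
  | add a b ha hb => simp only [map_add, ha, hb]

theorem symDer_extMul (i j : Var ι) (w : W K ι) :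
    symDer i (extMul j w) = extMul j (symDer i w) := by
  induction w using TensorProduct.induction_on with
  | zero => simp
  | tmul p q => simp [symDer, extMul]
  | add a b ha hb => simp only [map_add, ha, hb]

theorem symDer_vac (i : Var ι) : symDer i (vac K ι) = 0 := by simp [symDer, vac]

theorem extDer_vac (i : Var ι) : extDer i (vac K ι) = 0 := by
  simp only [extDer, vac, LinearMap.lTensor_tmul]
  erw [CliffordAlgebra.contractLeft_one]
  simp

/-- The coefficient of the vacuum. -/
def vacCoeff (K ι : Type*) [Field K] : W K ι →ₗ[K] K :=
  LinearMap.mul' K K ∘ₗ TensorProduct.map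
    ((MvPolynomial.aeval (fun _ => (0 : K)) : SymMod K ι →ₐ[K] K) : SymMod K ι →ₗ[K] K)
    ((ExteriorAlgebra.algebraMapInv : ExtMod K ι →ₐ[K] K) : ExtMod K ι →ₗ[K] K)

theorem vacCoeff_vac : vacCoeff K ι (vac K ι) = 1 := by simp [vacCoeff, vac]

theorem vacCoeff_symMul (i : Var ι) (w : W K ι) : vacCoeff K ι (symMul i w) = 0 := by
  induction w using TensorProduct.induction_on with
  | zero => simp
  | tmul p q => simp [symMul, vacCoeff]
  | add a b ha hb => simp only [map_add, ha, hb, add_zero]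

theorem vacCoeff_extMul (i : Var ι) (w : W K ι) : vacCoeff K ι (extMul i w) = 0 := by
  induction w using TensorProduct.induction_on with
  | zero => simp
  | tmul p q => simp [extMul, vacCoeff, ExteriorAlgebra.algebraMapInv]
  | add a b ha hb => simp only [map_add, ha, hb, add_zero]

/-- Of two generators with opposite modes exactly one differentiates, in the variable of the other.
The minus sign in `betaB` at nonnegative modes makes the scalar the same whichever of the two it is.
-/
theorem gammaB_betaB (n m : ℤ) (i j : ι) (w : W K ι) :
    gammaB n i (betaB m j w) =
      betaB m j (gammaB n i w) + (if n + m = 0 then Finsupp.single j (1 : K) i else 0) • w := by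
  classical
  unfold gammaB betaB
  split_ifs with h1 h2 h3 h3 h2 h3 h3 <;> try omega
  · rw [symMul_symMul]; simp
  · simp only [LinearMap.neg_apply, map_neg, symDer_symMul]
    have : (-n).toNat = m.toNat := by omega
    simp [Finsupp.single_apply, this, eq_comm]
  · simp only [LinearMap.neg_apply, map_neg, symDer_symMul]
    have : ¬ (-n).toNat = m.toNat := by omega
    simp [Sum.inr.injEq, Prod.mk.injEq, this]
  · simp only [symDer_symMul]
    have : (-m - 1).toNat = (n - 1).toNat := by omega
    simp [Finsupp.single_apply, Prod.mk.injEq, this]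
  · simp only [symDer_symMul]
    have : ¬ (-m - 1).toNat = (n - 1).toNat := by omega
    simp only [Finsupp.single_apply, Sum.inl.injEq, Prod.mk.injEq, this, and_false, if_false,
      zero_smul]
  · simp [symDer_symDer]

theorem cB_bB (n m : ℤ) (i j : ι) (w : W K ι) :
    cB n i (bB m j w) =
      -bB m j (cB n i w) + (if n + m = 0 then Finsupp.single j (1 : K) i else 0) • w := by
  classical
  unfold cB bB
  split_ifs with h1 h2 h3 h3 h2 h3 h3 <;> try omega
  · rw [extMul_extMul]; simp
  · simp only [extDer_extMul]
    have : (-n).toNat = m.toNat := by omega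
    simp [Finsupp.single_apply, this, eq_comm]
  · simp only [extDer_extMul]
    have : ¬ (-n).toNat = m.toNat := by omega
    simp [Sum.inr.injEq, Prod.mk.injEq, this]
  · simp only [extDer_extMul]
    have : (-m - 1).toNat = (n - 1).toNat := by omega
    simp [Finsupp.single_apply, Prod.mk.injEq, this]
  · simp only [extDer_extMul]
    have : ¬ (-m - 1).toNat = (n - 1).toNat := by omega
    simp only [Finsupp.single_apply, Sum.inl.injEq, Prod.mk.injEq, this, and_false, if_false,
      zero_smul]
  · rw [extDer_extDer]; simp

theorem betaB_betaB (n m : ℤ) (i j : ι) (w : W K ι) :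
    betaB n i (betaB m j w) = betaB m j (betaB n i w) := by
  unfold betaB
  split_ifs
  · rw [symMul_symMul]
  · simp [symDer_symMul]
  · simp [symDer_symMul]
  · simp only [LinearMap.neg_apply, map_neg, neg_neg]; rw [symDer_symDer]

theorem gammaB_gammaB (n m : ℤ) (i j : ι) (w : W K ι) :
    gammaB n i (gammaB m j w) = gammaB m j (gammaB n i w) := by
  unfold gammaB
  split_ifs
  · rw [symMul_symMul]
  · simp [symDer_symMul]
  · simp [symDer_symMul]
  · rw [symDer_symDer]

theorem bB_bB (n m : ℤ) (i j : ι) (w : W K ι) :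
    bB n i (bB m j w) = -bB m j (bB n i w) := by
  unfold bB
  split_ifs
  · rw [extMul_extMul]
  · simp [extDer_extMul]
  · simp [extDer_extMul]
  · rw [extDer_extDer]

theorem cB_cB (n m : ℤ) (i j : ι) (w : W K ι) :
    cB n i (cB m j w) = -cB m j (cB n i w) := by
  unfold cB
  split_ifs
  · rw [extMul_extMul]
  · simp [extDer_extMul]
  · simp [extDer_extMul]
  · rw [extDer_extDer]

theorem betaB_bB (n m : ℤ) (i j : ι) (w : W K ι) :
    betaB n i (bB m j w) = bB m j (betaB n i w) := by
  unfold betaB bB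
  split_ifs <;> simp [symMul_extMul, symMul_extDer, symDer_extMul, symDer_extDer]

theorem betaB_cB (n m : ℤ) (i j : ι) (w : W K ι) :
    betaB n i (cB m j w) = cB m j (betaB n i w) := by
  unfold betaB cB
  split_ifs <;> simp [symMul_extMul, symMul_extDer, symDer_extMul, symDer_extDer]

theorem gammaB_bB (n m : ℤ) (i j : ι) (w : W K ι) :
    gammaB n i (bB m j w) = bB m j (gammaB n i w) := by
  unfold gammaB bB
  split_ifs <;> simp [symMul_extMul, symMul_extDer, symDer_extMul, symDer_extDer]

theorem gammaB_cB (n m : ℤ) (i j : ι) (w : W K ι) :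
    gammaB n i (cB m j w) = cB m j (gammaB n i w) := by
  unfold gammaB cB
  split_ifs <;> simp [symMul_extMul, symMul_extDer, symDer_extMul, symDer_extDer]

end Fock

/-! ### Supercommutators of generators and normally ordered products. -/

section Commutation

variable {K ι L : Type*} [Field K] [Fintype ι] [LieRing L] [LieAlgebra K L]

/-- The sign in the supercommutator of two generators. -/
def koszulSign (g a : Gen K L) : K := if g.isOdd && a.isOdd then -1 else 1

/-- The value of the supercommutator of two generators. -/
def contraction : Gen K L → Gen K L → K
  | .gamma n f, .beta m u => if n + m = 0 then f u else 0
  | .beta m u, .gamma n f => if n + m = 0 then -f u else 0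
  | .b m u, .c n f => if n + m = 0 then f u else 0
  | .c n f, .b m u => if n + m = 0 then f u else 0
  | _, _ => 0

/-- Bilinear extension of a relation from basis vectors: `s` is the sign and `p` the table of
contractions. -/
theorem sum_smul_comm_sum_smul (s : K) {A B : ι → Module.End K (W K ι)} (x y : ι → K)
    {p : ι → ι → K} {r : K}
    (h : ∀ i j w, A i (B j w) = s • B j (A i w) + p i j • w)
    (hr : ∑ i, ∑ j, x i * y j * p i j = r) :
    (∑ i, x i • A i) * (∑ j, y j • B j) =
      s • ((∑ j, y j • B j) * (∑ i, x i • A i)) + r • 1 := by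
  refine LinearMap.ext fun w => ?_
  simp only [Module.End.mul_apply, LinearMap.add_apply, LinearMap.smul_apply, Module.End.one_apply,
    LinearMap.sum_apply, map_sum, map_smul, h, ← hr, Finset.smul_sum, Finset.sum_smul, smul_add,
    Finset.sum_add_distrib, smul_smul]
  rw [Finset.sum_comm]
  congr 1
  · refine Finset.sum_congr rfl fun j _ => Finset.sum_congr rfl fun i _ => ?_
    ring_nf
  · rw [Finset.sum_comm]
    refine Finset.sum_congr rfl fun j _ => Finset.sum_congr rfl fun i _ => ?_
    ring_nf

theorem sum_coord_pairing (e : Module.Basis ι K L) (f : Module.Dual K L) (u : L) :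
    ∑ i, ∑ j, f (e i) * e.repr u j * (Finsupp.single j (1 : K) i) = f u := by
  classical
  conv_rhs => rw [← e.sum_repr u]
  simp [Finsupp.single_apply, mul_comm, map_sum, -Module.Basis.sum_repr]

theorem op_mul_op (e : Module.Basis ι K L) (g a : Gen K L) :
    op e g * op e a = koszulSign g a • (op e a * op e g) + contraction g a • 1 := by
  classical
  have hs := fun (f : Module.Dual K L) u => sum_coord_pairing e f u
  have hs' : ∀ (f : Module.Dual K L) u, ∑ j, ∑ i, f (e i) * e.repr u j *
      (Finsupp.single j (1 : K) i) = f u := fun f u => by rw [Finset.sum_comm, hs]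
  cases g <;> cases a <;>
    simp only [op, koszulSign, contraction, Gen.isOdd, Bool.and_self, Bool.and_false,
      Bool.and_true, Bool.false_eq_true, if_true, if_false]
  · exact sum_smul_comm_sum_smul 1 (p := fun _ _ => 0) _ _ (by simp [betaB_betaB]) (by simp)
  · rename_i m u n f
    refine sum_smul_comm_sum_smul 1
      (p := fun j i => if n + m = 0 then -Finsupp.single j (1 : K) i else 0) _ _ ?_ ?_
    · intro i j w
      rw [gammaB_betaB n m]
      split_ifs <;> simp
    · split_ifs
      · rw [← hs' f u]
        simp only [← Finset.sum_neg_distrib]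
        refine Finset.sum_congr rfl fun j _ => Finset.sum_congr rfl fun i _ => by ring
      · simp
  · exact sum_smul_comm_sum_smul 1 (p := fun _ _ => 0) _ _ (by simp [betaB_bB]) (by simp)
  · exact sum_smul_comm_sum_smul 1 (p := fun _ _ => 0) _ _ (by simp [betaB_cB]) (by simp)
  · rename_i n f m u
    refine sum_smul_comm_sum_smul 1
      (p := fun i j => if n + m = 0 then Finsupp.single j (1 : K) i else 0) _ _ ?_ ?_
    · intro i j w
      rw [gammaB_betaB, one_smul]
    · split_ifs
      · exact hs f u
      · simp
  · exact sum_smul_comm_sum_smul 1 (p := fun _ _ => 0) _ _ (by simp [gammaB_gammaB]) (by simp)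
  · exact sum_smul_comm_sum_smul 1 (p := fun _ _ => 0) _ _ (by simp [gammaB_bB]) (by simp)
  · exact sum_smul_comm_sum_smul 1 (p := fun _ _ => 0) _ _ (by simp [gammaB_cB]) (by simp)
  · exact sum_smul_comm_sum_smul 1 (p := fun _ _ => 0) _ _ (by simp [betaB_bB]) (by simp)
  · exact sum_smul_comm_sum_smul 1 (p := fun _ _ => 0) _ _ (by simp [gammaB_bB]) (by simp)
  · exact sum_smul_comm_sum_smul (-1) (p := fun _ _ => 0) _ _
      (fun i j w => by rw [bB_bB]; simp) (by simp)
  · rename_i m u n f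
    refine sum_smul_comm_sum_smul (-1)
      (p := fun j i => if n + m = 0 then Finsupp.single j (1 : K) i else 0) _ _ ?_ ?_
    · intro i j w
      rw [cB_bB]
      split_ifs <;> simp
    · split_ifs
      · rw [← hs' f u]
        refine Finset.sum_congr rfl fun j _ => Finset.sum_congr rfl fun i _ => by ring
      · simp
  · exact sum_smul_comm_sum_smul 1 (p := fun _ _ => 0) _ _ (by simp [betaB_cB]) (by simp)
  · exact sum_smul_comm_sum_smul 1 (p := fun _ _ => 0) _ _ (by simp [gammaB_cB]) (by simp)
  · rename_i n f m u
    refine sum_smul_comm_sum_smul (-1)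
      (p := fun i j => if n + m = 0 then Finsupp.single j (1 : K) i else 0) _ _ ?_ ?_
    · intro i j w
      rw [cB_bB, neg_smul, one_smul]
    · split_ifs
      · exact hs f u
      · simp
  · exact sum_smul_comm_sum_smul (-1) (p := fun _ _ => 0) _ _
      (fun i j w => by rw [cB_cB]; simp) (by simp)

/-- A nonzero contraction forces both generators to have the same parity, so they have the same sign
against any third one. -/
theorem koszulSign_mul_contraction (g a b : Gen K L) :
    koszulSign a b * contraction g b = koszulSign g a * contraction g b := by
  cases g <;> cases a <;> cases b <;> simp [koszulSign, contraction, Gen.isOdd]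

theorem koszulSign_mul_koszulSign_mul_contraction (g a b : Gen K L) :
    koszulSign a b * koszulSign g b * contraction g a = contraction g a := by
  cases g <;> cases a <;> cases b <;> simp [koszulSign, contraction, Gen.isOdd]

theorem nord_singleton (e : Module.Basis ι K L) (a : Gen K L) : nord e [a] = op e a := by
  simp [nord]

theorem nord_pair_of_isCreation (e : Module.Basis ι K L) {a : Gen K L} (h : a.isCreation = true)
    (b : Gen K L) : nord e [a, b] = op e a * op e b := by
  rw [nord, if_pos h, nord_singleton]

theorem nord_pair_of_not_isCreation (e : Module.Basis ι K L) {a : Gen K L}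
    (h : ¬ a.isCreation = true) (b : Gen K L) :
    nord e [a, b] = koszulSign a b • (op e b * op e a) := by
  rw [nord, if_neg h, nord_singleton]
  congr 1
  cases a <;> cases b <;> simp [koszulSign, Gen.isOdd]

theorem nord_triple_of_isCreation (e : Module.Basis ι K L) {a : Gen K L} (h : a.isCreation = true)
    (b c : Gen K L) : nord e [a, b, c] = op e a * nord e [b, c] := by
  rw [nord, if_pos h]

theorem nord_triple_of_not_isCreation (e : Module.Basis ι K L) {a : Gen K L}
    (h : ¬ a.isCreation = true) (b c : Gen K L) :
    nord e [a, b, c] = (koszulSign a b * koszulSign a c) • (nord e [b, c] * op e a) := by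
  rw [nord, if_neg h]
  congr 1
  cases a <;> cases b <;> cases c <;> simp [koszulSign, Gen.isOdd, List.countP_cons]

/-- A generator passes through a normally ordered pair up to its contractions. -/
theorem op_mul_nord_pair (e : Module.Basis ι K L) (g a b : Gen K L) :
    op e g * nord e [a, b] = (koszulSign g a * koszulSign g b) • (nord e [a, b] * op e g) +
      contraction g a • op e b + (koszulSign g a * contraction g b) • op e a := by
  have ha := op_mul_op e g a
  have hb := op_mul_op e g b
  by_cases h : a.isCreation = true
  · rw [nord_pair_of_isCreation e h, ← mul_assoc, ha, add_mul, smul_mul_assoc, mul_assoc, hb]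
    simp only [mul_add, mul_smul_comm, smul_add, smul_smul, mul_assoc, smul_mul_assoc, one_mul,
      mul_one]
    abel
  · have h1 := koszulSign_mul_contraction g a b
    have h2 := koszulSign_mul_koszulSign_mul_contraction g a b
    rw [nord_pair_of_not_isCreation e h, mul_smul_comm, ← mul_assoc, hb, add_mul, smul_mul_assoc,
      mul_assoc, ha, ← h1]
    -- Before it meets `a`, the operator `g` has passed `b`, and `a` itself was moved past `b`; on
    -- the support of the contraction these two signs cancel.
    conv_rhs => rw [← h2]
    simp only [mul_add, mul_smul_comm, smul_add, smul_smul, mul_assoc, smul_mul_assoc, one_mul,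
      mul_one]
    module

/-- A generator passes through a normally ordered triple up to its contractions. -/
theorem op_mul_nord_triple (e : Module.Basis ι K L) (g a b c : Gen K L) :
    op e g * nord e [a, b, c] =
      (koszulSign g a * koszulSign g b * koszulSign g c) • (nord e [a, b, c] * op e g) +
      contraction g a • nord e [b, c] + (koszulSign g a * contraction g b) • nord e [a, c] +
      (koszulSign g a * koszulSign g b * contraction g c) • nord e [a, b] := by
  have ha := op_mul_op e g a
  have hbc := op_mul_nord_pair e g b c
  by_cases h : a.isCreation = true
  · rw [nord_triple_of_isCreation e h, nord_pair_of_isCreation e h, nord_pair_of_isCreation e h,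
      ← mul_assoc, ha, add_mul, smul_mul_assoc, mul_assoc, hbc]
    simp only [mul_add, mul_smul_comm, smul_add, smul_smul, mul_assoc, smul_mul_assoc, one_mul]
    module
  · have h1 := koszulSign_mul_contraction g a b
    have h2 := koszulSign_mul_contraction g a c
    have h3 := koszulSign_mul_koszulSign_mul_contraction g a b
    have h4 := koszulSign_mul_koszulSign_mul_contraction g a c
    rw [nord_triple_of_not_isCreation e h, nord_pair_of_not_isCreation e h,
      nord_pair_of_not_isCreation e h, mul_smul_comm, ← mul_assoc, hbc]
    simp only [add_mul, smul_mul_assoc, mul_assoc, ha]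
    simp only [mul_add, mul_smul_comm, smul_add, smul_smul, mul_assoc, mul_one]
    -- `h3` and `h4` remove the signs for passing `b` and `c` from the term contracted with `a`;
    -- `h1` and `h2` convert the signs of the terms contracted with `b` and `c`.
    linear_combination (norm := module) (koszulSign a c * koszulSign g c) • h3 • nord e [b, c] +
      h4 • nord e [b, c] + koszulSign a c • h1 • (op e c * op e a) +
      (koszulSign a b * koszulSign g b) • h2 • (op e b * op e a)

theorem op_vac (e : Module.Basis ι K L) {g : Gen K L} (h : g.isCreation = false) :
    op e g (vac K ι) = 0 := by
  cases g <;> simp only [Gen.isCreation, decide_eq_false_iff_not] at h <;>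
    simp [op, betaB, gammaB, bB, cB, h, symDer_vac, extDer_vac]

theorem nord_vac (e : Module.Basis ι K L) : ∀ {l : List (Gen K L)},
    (∃ g ∈ l, g.isCreation = false) → nord e l (vac K ι) = 0
  | [], h => by simp at h
  | g :: l, h => by
    by_cases hc : g.isCreation = true
    · have hl : ∃ g ∈ l, g.isCreation = false := by
        obtain ⟨a, ha, h2⟩ := h
        rcases List.mem_cons.1 ha with rfl | ha
        · simp [hc] at h2
        · exact ⟨a, ha, h2⟩
      simp [nord, hc, nord_vac e hl]
    · simp only [Bool.not_eq_true] at hc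
      rw [nord, if_neg (by simp [hc]), LinearMap.smul_apply, Module.End.mul_apply, op_vac e hc,
        map_zero,
        smul_zero]

theorem vacCoeff_op (e : Module.Basis ι K L) {g : Gen K L} (h : g.isCreation = true) (w : W K ι) :
    vacCoeff K ι (op e g w) = 0 := by
  cases g <;> simp only [Gen.isCreation, decide_eq_true_eq] at h <;>
    simp [op, betaB, gammaB, bB, cB, h, vacCoeff_symMul, vacCoeff_extMul]

/-- Normal ordering places some creation operator leftmost, and its image has no vacuum component.
-/
theorem vacCoeff_nord (e : Module.Basis ι K L) : ∀ {l : List (Gen K L)},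
    (∃ g ∈ l, g.isCreation = true) → ∀ w, vacCoeff K ι (nord e l w) = 0
  | [], h, _ => by simp at h
  | g :: l, h, w => by
    by_cases hc : g.isCreation = true
    · simp [nord, hc, vacCoeff_op e hc]
    · have hl : ∃ g ∈ l, g.isCreation = true := by
        obtain ⟨a, ha, h2⟩ := h
        rcases List.mem_cons.1 ha with rfl | ha
        · exact absurd h2 hc
        · exact ⟨a, ha, h2⟩
      simp only [Bool.not_eq_true] at hc
      rw [nord, if_neg (by simp [hc]), LinearMap.smul_apply, Module.End.mul_apply, map_smul,
        vacCoeff_nord e hl, smul_zero]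

end Commutation

/-! ### Linearity of generators and normally ordered pairs in their argument. -/

section LinearFamilies

theorem end_neg_smul {K ι : Type*} [Field K] (c : K) (A : Module.End K (W K ι)) :
    (-c) • A = -(c • A) := by module

variable {K ι L : Type*} [Field K] [Fintype ι] [LieRing L] [LieAlgebra K L]

/-- `u ↦ β_n^u` as a linear map. -/
def betaOp (e : Module.Basis ι K L) (n : ℤ) : L →ₗ[K] Module.End K (W K ι) where
  toFun u := op e (.beta n u)
  map_add' u v := by simp [op, add_smul, Finset.sum_add_distrib]
  map_smul' r u := by simp [op, mul_smul, Finset.smul_sum]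

/-- `f ↦ γ_n^f` as a linear map. -/
def gammaOp (e : Module.Basis ι K L) (n : ℤ) : Module.Dual K L →ₗ[K] Module.End K (W K ι) where
  toFun f := op e (.gamma n f)
  map_add' u v := by simp [op, add_smul, Finset.sum_add_distrib]
  map_smul' r u := by simp [op, mul_smul, Finset.smul_sum]

/-- `u ↦ b_n^u` as a linear map. -/
def bOp (e : Module.Basis ι K L) (n : ℤ) : L →ₗ[K] Module.End K (W K ι) where
  toFun u := op e (.b n u)
  map_add' u v := by simp [op, add_smul, Finset.sum_add_distrib]
  map_smul' r u := by simp [op, mul_smul, Finset.smul_sum]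

/-- `f ↦ c_n^f` as a linear map. -/
def cOp (e : Module.Basis ι K L) (n : ℤ) : Module.Dual K L →ₗ[K] Module.End K (W K ι) where
  toFun f := op e (.c n f)
  map_add' u v := by simp [op, add_smul, Finset.sum_add_distrib]
  map_smul' r u := by simp [op, mul_smul, Finset.smul_sum]

theorem betaOp_apply (e : Module.Basis ι K L) (n : ℤ) (u : L) :
    betaOp e n u = op e (.beta n u) := rfl

theorem gammaOp_apply (e : Module.Basis ι K L) (n : ℤ) (f : Module.Dual K L) :
    gammaOp e n f = op e (.gamma n f) := rfl

theorem bOp_apply (e : Module.Basis ι K L) (n : ℤ) (u : L) : bOp e n u = op e (.b n u) := rfl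

theorem cOp_apply (e : Module.Basis ι K L) (n : ℤ) (f : Module.Dual K L) :
    cOp e n f = op e (.c n f) := rfl

variable {M : Type*} [AddCommGroup M] [Module K M]

/-- Used with operator-valued `F` to resum the basis expansions that contractions leave behind. -/
theorem sum_coord_smul_map (e : Module.Basis ι K L) (F : L →ₗ[K] M) (u : L) :
    ∑ i, e.coord i u • F (e i) = F u := by
  conv_rhs => rw [← e.sum_repr u]
  simp [-Module.Basis.sum_repr]

theorem sum_smul_map_coord (e : Module.Basis ι K L) (F : Module.Dual K L →ₗ[K] M)
    (f : Module.Dual K L) : ∑ i, f (e i) • F (e.coord i) = F f := by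
  classical
  have h : f = ∑ i, f (e i) • e.coord i := by
    refine e.ext fun j => ?_
    simp
  conv_rhs => rw [h, map_sum]
  simp only [map_smul]

/-- `u ↦ :β_n^u g:` as a linear map. -/
def nordBeta (e : Module.Basis ι K L) (n : ℤ) (g : Gen K L) :
    L →ₗ[K] Module.End K (W K ι) where
  toFun u := nord e [.beta n u, g]
  map_add' u v := by
    by_cases h : n < 0 <;>
      simp [nord, Gen.isCreation, h, ← betaOp_apply, Gen.isOdd, mul_add, add_mul]
  map_smul' r u := by
    by_cases h : n < 0 <;> simp [nord, Gen.isCreation, h, ← betaOp_apply, Gen.isOdd]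

/-- `u ↦ :b_n^u g:` as a linear map. -/
def nordB (e : Module.Basis ι K L) (n : ℤ) (g : Gen K L) :
    L →ₗ[K] Module.End K (W K ι) where
  toFun u := nord e [.b n u, g]
  map_add' u v := by
    by_cases h : n < 0
    · simp [nord, Gen.isCreation, h, ← bOp_apply, add_mul]
    · rw [nord_pair_of_not_isCreation _ (by simp [Gen.isCreation, h]),
        nord_pair_of_not_isCreation _ (by simp [Gen.isCreation, h]),
        nord_pair_of_not_isCreation _ (by simp [Gen.isCreation, h])]
      simp only [← bOp_apply, map_add, mul_add, smul_add]
      rfl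
  map_smul' r u := by
    by_cases h : n < 0
    · simp [nord, Gen.isCreation, h, ← bOp_apply]
    · rw [nord_pair_of_not_isCreation _ (by simp [Gen.isCreation, h]),
        nord_pair_of_not_isCreation _ (by simp [Gen.isCreation, h])]
      simp only [← bOp_apply, map_smul, mul_smul_comm, RingHom.id_apply]
      rw [smul_comm]
      rfl

theorem sum_coord_smul_nordBeta (e : Module.Basis ι K L) (n : ℤ) (g : Gen K L)
    (F : L →ₗ[K] L) (u : L) :
    ∑ i, e.coord i u • nord e [.beta n (F (e i)), g] = nord e [.beta n (F u), g] :=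
  sum_coord_smul_map e (nordBeta e n g ∘ₗ F) u

theorem sum_coord_smul_nordB (e : Module.Basis ι K L) (n : ℤ) (g : Gen K L)
    (F : L →ₗ[K] L) (u : L) :
    ∑ i, e.coord i u • nord e [.b n (F (e i)), g] = nord e [.b n (F u), g] :=
  sum_coord_smul_map e (nordB e n g ∘ₗ F) u

end LinearFamilies

/-! ### Commuting operators through locally finite sums. -/

section Sums

variable {K ι : Type*} [Field K]

/-- Passing an operator through a locally finite sum. -/
theorem map_locSum {α : Type*} {T : α → Module.End K (W K ι)} (hT : LocFin T)
    (A : Module.End K (W K ι)) (s : K) (T' : α → Module.End K (W K ι))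
    (h : ∀ a, A * T a = s • (T a * A) + T' a) (w : W K ι) :
    A (locSum T hT w) = s • locSum T hT (A w) + ∑ᶠ a, T' a w := by
  have h' : ∀ a, A (T a w) = s • T a (A w) + T' a w := fun a => by
    simpa using congrArg (fun B : Module.End K (W K ι) => B w) (h a)
  have h1 : (Function.support fun a => A (T a w)).Finite :=
    (hT w).subset fun a ha h0 => ha (by simp only [h0, map_zero])
  have h2 : (Function.support fun a => s • T a (A w)).Finite :=
    (hT (A w)).subset fun a ha h0 => ha (by simp only [h0, smul_zero])
  -- Local finiteness of `T'` need not be assumed: it is a difference of two locally finite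
  -- families.
  have h3 : (Function.support fun a => T' a w).Finite := by
    refine (h1.union h2).subset fun a ha => ?_
    by_contra hn
    simp only [Set.mem_union, Function.mem_support, not_or, not_not] at hn
    have := h' a
    rw [hn.1, hn.2, zero_add] at this
    exact ha this.symm
  change A (∑ᶠ a, T a w) = s • ∑ᶠ a, T a (A w) + _
  rw [map_finsum A (hT w), smul_finsum' _ (hT (A w)), ← finsum_add_distrib h2 h3]
  exact finsum_congr h'

theorem map_locSum_of_single {α : Type*} {T : α → Module.End K (W K ι)}
    (hT : LocFin T) (A : Module.End K (W K ι)) (a₀ : α) (T' : α → Module.End K (W K ι))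
    (h : ∀ a, A * T a = T a * A + T' a) (h₀ : ∀ a, a ≠ a₀ → T' a = 0) (w : W K ι) :
    A (locSum T hT w) = locSum T hT (A w) + T' a₀ w := by
  rw [map_locSum hT A 1 T' (fun a => by rw [one_smul, h]), one_smul,
    finsum_eq_single _ a₀ fun a ha => by rw [h₀ a ha, LinearMap.zero_apply]]

/-- Contracting b_n with a fermion of `Q` fixes one of the two summation indices; this collapses the
double sum. -/
theorem finsum_ite_snd {M : Type*} [AddCommMonoid M] (n : ℤ) (H : ℤ → M) :
    ∑ᶠ p : ℤ × ℤ, (if n = p.2 then H p.1 else 0) = ∑ᶠ i, H i := by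
  have hinj : Function.Injective fun i : ℤ => (i, n) := fun a b h => (Prod.mk.inj h).1
  have := finsum_mem_range (f := fun p : ℤ × ℤ => H p.1) hinj
  rw [← this, finsum_mem_def]
  refine finsum_congr fun p => ?_
  rcases p with ⟨i, j⟩
  by_cases h : n = j
  · subst h
    rw [if_pos rfl, Set.indicator_of_mem (Set.mem_range_self i)]
  · rw [if_neg h, Set.indicator_of_notMem]
    rintro ⟨k, hk⟩
    exact h (Prod.mk.inj hk).2

theorem finsum_ite_fst {M : Type*} [AddCommMonoid M] (n : ℤ) (H : ℤ → M) :
    ∑ᶠ p : ℤ × ℤ, (if n = p.1 then H p.2 else 0) = ∑ᶠ i, H i := by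
  rw [← finsum_ite_snd n H]
  exact (finsum_comp_equiv (Equiv.prodComm ℤ ℤ)
    (f := fun p : ℤ × ℤ => if n = p.1 then H p.2 else 0)).symm

end Sums

/-! ### Brackets of θ, L_n, h and k with the bosonic generators, and their action on the vacuum. -/

section Commutators

variable {K ι L : Type*} [Field K] [Fintype ι] [LieRing L] [LieAlgebra K L]

/-- The only contraction is with the γ of the bosonic pair, in the single term with opposite mode.
The sum over the basis reassembles the bracket, and the sign is that of [β, γ] = -[γ, β]. -/
theorem op_beta_mul_thetaTerm (e : Module.Basis ι K L) (n : ℤ) (x u : L) (j m : ℤ) :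
    op e (.beta n x) * thetaTerm e u j m = thetaTerm e u j m * op e (.beta n x) +
      if m = n then -op e (.beta (j + n) ⁅u, x⁆) else 0 := by
  have h := sum_coord_smul_map e (betaOp e (j + n) ∘ₗ (LieAlgebra.ad K L u : L →ₗ[K] L)) x
  simp only [LinearMap.comp_apply, LieAlgebra.ad_apply, betaOp_apply] at h
  simp only [thetaTerm, Finset.mul_sum, Finset.sum_mul, mul_add, add_mul, op_mul_nord_pair,
    koszulSign, contraction, Gen.isOdd, Bool.and_self, Bool.and_true, Bool.false_eq_true, if_false]
  simp only [one_smul, zero_smul, mul_zero, add_zero, one_mul, Finset.sum_add_distrib]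
  split_ifs with h1 h2 h2
  · subst h2
    rw [← h, ← Finset.sum_neg_distrib]
    simp only [end_neg_smul]
    abel
  · omega
  · omega
  · simp

theorem op_gamma_mul_thetaTerm (e : Module.Basis ι K L) (n : ℤ) (f : Module.Dual K L) (u : L)
    (j m : ℤ) :
    op e (.gamma n f) * thetaTerm e u j m = thetaTerm e u j m * op e (.gamma n f) +
      if m = -n - j then op e (.gamma (j + n) (f ∘ₗ (LieAlgebra.ad K L u : L →ₗ[K] L))) else 0 := by
  have h := sum_smul_map_coord e (gammaOp e (j + n)) (f ∘ₗ (LieAlgebra.ad K L u : L →ₗ[K] L))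
  simp only [LinearMap.comp_apply, LieAlgebra.ad_apply, gammaOp_apply] at h
  simp only [thetaTerm, Finset.mul_sum, Finset.sum_mul, mul_add, add_mul, op_mul_nord_pair,
    koszulSign, contraction, Gen.isOdd, Bool.and_self, Bool.and_true, Bool.false_eq_true, if_false]
  simp only [one_smul, zero_smul, mul_zero, add_zero, one_mul, Finset.sum_add_distrib]
  split_ifs with h1 h2 h2
  · subst h2
    rw [← h, show -(-n - j) = j + n by ring]
    abel
  · omega
  · omega
  · simp

/-- `[θ(u_j), β_n^x] = β_{j+n}^{[u,x]}`. -/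
theorem theta_beta (e : Module.Basis ι K L) (n : ℤ) (x u : L) (j : ℤ) (w : W K ι) :
    theta e u j (op e (.beta n x) w) =
      op e (.beta n x) (theta e u j w) + op e (.beta (j + n) ⁅u, x⁆) w := by
  have := map_locSum_of_single (locFin_theta e u j) (op e (.beta n x)) n _
    (op_beta_mul_thetaTerm e n x u j) (fun a ha => by rw [if_neg ha]) w
  rw [if_pos rfl, LinearMap.neg_apply] at this
  rw [theta, this]
  abel

/-- `[θ(u_j), γ_n^f] = -γ_{j+n}^{f ∘ ad u}`. -/
theorem theta_gamma (e : Module.Basis ι K L) (n : ℤ) (f : Module.Dual K L) (u : L) (j : ℤ)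
    (w : W K ι) :
    theta e u j (op e (.gamma n f) w) = op e (.gamma n f) (theta e u j w) -
      op e (.gamma (j + n) (f ∘ₗ (LieAlgebra.ad K L u : L →ₗ[K] L))) w := by
  have := map_locSum_of_single (locFin_theta e u j) (op e (.gamma n f)) (-n - j) _
    (op_gamma_mul_thetaTerm e n f u j) (fun a ha => by rw [if_neg ha]) w
  rw [if_pos rfl] at this
  rw [theta, this]
  abel

theorem koszul_beta (e : Module.Basis ι K L) (n : ℤ) (x : L) (w : W K ι) :
    koszul e (op e (.beta n x) w) = op e (.beta n x) (koszul e w) + op e (.b n x) w := by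
  have h := sum_coord_smul_map e (bOp e n) x
  simp only [bOp_apply] at h
  have := map_locSum_of_single (locFin_koszul e) (op e (.beta n x)) n
    (fun m => if m = n then -op e (.b n x) else 0) (fun m => by
      simp only [koszulTerm, Finset.mul_sum, Finset.sum_mul, op_mul_nord_pair,
        koszulSign, contraction, Gen.isOdd, Bool.and_self, Bool.and_true, Bool.false_eq_true,
          if_false]
      simp only [one_smul, zero_smul, mul_zero, add_zero, one_mul, Finset.sum_add_distrib]
      congr 1
      split_ifs with h1 h2 h2
      · subst h2
        rw [← h, ← Finset.sum_neg_distrib]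
        simp only [end_neg_smul]
      · omega
      · omega
      · simp) (fun a ha => by rw [if_neg ha]) w
  rw [if_pos rfl, LinearMap.neg_apply] at this
  rw [koszul, this]
  abel

theorem koszul_gamma (e : Module.Basis ι K L) (n : ℤ) (f : Module.Dual K L) (w : W K ι) :
    koszul e (op e (.gamma n f) w) = op e (.gamma n f) (koszul e w) := by
  -- There is no contraction at all, so the distinguished index `0` is arbitrary.
  have := map_locSum_of_single (locFin_koszul e) (op e (.gamma n f)) 0 (fun _ => 0) (fun m => by
      simp only [koszulTerm, Finset.mul_sum, Finset.sum_mul, op_mul_nord_pair,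
        koszulSign, contraction, Gen.isOdd, Bool.and_self, Bool.and_true, Bool.false_eq_true,
          if_false]
      simp only [one_smul, zero_smul, mul_zero, add_zero, one_mul]) (fun a _ => rfl) w
  rw [koszul, this]
  simp

theorem homot_gamma (e : Module.Basis ι K L) (n : ℤ) (f : Module.Dual K L) (w : W K ι) :
    homot e (op e (.gamma n f) w) = op e (.gamma n f) (homot e w) + (n : K) • op e (.c n f) w := by
  have h := sum_smul_map_coord e (cOp e n) f
  simp only [cOp_apply] at h
  have := map_locSum_of_single (locFin_homot e) (op e (.gamma n f)) (-n)
    (fun m => if m = -n then -((n : K) • op e (.c n f)) else 0) (fun m => by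
      simp only [homotTerm, Finset.mul_sum, Finset.sum_mul, mul_smul_comm, smul_mul_assoc,
        op_mul_nord_pair,
        koszulSign, contraction, Gen.isOdd, Bool.and_self, Bool.and_true, Bool.false_eq_true,
          if_false]
      simp only [one_smul, zero_smul, mul_zero, add_zero, one_mul, smul_add,
        Finset.sum_add_distrib]
      congr 1
      split_ifs with h1 h2 h2
      · subst h2
        rw [← h, Finset.smul_sum, ← Finset.sum_neg_distrib]
        simp
      · omega
      · omega
      · simp) (fun a ha => by rw [if_neg ha]) w
  rw [if_pos rfl, LinearMap.neg_apply, LinearMap.smul_apply] at this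
  rw [homot, this]
  abel

theorem op_beta_mul_virTerm (e : Module.Basis ι K L) (j n m : ℤ) (x : L) :
    op e (.beta n x) * virTerm e j m = virTerm e j m * op e (.beta n x) +
      if m = n then (n : K) • op e (.beta (j + n) x) else 0 := by
  have h := sum_coord_smul_map e (betaOp e (j + n)) x
  simp only [betaOp_apply] at h
  set V := ∑ u, (m : K) • (nord e [.b (j + m) (e u), .c (-m) (e.coord u)] +
    nord e [.beta (j + m) (e u), .gamma (-m) (e.coord u)]) with hV
  have hv : virTerm e j m = -V := rfl
  have key : op e (.beta n x) * V = V * op e (.beta n x) +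
      if m = n then -((n : K) • op e (.beta (j + n) x)) else 0 := by
    simp only [hV, Finset.mul_sum, Finset.sum_mul, mul_smul_comm,
      smul_mul_assoc, op_mul_nord_pair, mul_add, add_mul,
      koszulSign, contraction, Gen.isOdd, Bool.and_self, Bool.and_true, Bool.false_eq_true,
        if_false]
    simp only [one_smul, zero_smul, mul_zero, add_zero, one_mul, smul_add,
      Finset.sum_add_distrib]
    by_cases hm : m = n
    · subst hm
      simp only [neg_add_cancel, if_true]
      rw [← h, Finset.smul_sum]
      simp only [end_neg_smul, smul_neg, Finset.sum_neg_distrib]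
      abel
    · have h1 : ¬ -m + n = 0 := by omega
      simp only [hm, h1, if_false, zero_smul, smul_zero, Finset.sum_const_zero, add_zero]
  refine LinearMap.ext fun w => ?_
  have hw := congrArg (fun A : Module.End K (W K ι) => A w) key
  simp only [Module.End.mul_apply, LinearMap.add_apply] at hw
  simp only [hv, Module.End.mul_apply, LinearMap.neg_apply, LinearMap.add_apply, map_neg, hw]
  split_ifs
  · rw [LinearMap.neg_apply]
    abel
  · simp

theorem vir_beta (e : Module.Basis ι K L) (j n : ℤ) (x : L) (w : W K ι) :
    vir e j (op e (.beta n x) w) =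
      op e (.beta n x) (vir e j w) - (n : K) • op e (.beta (j + n) x) w := by
  have := map_locSum_of_single (locFin_vir e j) (op e (.beta n x)) n _
    (op_beta_mul_virTerm e j n · x) (fun a ha => by rw [if_neg ha]) w
  rw [if_pos rfl, LinearMap.smul_apply] at this
  rw [vir, this]
  abel

/-- When the total mode is nonnegative the two factors cannot both be creation operators: that would
need j + m < 0 and m ≥ 0. The next three lemmas rest on the same count. -/
theorem theta_vac (e : Module.Basis ι K L) (u : L) {j : ℤ} (hj : 0 ≤ j) :
    theta e u j (vac K ι) = 0 := by
  change ∑ᶠ m, thetaTerm e u j m (vac K ι) = 0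
  refine finsum_eq_zero_of_forall_eq_zero fun m => ?_
  simp only [thetaTerm, LinearMap.sum_apply, LinearMap.add_apply]
  refine Finset.sum_eq_zero fun v _ => ?_
  rw [nord_vac, nord_vac, add_zero] <;>
  · simp [Gen.isCreation]
    omega

theorem koszul_vac (e : Module.Basis ι K L) : koszul e (vac K ι) = 0 := by
  change ∑ᶠ m, koszulTerm e m (vac K ι) = 0
  refine finsum_eq_zero_of_forall_eq_zero fun m => ?_
  simp only [koszulTerm, LinearMap.sum_apply]
  refine Finset.sum_eq_zero fun v _ => ?_
  rw [nord_vac]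
  simp [Gen.isCreation]
  omega

theorem homot_vac (e : Module.Basis ι K L) : homot e (vac K ι) = 0 := by
  change ∑ᶠ m, homotTerm e m (vac K ι) = 0
  refine finsum_eq_zero_of_forall_eq_zero fun m => ?_
  simp only [homotTerm, LinearMap.sum_apply, LinearMap.smul_apply]
  refine Finset.sum_eq_zero fun v _ => ?_
  rw [nord_vac, smul_zero]
  simp [Gen.isCreation]
  omega

theorem vir_vac (e : Module.Basis ι K L) {j : ℤ} (hj : 0 ≤ j) : vir e j (vac K ι) = 0 := by
  change ∑ᶠ m, virTerm e j m (vac K ι) = 0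
  refine finsum_eq_zero_of_forall_eq_zero fun m => ?_
  have hv : virTerm e j m = -∑ u, (m : K) • (nord e [.b (j + m) (e u), .c (-m) (e.coord u)] +
        nord e [.beta (j + m) (e u), .gamma (-m) (e.coord u)]) := rfl
  rw [hv, LinearMap.neg_apply, neg_eq_zero]
  simp only [LinearMap.sum_apply, LinearMap.add_apply, LinearMap.smul_apply]
  refine Finset.sum_eq_zero fun v _ => ?_
  rw [nord_vac, nord_vac, add_zero, smul_zero] <;>
  · simp [Gen.isCreation]
    omega

end Commutators

/-! ### States without fermions. -/

section Bosonic

variable {K ι : Type*} [Field K]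

/-- A state annihilated by all contractions, that is, without fermions. -/
def IsBosonic (w : W K ι) : Prop := ∀ i, extDer i w = 0

theorem isBosonic_vac : IsBosonic (vac K ι) := extDer_vac

theorem IsBosonic.add {v w : W K ι} (hv : IsBosonic v) (hw : IsBosonic w) : IsBosonic (v + w) :=
  fun i => by rw [map_add, hv i, hw i, add_zero]

theorem IsBosonic.smul (r : K) {w : W K ι} (hw : IsBosonic w) : IsBosonic (r • w) :=
  fun i => by rw [map_smul, hw i, smul_zero]

end Bosonic

/-! ### Commutators with Q, and closedness of bosonic states as invariance under nonnegative loops.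
-/

section Differential

variable {K ι L : Type*} [Field K] [Fintype ι] [LieRing L] [LieAlgebra K L]

/-- Only the β of the first cubic term can be contracted; the pair that remains has total mode `n`.
-/
theorem op_gamma_mul_QTerm (e : Module.Basis ι K L) (n : ℤ) (f : Module.Dual K L) (p : ℤ × ℤ) :
    op e (.gamma n f) * QTerm e p = QTerm e p * op e (.gamma n f) +
      if n + (p.1 + p.2) = 0 then ∑ u, ∑ v, f ⁅e u, e v⁆ •
        nord e [.gamma (-p.1) (e.coord v), .c (-p.2) (e.coord u)] else 0 := by
  simp only [QTerm, Finset.mul_sum, Finset.sum_mul, mul_smul_comm,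
      smul_mul_assoc, op_mul_nord_triple, mul_add, add_mul,
      koszulSign, contraction, Gen.isOdd, Bool.and_self, Bool.and_true, Bool.false_eq_true,
        if_false]
  simp only [one_smul, zero_smul, mul_zero, add_zero, one_mul, Finset.sum_add_distrib]
  split_ifs with h
  · abel
  · simp

theorem op_beta_mul_QTerm (e : Module.Basis ι K L) (n : ℤ) (x : L) (p : ℤ × ℤ) :
    op e (.beta n x) * QTerm e p = QTerm e p * op e (.beta n x) +
      if n = p.1 then -∑ u,
        nord e [.beta (p.1 + p.2) ⁅e u, x⁆, .c (-p.2) (e.coord u)] else 0 := by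
  have h1 : ∀ u, nord e [.beta (p.1 + p.2) ⁅e u, x⁆, .c (-p.2) (e.coord u)] =
      ∑ v, e.coord v x • nord e [.beta (p.1 + p.2) ⁅e u, e v⁆, .c (-p.2) (e.coord u)] := fun u =>
    (sum_coord_smul_nordBeta e (p.1 + p.2) (.c (-p.2) (e.coord u))
      (LieAlgebra.ad K L (e u) : L →ₗ[K] L) x).symm
  simp only [QTerm, Finset.mul_sum, Finset.sum_mul, mul_smul_comm,
      smul_mul_assoc, op_mul_nord_triple, mul_add, add_mul,
      koszulSign, contraction, Gen.isOdd, Bool.and_self, Bool.and_true, Bool.false_eq_true,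
        if_false]
  simp only [one_smul, zero_smul, mul_zero, add_zero, one_mul, Finset.sum_add_distrib]
  by_cases h : n = p.1
  · subst h
    simp only [neg_add_cancel, if_true, h1, end_neg_smul, Finset.sum_neg_distrib]
    abel
  · have : ¬ -p.1 + n = 0 := by omega
    simp only [h, this, if_false, zero_smul, Finset.sum_const_zero, add_zero]

/-- There are three contractions: with the c of βγc, and with either c of bcc. The last two differ
by a fermionic sign and by the order of the bracket, which compensate each other; each carries half
of the fermionic part of θ(x_n). -/
theorem op_b_mul_QTerm (e : Module.Basis ι K L) (n : ℤ) (x : L) (p : ℤ × ℤ) :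
    op e (.b n x) * QTerm e p = (-1 : K) • (QTerm e p * op e (.b n x)) +
      ((if n = p.2 then ∑ v, (nord e [.beta (p.1 + n) ⁅x, e v⁆, .gamma (-p.1) (e.coord v)] +
          (1 / 2 : K) • nord e [.b (p.1 + n) ⁅x, e v⁆, .c (-p.1) (e.coord v)]) else 0) +
        if n = p.1 then ∑ v,
          (1 / 2 : K) • nord e [.b (p.2 + n) ⁅x, e v⁆, .c (-p.2) (e.coord v)] else 0) := by
  have h1 : ∀ m v, nord e [.beta m ⁅x, e v⁆, .gamma (-p.1) (e.coord v)] =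
      ∑ u, e.coord u x • nord e [.beta m ⁅e u, e v⁆, .gamma (-p.1) (e.coord v)] := fun m v => by
    have := sum_coord_smul_nordBeta e m (.gamma (-p.1) (e.coord v))
      (-(LieAlgebra.ad K L (e v) : L →ₗ[K] L)) x
    simpa using this.symm
  have h2 : ∀ m i v, nord e [.b m ⁅x, e v⁆, .c i (e.coord v)] =
      ∑ u, e.coord u x • nord e [.b m ⁅e u, e v⁆, .c i (e.coord v)] := fun m i v => by
    have := sum_coord_smul_nordB e m (.c i (e.coord v))
      (-(LieAlgebra.ad K L (e v) : L →ₗ[K] L)) x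
    simpa using this.symm
  have h3 : ∀ m i v, nord e [.b m ⁅x, e v⁆, .c i (e.coord v)] =
      -∑ u, e.coord u x • nord e [.b m ⁅e v, e u⁆, .c i (e.coord v)] := fun m i v => by
    have := sum_coord_smul_nordB e m (.c i (e.coord v))
      ((LieAlgebra.ad K L (e v) : L →ₗ[K] L)) x
    simp only [LieAlgebra.ad_apply] at this
    rw [this, ← lie_skew, ← neg_one_smul K]
    have h := (nordB e m (.c i (e.coord v))).map_smul (-1) ⁅e v, x⁆
    refine h.trans ?_
    rw [end_neg_smul, one_smul]
    rfl
  simp only [QTerm, Finset.mul_sum, Finset.sum_mul, mul_smul_comm,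
      smul_mul_assoc, op_mul_nord_triple, mul_add, add_mul,
      koszulSign, contraction, Gen.isOdd, Bool.and_self, Bool.and_false,
      Bool.false_eq_true, if_true, if_false]
  simp only [zero_smul, mul_zero, add_zero, one_mul, smul_add,
      Finset.sum_add_distrib]
  have e1 : (-p.2 + n = 0) = (n = p.2) := propext (by omega)
  have e2 : (-p.1 + n = 0) = (n = p.1) := propext (by omega)
  simp only [e1, e2]
  have s1 : ∑ u, ∑ v, (if n = p.2 then e.coord u x else 0) •
      nord e [.beta (p.1 + p.2) ⁅e u, e v⁆, .gamma (-p.1) (e.coord v)] =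
      if n = p.2 then ∑ v, nord e [.beta (p.1 + n) ⁅x, e v⁆, .gamma (-p.1) (e.coord v)] else 0 := by
    by_cases h : n = p.2
    · subst h
      simp only [if_true]
      rw [Finset.sum_comm]
      exact Finset.sum_congr rfl fun v _ => (h1 _ v).symm
    · simp only [h, if_false, zero_smul, Finset.sum_const_zero]
  have s2 : ∑ u, ∑ v, (1 / 2 : K) • (-1 * -1 * if n = p.2 then e.coord u x else 0) •
      nord e [.b (p.1 + p.2) ⁅e u, e v⁆, .c (-p.1) (e.coord v)] =
      if n = p.2 then ∑ v, (1 / 2 : K) • nord e [.b (p.1 + n) ⁅x, e v⁆, .c (-p.1) (e.coord v)]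
        else 0 := by
    by_cases h : n = p.2
    · subst h
      simp only [if_true, mul_neg, mul_one, neg_neg, one_mul]
      rw [Finset.sum_comm]
      exact Finset.sum_congr rfl fun v _ => by rw [h2, Finset.smul_sum]
    · simp only [h, if_false, mul_zero, zero_smul, smul_zero, Finset.sum_const_zero]
  have s3 : ∑ u, ∑ v, (1 / 2 : K) • (-1 * if n = p.1 then e.coord v x else 0) •
      nord e [.b (p.1 + p.2) ⁅e u, e v⁆, .c (-p.2) (e.coord u)] =
      if n = p.1 then ∑ v, (1 / 2 : K) • nord e [.b (p.2 + n) ⁅x, e v⁆, .c (-p.2) (e.coord v)]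
        else 0 := by
    by_cases h : n = p.1
    · subst h
      simp only [if_true, neg_mul, one_mul]
      exact Finset.sum_congr rfl fun v _ => by
        rw [h3, ← Finset.smul_sum, add_comm p.2]
        congr 1
        simp only [end_neg_smul, Finset.sum_neg_distrib]
    · simp only [h, if_false, mul_zero, zero_smul, smul_zero, Finset.sum_const_zero]
  rw [s1, s2, s3]
  simp only [Finset.smul_sum, mul_neg, mul_one, neg_neg, smul_comm (1 / 2 : K) (-1 : K)]
  split_ifs <;> abel

theorem op_c_mul_QTerm (e : Module.Basis ι K L) (n : ℤ) (f : Module.Dual K L) (p : ℤ × ℤ) :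
    op e (.c n f) * QTerm e p = (-1 : K) • (QTerm e p * op e (.c n f)) +
      if n + (p.1 + p.2) = 0 then ∑ u, ∑ v, (1 / 2 * f ⁅e u, e v⁆) •
        nord e [.c (-p.1) (e.coord v), .c (-p.2) (e.coord u)] else 0 := by
  simp only [QTerm, Finset.mul_sum, Finset.sum_mul, mul_smul_comm,
      smul_mul_assoc, op_mul_nord_triple, mul_add, add_mul,
      koszulSign, contraction, Gen.isOdd, Bool.and_self, Bool.and_false,
      Bool.false_eq_true, if_true, if_false]
  simp only [zero_smul, mul_zero, add_zero, smul_add,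
      Finset.sum_add_distrib, mul_neg, mul_one, neg_neg, Finset.smul_sum, smul_smul]
  split_ifs with h
  · rw [add_assoc]
    simp only [neg_mul, one_mul]
  · simp [mul_comm, end_neg_smul, Finset.sum_neg_distrib]

/-- `{Q, b_n^x} = θ(x_n)`. -/
theorem op_b_Q (e : Module.Basis ι K L) [CharZero K] (n : ℤ) (x : L) (w : W K ι) :
    op e (.b n x) (Q e w) = -Q e (op e (.b n x) w) + theta e x n w := by
  have h := map_locSum (locFin_Q e) (op e (.b n x)) (-1) _ (op_b_mul_QTerm e n x) w
  rw [neg_one_smul] at h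
  rw [Q, h]
  congr 1
  set H : ℤ → W K ι := fun i => ∑ v, (nord e [.beta (i + n) ⁅x, e v⁆, .gamma (-i) (e.coord v)] w +
      (1 / 2 : K) • nord e [.b (i + n) ⁅x, e v⁆, .c (-i) (e.coord v)] w) with hH
  set G : ℤ → W K ι := fun i => ∑ v,
    (1 / 2 : K) • nord e [.b (i + n) ⁅x, e v⁆, .c (-i) (e.coord v)] w with hG
  obtain ⟨N, hN⟩ := exists_mem_low w
  have hz : ∀ i, i ∉ Set.Icc (-(N : ℤ)) (N - n) → H i = 0 ∧ G i = 0 := by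
    intro i hi
    have hi' : (N : ℤ) < i + n ∨ (N : ℤ) < -i := by
      simp only [Set.mem_Icc, not_and_or] at hi
      omega
    constructor
    · refine Finset.sum_eq_zero fun v _ => ?_
      rw [nord_eq_zero e _ hN (by simpa [Gen.mode] using hi'),
        nord_eq_zero e _ hN (by simpa [Gen.mode] using hi'), smul_zero, add_zero]
    · refine Finset.sum_eq_zero fun v _ => ?_
      rw [nord_eq_zero e _ hN (by simpa [Gen.mode] using hi'), smul_zero]
  have hHf : (Function.support H).Finite := (Set.finite_Icc (-(N : ℤ)) (N - n)).subset
    fun i hi => by_contra fun hn => hi (hz i hn).1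
  have hGf : (Function.support G).Finite := (Set.finite_Icc (-(N : ℤ)) (N - n)).subset
    fun i hi => by_contra fun hn => hi (hz i hn).2
  have h1 : (Function.support fun p : ℤ × ℤ => if n = p.2 then H p.1 else 0).Finite := by
    refine (hHf.image fun i => (i, n)).subset fun p hp => ?_
    by_cases hn : n = p.2
    · simp only [Function.mem_support, hn, if_true] at hp
      exact ⟨p.1, hp, by rw [hn]⟩
    · simp [hn] at hp
  have h2 : (Function.support fun p : ℤ × ℤ => if n = p.1 then G p.2 else 0).Finite := by
    refine (hGf.image fun i => (n, i)).subset fun p hp => ?_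
    by_cases hn : n = p.1
    · simp only [Function.mem_support, hn, if_true] at hp
      exact ⟨p.2, hp, by rw [hn]⟩
    · simp [hn] at hp
  change _ = ∑ᶠ i, thetaTerm e x n i w
  -- `H` holds the bosonic part and one half of the fermionic part, `G` the other half.
  have h3 : ∀ i, thetaTerm e x n i w = H i + G i := fun i => by
    simp only [thetaTerm, LinearMap.sum_apply, LinearMap.add_apply, hH, hG, add_comm n i,
      ← Finset.sum_add_distrib]
    refine Finset.sum_congr rfl fun v _ => ?_
    rw [add_assoc, ← add_smul]
    norm_num
  rw [finsum_congr h3, finsum_add_distrib hHf hGf, ← finsum_ite_snd n H, ← finsum_ite_fst n G,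
    ← finsum_add_distrib h1 h2]
  refine finsum_congr fun p => ?_
  rw [LinearMap.add_apply]
  congr 1
  · split_ifs
    · simp only [hH, LinearMap.sum_apply, LinearMap.add_apply, LinearMap.smul_apply]
    · rfl
  · split_ifs
    · simp only [hG, LinearMap.sum_apply, LinearMap.smul_apply]
    · rfl

theorem IsBosonic.op (e : Module.Basis ι K L) {g : Gen K L} (hg : g.isOdd = false) {w : W K ι}
    (hw : IsBosonic w) : IsBosonic (op e g w) := fun i => by
  cases g with
  | beta n u =>
    simp only [VOWA.op, LinearMap.sum_apply, LinearMap.smul_apply, map_sum, map_smul]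
    refine Finset.sum_eq_zero fun k _ => ?_
    by_cases h : n < 0
    · simp [betaB, h, ← symMul_extDer, hw i]
    · simp [betaB, h, ← symDer_extDer, hw i]
  | gamma n u =>
    simp only [VOWA.op, LinearMap.sum_apply, LinearMap.smul_apply, map_sum, map_smul]
    refine Finset.sum_eq_zero fun k _ => ?_
    by_cases h : n ≤ 0
    · simp [gammaB, h, ← symMul_extDer, hw i]
    · simp [gammaB, h, ← symDer_extDer, hw i]
  | b n u => simp [Gen.isOdd] at hg
  | c n u => simp [Gen.isOdd] at hg

theorem IsBosonic.op_eq_zero (e : Module.Basis ι K L) {g : Gen K L} (hg : g.isOdd = true)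
    (hc : g.isCreation = false) {w : W K ι} (hw : IsBosonic w) : VOWA.op e g w = 0 := by
  cases g with
  | beta n u => simp [Gen.isOdd] at hg
  | gamma n u => simp [Gen.isOdd] at hg
  | b n u =>
    simp only [Gen.isCreation, decide_eq_false_iff_not] at hc
    simp [VOWA.op, bB, hc, hw _]
  | c n u =>
    simp only [Gen.isCreation, decide_eq_false_iff_not] at hc
    simp [VOWA.op, cB, hc, hw _]

/-- Before the fermionic annihilation operator acts, only bosonic annihilation operators have acted,
and these keep the state bosonic. -/
theorem IsBosonic.nord_eq_zero (e : Module.Basis ι K L) : ∀ {l : List (Gen K L)},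
    (∃ g ∈ l, g.isOdd = true ∧ g.isCreation = false) → ∀ {w : W K ι}, IsBosonic w →
    nord e l w = 0
  | [], h, _, _ => by simp at h
  | g :: l, h, w, hw => by
    by_cases hc : g.isCreation = true
    · have hl : ∃ g ∈ l, g.isOdd = true ∧ g.isCreation = false := by
        obtain ⟨a, ha, h2⟩ := h
        rcases List.mem_cons.1 ha with rfl | ha
        · simp [hc] at h2
        · exact ⟨a, ha, h2⟩
      simp [nord, hc, IsBosonic.nord_eq_zero e hl hw]
    · rw [nord, if_neg hc, LinearMap.smul_apply, Module.End.mul_apply]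
      simp only [Bool.not_eq_true] at hc
      by_cases ho : g.isOdd = true
      · rw [hw.op_eq_zero e ho hc, map_zero, smul_zero]
      · have hl : ∃ g ∈ l, g.isOdd = true ∧ g.isCreation = false := by
          obtain ⟨a, ha, h2⟩ := h
          rcases List.mem_cons.1 ha with rfl | ha
          · exact absurd h2.1 ho
          · exact ⟨a, ha, h2⟩
        rw [IsBosonic.nord_eq_zero e hl (hw.op e (by simpa using ho)), smul_zero]

theorem nord_beta_gamma_c (e : Module.Basis ι K L) (i j k : ℤ) (x : L) (f g : Module.Dual K L)
    (hk : k ≤ 0) : nord e [.beta i x, .gamma j f, .c k g] =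
      op e (.c k g) * nord e [.beta i x, .gamma j f] := by
  have h1 : op e (.c k g) * op e (.beta i x) = op e (.beta i x) * op e (.c k g) := by
    simpa [koszulSign, contraction, Gen.isOdd] using op_mul_op e (.c k g) (.beta i x)
  have h2 : op e (.c k g) * op e (.gamma j f) = op e (.gamma j f) * op e (.c k g) := by
    simpa [koszulSign, contraction, Gen.isOdd] using op_mul_op e (.c k g) (.gamma j f)
  by_cases hi : i < 0 <;> by_cases hj : j ≤ 0 <;>
    simp [nord, Gen.isCreation, Gen.isOdd, hi, hj, h1, h2, hk, ← mul_assoc]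
  all_goals simp [mul_assoc, h2]

/-- On a state without fermions `Q = ∑ c_{-j}^{u'} θ(u_j)`. -/
theorem IsBosonic.Q_apply (e : Module.Basis ι K L) {w : W K ι} (hw : IsBosonic w) :
    Q e w = ∑ᶠ j : ℤ, if 0 ≤ j then
      ∑ u, VOWA.op e (.c (-j) (e.coord u)) (theta e (e u) j w) else 0 := by
  -- For j < 0 the factor c_{-j} annihilates. For j ≥ 0, b_{i+j} and c_{-i} cannot both be creation
  -- operators, so the bcc term and the fermionic part of θ both vanish on `w`.
  have hterm : ∀ j i : ℤ, QTerm e (i, j) w = if 0 ≤ j then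
      ∑ u, VOWA.op e (.c (-j) (e.coord u)) (thetaTerm e (e u) j i w) else 0 := by
    intro j i
    simp only [QTerm, LinearMap.sum_apply, LinearMap.add_apply, LinearMap.smul_apply]
    split_ifs with h
    · refine Finset.sum_congr rfl fun u _ => ?_
      simp only [thetaTerm, LinearMap.sum_apply, LinearMap.add_apply, map_sum, map_add]
      refine Finset.sum_congr rfl fun v _ => ?_
      rw [nord_beta_gamma_c e _ _ _ _ _ _ (by omega), Module.End.mul_apply, add_comm i j,
        IsBosonic.nord_eq_zero e (l := [.b _ _, .c _ _, .c _ _]) _ hw,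
        IsBosonic.nord_eq_zero e (l := [.b _ _, .c _ _]) _ hw, map_zero, smul_zero]
      · simp [Gen.isOdd, Gen.isCreation]
        omega
      · simp [Gen.isOdd, Gen.isCreation]
        omega
    · refine Finset.sum_eq_zero fun u _ => Finset.sum_eq_zero fun v _ => ?_
      rw [IsBosonic.nord_eq_zero e _ hw, IsBosonic.nord_eq_zero e _ hw, smul_zero, add_zero]
      · simp [Gen.isOdd, Gen.isCreation]
        omega
      · simp [Gen.isOdd, Gen.isCreation]
        omega
  have hfin := locFin_Q e w
  change ∑ᶠ p, QTerm e p w = _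
  rw [← finsum_comp_equiv (Equiv.prodComm ℤ ℤ), finsum_curry]
  · refine finsum_congr fun j => ?_
    simp only [Equiv.prodComm_apply, Prod.swap_prod_mk, hterm]
    split_ifs with h
    · have hs : ∀ u, (Function.support fun i => thetaTerm e (e u) j i w).Finite := fun u =>
        locFin_theta e (e u) j w
      rw [finsum_sum_comm]
      · refine Finset.sum_congr rfl fun u _ => ?_
        exact (map_finsum _ (hs u)).symm
      · intro u _
        exact (hs u).subset fun i hi h0 => hi (by simp only [h0, map_zero])
    · simp
  · exact (hfin.preimage (Equiv.injective _).injOn)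

/-- For `j ≥ 0` the operator b_j kills `w`, so {Q, b_j} = θ gives the claim. With the converse
`IsBosonic.Q_eq_zero` this turns `Q`-closedness into invariance under ℓ[t]. -/
theorem IsBosonic.theta_eq_zero [CharZero K] (e : Module.Basis ι K L) {w : W K ι}
    (hw : IsBosonic w) (hQ : Q e w = 0) (u : L) {j : ℤ} (hj : 0 ≤ j) : theta e u j w = 0 := by
  have h := op_b_Q e j u w
  rw [hQ, map_zero, hw.op_eq_zero e rfl (by simpa [Gen.isCreation] using hj), map_zero, neg_zero,
    zero_add] at h
  exact h.symm

theorem IsBosonic.Q_eq_zero (e : Module.Basis ι K L) {w : W K ι}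
    (hw : IsBosonic w) (h : ∀ u : L, ∀ j : ℤ, 0 ≤ j → theta e u j w = 0) : Q e w = 0 := by
  rw [hw.Q_apply e]
  refine finsum_eq_zero_of_forall_eq_zero fun j => ?_
  split_ifs with hj
  · exact Finset.sum_eq_zero fun u _ => by rw [h _ _ hj, map_zero]
  · rfl

end Differential

/-! ### Invariant forms and tensors of sl(2). -/

section SL2Algebra

variable {K L : Type*} [Field K] [LieRing L] [LieAlgebra K L]

/-- The basis `e = (x, y, h)` satisfies the relations of `sl(2)`. -/
structure IsSL2Basis (e : Module.Basis (Fin 3) K L) : Prop where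
  lie_xy : ⁅e 0, e 1⁆ = e 2
  lie_hx : ⁅e 2, e 0⁆ = (2 : K) • e 0
  lie_hy : ⁅e 2, e 1⁆ = (-2 : K) • e 1

variable {e : Module.Basis (Fin 3) K L}

theorem IsSL2Basis.lie_yx (he : IsSL2Basis e) : ⁅e 1, e 0⁆ = -e 2 := by
  rw [← lie_skew, he.lie_xy]

theorem IsSL2Basis.lie_xh (he : IsSL2Basis e) : ⁅e 0, e 2⁆ = (-2 : K) • e 0 := by
  rw [← lie_skew, he.lie_hx, neg_smul]

theorem IsSL2Basis.lie_yh (he : IsSL2Basis e) : ⁅e 1, e 2⁆ = (2 : K) • e 1 := by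
  rw [← lie_skew, he.lie_hy, neg_smul, neg_neg]

theorem exists_eq_smul_add (e : Module.Basis (Fin 3) K L) (u : L) :
    ∃ a b c : K, u = a • e 0 + b • e 1 + c • e 2 :=
  ⟨e.repr u 0, e.repr u 1, e.repr u 2, by
    conv_lhs => rw [← e.sum_repr u, Fin.sum_univ_three]⟩

theorem phi_x (e : Module.Basis (Fin 3) K L) : phi e (e 0) = (1 / 2 : K) • e.coord 1 := by
  simp [phi]

theorem phi_y (e : Module.Basis (Fin 3) K L) : phi e (e 1) = (1 / 2 : K) • e.coord 0 := by
  simp [phi]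

theorem phi_h (e : Module.Basis (Fin 3) K L) : phi e (e 2) = e.coord 2 := by
  simp [phi]

theorem phi_apply_combination (e : Module.Basis (Fin 3) K L) (a b c a' b' c' : K) :
    phi e (a • e 0 + b • e 1 + c • e 2) (a' • e 0 + b' • e 1 + c' • e 2) =
      1 / 2 * (a * b' + b * a') + c * c' := by
  simp [phi_x, phi_y, phi_h]
  ring

theorem phi_symm (e : Module.Basis (Fin 3) K L) (u v : L) : phi e u v = phi e v u := by
  obtain ⟨a, b, c, rfl⟩ := exists_eq_smul_add e u
  obtain ⟨a', b', c', rfl⟩ := exists_eq_smul_add e v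
  rw [phi_apply_combination, phi_apply_combination]
  ring

theorem IsSL2Basis.lie_combination (he : IsSL2Basis e) (a b c a' b' c' : K) :
    ⁅a • e 0 + b • e 1 + c • e 2, a' • e 0 + b' • e 1 + c' • e 2⁆ =
      (2 * (c * a' - a * c')) • e 0 + (2 * (b * c' - c * b')) • e 1 + (a * b' - b * a') • e 2 := by
  simp only [add_lie, lie_add, smul_lie, lie_smul, lie_self, he.lie_xy, he.lie_hx, he.lie_hy,
    he.lie_yx, he.lie_xh, he.lie_yh]
  module

theorem IsSL2Basis.phi_lie (he : IsSL2Basis e) [CharZero K] (u a b : L) :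
    phi e ⁅u, a⁆ b = -phi e a ⁅u, b⁆ := by
  obtain ⟨u₁, u₂, u₃, rfl⟩ := exists_eq_smul_add e u
  obtain ⟨a₁, a₂, a₃, rfl⟩ := exists_eq_smul_add e a
  obtain ⟨b₁, b₂, b₃, rfl⟩ := exists_eq_smul_add e b
  simp only [he.lie_combination, phi_apply_combination]
  field_simp
  ring

theorem exists_phi_eq (e : Module.Basis (Fin 3) K L) [CharZero K] (f : Module.Dual K L) :
    ∃ u, phi e u = f := by
  refine ⟨(2 * f (e 1)) • e 0 + (2 * f (e 0)) • e 1 + f (e 2) • e 2, e.ext fun i => ?_⟩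
  fin_cases i <;> simp [phi_x, phi_y, phi_h] <;> ring

/-- The contraction of a bilinear expression with the inverse of the invariant form. -/
def casSum {M : Type*} [AddCommGroup M] [Module K M] (e : Module.Basis (Fin 3) K L)
    (F : L → L → M) : M := (2 : K) • F (e 0) (e 1) + (2 : K) • F (e 1) (e 0) + F (e 2) (e 2)

variable {M N : Type*} [AddCommGroup M] [Module K M] [AddCommGroup N] [Module K N]

theorem map_casSum (T : M →ₗ[K] N) (F : L → L → M) :
    T (casSum e F) = casSum e fun a b => T (F a b) := by
  simp [casSum]

theorem casSum_add (F G : L → L → M) :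
    casSum e (fun a b => F a b + G a b) = casSum e F + casSum e G := by
  simp only [casSum]
  module

theorem casSum_smul (r : K) (F : L → L → M) :
    casSum e (fun a b => r • F a b) = r • casSum e F := by
  simp only [casSum]
  module

theorem casSum_neg (F : L → L → M) :
    casSum e (fun a b => -F a b) = -casSum e F := by
  simp only [casSum]
  module

theorem casSum_zero : casSum e (fun _ _ => (0 : M)) = 0 := by
  simp [casSum]

theorem casSum_comm (F : L → L → L → L → M) :
    casSum e (fun a b => casSum e fun c d => F a b c d) =
      casSum e fun c d => casSum e fun a b => F a b c d := by
  simp only [casSum]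
  module

theorem casSum_swap (F : L → L → M) : casSum e (fun a b => F b a) = casSum e F := by
  simp only [casSum]
  module

/-- The tensor in `casSum` is inverse to `phi`, so contracting them gives the identity. -/
theorem casSum_phi_smul [CharZero K] (F : L →ₗ[K] M) (b : L) :
    casSum e (fun a c => phi e c b • F a) = F b := by
  obtain ⟨b₁, b₂, b₃, rfl⟩ := exists_eq_smul_add e b
  simp [casSum, phi_x, phi_y, phi_h, smul_smul]

/-- Invariance of the Casimir tensor. -/
theorem IsSL2Basis.casSum_lie (he : IsSL2Basis e) (S : L →ₗ[K] L →ₗ[K] M) (u : L) :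
    casSum e (fun a b => S ⁅u, a⁆ b + S a ⁅u, b⁆) = 0 := by
  obtain ⟨u₁, u₂, u₃, rfl⟩ := exists_eq_smul_add e u
  simp only [casSum, add_lie, smul_lie, lie_self, he.lie_xy, he.lie_hx, he.lie_hy,
    he.lie_yx, he.lie_xh, he.lie_yh, map_add, map_smul, map_neg, map_zero, LinearMap.add_apply,
    LinearMap.smul_apply, LinearMap.neg_apply, LinearMap.zero_apply]
  module

/-- For symmetric `S` the two halves of `casSum_lie` agree. The check in coordinates avoids dividing
by two. Most cancellations in the proof reduce to this one. -/
theorem IsSL2Basis.casSum_lie_left (he : IsSL2Basis e) (S : L →ₗ[K] L →ₗ[K] M)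
    (hS : ∀ a b, S a b = S b a) (u : L) : casSum e (fun a b => S ⁅u, a⁆ b) = 0 := by
  obtain ⟨u₁, u₂, u₃, rfl⟩ := exists_eq_smul_add e u
  have h1 := hS (e 1) (e 0)
  have h2 := hS (e 2) (e 0)
  have h3 := hS (e 2) (e 1)
  simp only [casSum, add_lie, smul_lie, lie_self, he.lie_xy, he.lie_hx, he.lie_hy,
    he.lie_yx, he.lie_xh, he.lie_yh, map_add, map_smul, map_neg, map_zero, LinearMap.add_apply,
    LinearMap.smul_apply, LinearMap.neg_apply, LinearMap.zero_apply, h1, h2, h3]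
  module

theorem sum_coord_eq_casSum [CharZero K] (F : Module.Dual K L →ₗ[K] L →ₗ[K] M) :
    ∑ u, F (e.coord u) (e u) = casSum e fun a b => F (phi e a) b := by
  simp only [casSum, Fin.sum_univ_three, phi_x, phi_y, phi_h, map_smul, LinearMap.smul_apply,
    smul_smul]
  norm_num
  module

variable {V : Type*} [AddCommGroup V] [Module K V]

/-- `(a, b) ↦ A_a B_b w` as a bilinear map. -/
def biOp (A : M →ₗ[K] Module.End K V) (B : N →ₗ[K] Module.End K V) (w : V) :
    M →ₗ[K] N →ₗ[K] V :=
  LinearMap.mk₂ K (fun a b => A a (B b w)) (by simp) (by simp) (by simp) (by simp)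

theorem biOp_apply (A : M →ₗ[K] Module.End K V) (B : N →ₗ[K] Module.End K V) (w : V)
    (a : M) (b : N) : biOp A B w a b = A a (B b w) := rfl

/-- Invariant bilinear forms on `sl(2)` are multiples of the standard one. -/
theorem IsSL2Basis.bilin_eq [CharZero K] (he : IsSL2Basis e) (S : L →ₗ[K] L →ₗ[K] K)
    (hS : ∀ u a b : L, S ⁅u, a⁆ b + S a ⁅u, b⁆ = 0) (a b : L) :
    S a b = S (e 2) (e 2) * phi e a b := by
  have key := fun i j k => hS (e i) (e j) (e k)
  -- Invariance under h kills the entries of nonzero weight; invariance under x (`hx1`, `hx2`) gives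
  -- S(y,x) = S(x,y) = S(h,h)/2.
  have h00 := key 2 0 0
  have h02 := key 2 0 2
  have h12 := key 2 1 2
  have h20 := key 2 2 0
  have h21 := key 2 2 1
  have h11 := key 2 1 1
  have hx1 := key 0 1 2
  have hx2 := key 0 2 1
  obtain ⟨a₁, a₂, a₃, rfl⟩ := exists_eq_smul_add e a
  obtain ⟨b₁, b₂, b₃, rfl⟩ := exists_eq_smul_add e b
  rw [phi_apply_combination]
  simp only [lie_self, he.lie_xy, he.lie_hx, he.lie_hy,
    he.lie_xh, map_add, map_smul, map_zero, LinearMap.add_apply,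
    LinearMap.smul_apply, LinearMap.zero_apply, smul_eq_mul] at *
  linear_combination a₁ * b₁ / 4 * h00 - a₂ * b₂ / 4 * h11 + a₁ * b₃ / 2 * h02 -
    a₂ * b₃ / 2 * h12 + a₃ * b₁ / 2 * h20 - a₃ * b₂ / 2 * h21 - a₂ * b₁ / 2 * hx1 -
    a₁ * b₂ / 2 * hx2

/-- An invariant trilinear form on `sl(2)` is alternating. -/
theorem IsSL2Basis.trilin_relations (he : IsSL2Basis e)
    (T : L →ₗ[K] L →ₗ[K] L →ₗ[K] K)
    (hT : ∀ u a b c : L, T ⁅u, a⁆ b c + T a ⁅u, b⁆ c + T a b ⁅u, c⁆ = 0) :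
    T (e 0) (e 2) (e 1) = -T (e 2) (e 0) (e 1) ∧ T (e 2) (e 1) (e 0) = -T (e 2) (e 0) (e 1) ∧
      T (e 1) (e 0) (e 2) = -T (e 2) (e 0) (e 1) ∧ T (e 1) (e 2) (e 0) = T (e 2) (e 0) (e 1) ∧
      T (e 0) (e 1) (e 2) = T (e 2) (e 0) (e 1) := by
  -- Acting by x on a word with two y's and one x, or by y on a word with two x's and one y, relates
  -- exactly two permutations of (x, y, h), since [x,x] = [y,y] = 0.
  have h1 := hT (e 0) (e 1) (e 0) (e 1)
  have h2 := hT (e 0) (e 1) (e 1) (e 0)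
  have h3 := hT (e 0) (e 0) (e 1) (e 1)
  have h4 := hT (e 1) (e 0) (e 0) (e 1)
  have h5 := hT (e 1) (e 0) (e 1) (e 0)
  have h6 := hT (e 1) (e 1) (e 0) (e 0)
  simp only [lie_self, he.lie_xy, he.lie_yx, map_neg, map_zero,
    LinearMap.neg_apply, LinearMap.zero_apply] at h1 h2 h3 h4 h5 h6
  refine ⟨?_, ?_, ?_, ?_, ?_⟩
  · linear_combination -h4
  · linear_combination -h5 - h3 - h4
  · linear_combination h1
  · linear_combination -h6 - h1
  · linear_combination h3 + h4

/-- Invariant trilinear forms are multiples of the determinant, so a single entry decides. -/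
theorem IsSL2Basis.trilin_eq_zero [CharZero K] (he : IsSL2Basis e)
    (T : L →ₗ[K] L →ₗ[K] L →ₗ[K] K)
    (hT : ∀ u a b c : L, T ⁅u, a⁆ b c + T a ⁅u, b⁆ c + T a b ⁅u, c⁆ = 0)
    (h0 : T (e 2) (e 0) (e 1) = 0) : T = 0 := by
  obtain ⟨r1, r2, r3, r4, r5⟩ := he.trilin_relations T hT
  rw [h0] at r1 r2 r3 r4 r5
  -- (h, h, h) is the only word of weight zero that is not a permutation of (x, y, h). The other
  -- words have weight ±2, ±4 or ±6 and are killed by invariance under h, whence the denominators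
  -- below.
  have r6 := hT (e 0) (e 1) (e 2) (e 2)
  simp only [he.lie_xy, he.lie_xh, map_smul, LinearMap.smul_apply, smul_eq_mul, r3, r4] at r6
  refine e.ext fun i => e.ext fun j => e.ext fun k => ?_
  have hw := hT (e 2) (e i) (e j) (e k)
  simp only [LinearMap.zero_apply]
  fin_cases i <;> fin_cases j <;> fin_cases k <;>
    simp only [Fin.zero_eta, Fin.mk_one, Fin.reduceFinMk, lie_self, he.lie_hx, he.lie_hy, map_smul,
      map_zero, LinearMap.smul_apply, LinearMap.zero_apply, smul_eq_mul] at hw ⊢ <;>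
    first
    | assumption
    | linear_combination r1
    | linear_combination r2
    | linear_combination r3
    | linear_combination r4
    | linear_combination r5
    | linear_combination r6
    | linear_combination (1 / 2) * hw
    | linear_combination (-1 / 2) * hw
    | linear_combination (1 / 4) * hw
    | linear_combination (-1 / 4) * hw
    | linear_combination (1 / 6) * hw
    | linear_combination (-1 / 6) * hw

end SL2Algebra

/-! ### Uniform currents, dual annihilation operators and number operators. -/

section Currents

variable {K L : Type*} [Field K] [LieRing L] [LieAlgebra K L] {e : Module.Basis (Fin 3) K L}

/-- The bosonic currents, uniformly indexed by `L`: `β_{-n-1}^u` for `k = false` and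
`γ_{-n}^{φ(u)}` for `k = true`. -/
def cur (e : Module.Basis (Fin 3) K L) : Bool → ℤ → L →ₗ[K] Module.End K (W K (Fin 3))
  | false, n => betaOp e (-n - 1)
  | true, n => gammaOp e (-n) ∘ₗ phi e

theorem cur_false (n : ℤ) (u : L) : cur e false n u = op e (.beta (-n - 1) u) := rfl

theorem cur_true (n : ℤ) (u : L) : cur e true n u = op e (.gamma (-n) (phi e u)) := rfl

theorem op_op_of_contraction_eq_zero {g a : Gen K L} (h : contraction g a = 0)
    (hs : g.isOdd = false ∨ a.isOdd = false) (w : W K (Fin 3)) :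
    op e g (op e a w) = op e a (op e g w) := by
  have := congrArg (fun A : Module.End K (W K (Fin 3)) => A w) (op_mul_op e g a)
  have hk : koszulSign g a = 1 := by rcases hs with hs | hs <;> simp [koszulSign, hs]
  simpa [h, hk] using this

theorem cur_cur_same (k : Bool) (n m : ℤ) (a b : L) (w : W K (Fin 3)) :
    cur e k n a (cur e k m b w) = cur e k m b (cur e k n a w) := by
  cases k
  · exact op_op_of_contraction_eq_zero rfl (Or.inl rfl) w
  · exact op_op_of_contraction_eq_zero rfl (Or.inl rfl) w

theorem cur_true_cur_false (n m : ℤ) (a b : L) (w : W K (Fin 3)) :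
    cur e true n a (cur e false m b w) = cur e false m b (cur e true n a w) +
      (if n + m + 1 = 0 then phi e a b else 0) • w := by
  have := congrArg (fun A : Module.End K (W K (Fin 3)) => A w)
    (op_mul_op e (.gamma (-n) (phi e a)) (.beta (-m - 1) b))
  have h : (-n + (-m - 1) = 0) = (n + m + 1 = 0) := propext (by omega)
  simp only [koszulSign, contraction, Gen.isOdd, h, Bool.and_self, Bool.false_eq_true, if_false,
    one_smul, Module.End.mul_apply, LinearMap.add_apply, LinearMap.smul_apply,
    Module.End.one_apply] at this
  exact this

theorem cur_vac (k : Bool) {n : ℤ} (hn : n < 0) (a : L) : cur e k n a (vac K (Fin 3)) = 0 := by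
  cases k
  · exact op_vac e (by simp [Gen.isCreation]; omega)
  · exact op_vac e (by simp [Gen.isCreation]; omega)

theorem vacCoeff_cur (k : Bool) {n : ℤ} (hn : 0 ≤ n) (a : L) (w : W K (Fin 3)) :
    vacCoeff K (Fin 3) (cur e k n a w) = 0 := by
  cases k
  · exact vacCoeff_op e (by simp [Gen.isCreation]; omega) w
  · exact vacCoeff_op e (by simp [Gen.isCreation]; omega) w

theorem IsBosonic.cur {w : W K (Fin 3)} (hw : IsBosonic w) (k : Bool) (n : ℤ) (a : L) :
    IsBosonic (cur e k n a w) := by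
  cases k
  · exact hw.op e rfl
  · exact hw.op e rfl

/-- `[θ(u_j), X_n^a] = X_{n-j}^{[u,a]}` for the currents `X`. -/
theorem IsSL2Basis.theta_cur [CharZero K] (he : IsSL2Basis e) (k : Bool) (n j : ℤ) (u a : L)
    (w : W K (Fin 3)) :
    theta e u j (cur e k n a w) = cur e k n a (theta e u j w) + cur e k (n - j) ⁅u, a⁆ w := by
  cases k
  · rw [cur_false, theta_beta, cur_false, show j + (-n - 1) = -(n - j) - 1 by ring]
  · have h : phi e ⁅u, a⁆ = -(phi e a ∘ₗ (LieAlgebra.ad K L u : L →ₗ[K] L)) := by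
      ext b
      rw [he.phi_lie]
      rfl
    have h2 : op e (.gamma (-(n - j)) (phi e ⁅u, a⁆)) =
        -op e (.gamma (-(n - j)) (phi e a ∘ₗ (LieAlgebra.ad K L u : L →ₗ[K] L))) := by
      rw [h, ← gammaOp_apply, map_neg, gammaOp_apply]
    rw [cur_true, theta_gamma, cur_true, h2, LinearMap.neg_apply, sub_eq_add_neg,
      show j + -n = -(n - j) by ring]

namespace SymCopy

/-- Whether the copy consists of `γ`'s. -/
def kind : SymCopy → Bool
  | beta _ => false
  | gamma _ => true

/-- The level of a copy. -/
def level : SymCopy → ℕ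
  | beta n => n
  | gamma n => n

/-- The copy with the level raised by `j`. -/
def shift : SymCopy → ℕ → SymCopy
  | beta n, j => beta (n + j)
  | gamma n, j => gamma (n + j)

theorem ext_iff' {s t : SymCopy} : s = t ↔ s.kind = t.kind ∧ s.level = t.level := by
  cases s <;> cases t <;> simp [kind, level]

theorem kind_shift (s : SymCopy) (j : ℕ) : (s.shift j).kind = s.kind := by cases s <;> rfl

theorem level_shift (s : SymCopy) (j : ℕ) : (s.shift j).level = s.level + j := by cases s <;> rfl

theorem exists_shift_eq {s : SymCopy} (h : 0 < s.level) : ∃ t : SymCopy, t.shift 1 = s := by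
  cases s with
  | beta n => exact ⟨.beta (n - 1), by simp only [level] at h; simp only [shift]; congr; omega⟩
  | gamma n => exact ⟨.gamma (n - 1), by simp only [level] at h; simp only [shift]; congr; omega⟩

instance : DecidableEq SymCopy := fun _ _ => Classical.propDecidable _

end SymCopy

/-- The creation operators of a copy, indexed by `L`. -/
def creat (e : Module.Basis (Fin 3) K L) (s : SymCopy) : L →ₗ[K] Module.End K (W K (Fin 3)) :=
  cur e s.kind s.level

/-- The annihilation operators dual to `creat`. -/
def annih (e : Module.Basis (Fin 3) K L) (s : SymCopy) : L →ₗ[K] Module.End K (W K (Fin 3)) :=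
  (if s.kind then (-1 : K) else 1) • cur e (!s.kind) (-s.level - 1)

theorem annih_apply (s : SymCopy) (a : L) (w : W K (Fin 3)) : annih e s a w =
    (if s.kind then (-1 : K) else 1) • cur e (!s.kind) (-s.level - 1) a w := rfl

theorem creat_creat (s t : SymCopy) (a b : L) (w : W K (Fin 3)) :
    creat e s a (creat e t b w) = creat e t b (creat e s a w) := by
  have h : ∀ n m : ℕ, ((n : ℤ) + m + 1 = 0) ↔ False := fun n m => by
    constructor <;> intro h
    · omega
    · exact h.elim
  have key : ∀ (n m : ℕ) (a b : L), cur e true n a (cur e false m b w) =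
      cur e false m b (cur e true n a w) := fun n m a b => by
    rw [cur_true_cur_false, if_neg (by rw [h]; exact id), zero_smul, add_zero]
  cases s <;> cases t
  · exact cur_cur_same _ _ _ _ _ _
  · exact (key _ _ _ _).symm
  · exact key _ _ _ _
  · exact cur_cur_same _ _ _ _ _ _

theorem annih_annih (s t : SymCopy) (a b : L) (w : W K (Fin 3)) :
    annih e s a (annih e t b w) = annih e t b (annih e s a w) := by
  have key : ∀ (n m : ℕ) (a b : L), cur e true (-n - 1) a (cur e false (-m - 1) b w) =
      cur e false (-m - 1) b (cur e true (-n - 1) a w) := fun n m a b => by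
    rw [cur_true_cur_false, if_neg (by omega), zero_smul, add_zero]
  simp only [annih_apply, map_smul]
  rw [smul_comm]
  congr 2
  cases s <;> cases t
  · exact cur_cur_same _ _ _ _ _ _
  · exact key _ _ _ _
  · exact (key _ _ _ _).symm
  · exact cur_cur_same _ _ _ _ _ _

/-- Level n of one kind pairs with level -n - 1 of the other. For γ-copies the sign of [β, γ] is
absorbed by the sign in `annih`, and symmetry of `phi` restores the order of the arguments. -/
theorem annih_creat (s t : SymCopy) (a b : L) (w : W K (Fin 3)) :
    annih e s a (creat e t b w) =
      creat e t b (annih e s a w) + (if s = t then phi e a b else 0) • w := by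
  simp only [annih_apply, map_smul, creat, SymCopy.ext_iff']
  cases s with
  | beta n =>
    cases t with
    | beta m =>
      simp only [SymCopy.kind, SymCopy.level, Bool.not_false, Bool.false_eq_true, if_false,
        one_smul, cur_true_cur_false, true_and]
      congr 3
      exact propext (by omega)
    | gamma m =>
      simp only [SymCopy.kind, SymCopy.level, Bool.not_false, Bool.false_eq_true, if_false,
        one_smul, false_and, zero_smul, add_zero]
      exact cur_cur_same _ _ _ _ _ _
  | gamma n =>
    cases t with
    | beta m =>
      simp only [SymCopy.kind, SymCopy.level, Bool.not_true, Bool.true_eq_false,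
        if_false, false_and, zero_smul, add_zero]
      rw [cur_cur_same]
    | gamma m =>
      simp only [SymCopy.kind, SymCopy.level, Bool.not_true, if_true, true_and,
        cur_true_cur_false, smul_add, phi_symm e b a]
      by_cases hnm : n = m
      · have h : (m : ℤ) + (-n - 1) + 1 = 0 := by omega
        rw [if_pos h, if_pos hnm]
        module
      · have h : ¬ (m : ℤ) + (-n - 1) + 1 = 0 := by omega
        rw [if_neg h, if_neg hnm]
        module

theorem annih_vac (s : SymCopy) (a : L) : annih e s a (vac K (Fin 3)) = 0 := by
  rw [annih_apply, cur_vac _ (by omega), smul_zero]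

theorem vacCoeff_creat (s : SymCopy) (a : L) (w : W K (Fin 3)) :
    vacCoeff K (Fin 3) (creat e s a w) = 0 := vacCoeff_cur _ (by omega) a w

/-- Dual to `theta_cur`: a loop that lowers the level of creation operators raises that of the
annihilation operators paired with them. -/
theorem IsSL2Basis.theta_annih [CharZero K] (he : IsSL2Basis e) (s : SymCopy) (j : ℕ) (u a : L)
    (w : W K (Fin 3)) : annih e s a (theta e u j w) =
      theta e u j (annih e s a w) - annih e (s.shift j) ⁅u, a⁆ w := by
  simp only [annih_apply, map_smul, he.theta_cur, SymCopy.kind_shift, SymCopy.level_shift]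
  push_cast
  rw [show (-(s.level : ℤ) - 1 - j) = -(s.level + j) - 1 by ring]
  module

/-- The operator counting the creation operators of a copy. -/
def num (e : Module.Basis (Fin 3) K L) (s : SymCopy) : Module.End K (W K (Fin 3)) :=
  casSum e fun a b => creat e s a * annih e s b

theorem num_apply (s : SymCopy) (w : W K (Fin 3)) :
    num e s w = casSum e fun a b => creat e s a (annih e s b w) := by
  simp only [num, casSum, LinearMap.add_apply, LinearMap.smul_apply, Module.End.mul_apply]

theorem num_vac (s : SymCopy) : num e s (vac K (Fin 3)) = 0 := by
  simp only [num_apply, annih_vac, map_zero, casSum_zero]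

theorem num_creat [CharZero K] (s t : SymCopy) (b : L) (w : W K (Fin 3)) :
    num e s (creat e t b w) = creat e t b (num e s w) + if s = t then creat e t b w else 0 := by
  simp only [num_apply, map_casSum, annih_creat, map_add, casSum_add, map_smul]
  congr 1
  · simp only [creat_creat s t]
  · split_ifs with h
    · subst h
      exact casSum_phi_smul ((creat e s).flip w) b
    · simp only [zero_smul, casSum_zero]

theorem num_annih [CharZero K] (s t : SymCopy) (b : L) (w : W K (Fin 3)) :
    annih e t b (num e s w) = num e s (annih e t b w) + if s = t then annih e t b w else 0 := by
  simp only [num_apply, map_casSum, annih_creat, casSum_add]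
  congr 1
  · simp only [annih_annih t s]
  · split_ifs with h h' h'
    · subst h
      simp only [phi_symm e b]
      rw [casSum_swap fun a c => phi e c b • annih e t a w]
      exact casSum_phi_smul ((annih e t).flip w) b
    · exact (h' h.symm).elim
    · exact (h h'.symm).elim
    · simp only [zero_smul, casSum_zero]

end Currents

/-! ### Multihomogeneous states and their coefficient forms. -/

section Multihomogeneous

variable {K L : Type*} [Field K] [LieRing L] [LieAlgebra K L] {e : Module.Basis (Fin 3) K L}

/-- Induction principle: surjectivity of `phi` lets every generator of a copy be written as `creat e
s a`. -/
theorem multiHom_le [CharZero K] (p : List SymCopy → Submodule K (W K (Fin 3)))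
    (h0 : vac K (Fin 3) ∈ p []) (h1 : ∀ s l a w, w ∈ p l → creat e s a w ∈ p (s :: l))
    (l : List SymCopy) : multiHom e l ≤ p l := by
  refine Submodule.span_le.2 ?_
  rintro w ⟨gs, hgs, rfl⟩
  induction hgs with
  | nil => simpa [str] using h0
  | @cons g s gs l hg _ ih =>
    have hstr : str e (g :: gs) (vac K (Fin 3)) = op e g (str e gs (vac K (Fin 3))) := by
      simp [str]
    have hop : ∃ a, op e g = creat e s a := by
      cases s with
      | beta n =>
        obtain ⟨u, rfl⟩ := hg
        exact ⟨u, rfl⟩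
      | gamma n =>
        obtain ⟨f, rfl⟩ := hg
        obtain ⟨u, rfl⟩ := exists_phi_eq e f
        exact ⟨u, rfl⟩
    obtain ⟨a, ha⟩ := hop
    rw [SetLike.mem_coe, hstr, ha]
    exact h1 s l a _ ih

theorem isBosonic_of_mem_multiHom [CharZero K] {l : List SymCopy} {w : W K (Fin 3)}
    (hw : w ∈ multiHom e l) : IsBosonic w :=
  multiHom_le (e := e) (fun _ =>
    { carrier := {w | IsBosonic w}
      add_mem' := IsBosonic.add
      zero_mem' := fun _ => map_zero _
      smul_mem' := fun r _ h => h.smul r }) isBosonic_vac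
    (fun s _ a _ h => IsBosonic.cur h s.kind s.level a) l hw

theorem num_of_mem_multiHom [CharZero K] (s : SymCopy) {l : List SymCopy} {w : W K (Fin 3)}
    (hw : w ∈ multiHom e l) : num e s w = (l.count s : K) • w := by
  have := multiHom_le (e := e) (fun l => LinearMap.ker (num e s - (l.count s : K) • 1))
    (by simp [num_vac]) (fun t l a w h => by
      simp only [LinearMap.mem_ker, LinearMap.sub_apply, LinearMap.smul_apply,
        Module.End.one_apply, sub_eq_zero] at h ⊢
      rw [num_creat, h, List.count_cons, map_smul]
      by_cases hst : s = t
      · subst hst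
        simp only [if_true, beq_self_eq_true]
        push_cast
        module
      · have : ¬ (t == s) = true := by simpa using fun h => hst h.symm
        simp only [hst, this, if_false, add_zero, Bool.false_eq_true]) l hw
  simpa [sub_eq_zero] using this

/-- The states of degree `d` in the bosonic creation operators. -/
def homDeg (e : Module.Basis (Fin 3) K L) : ℕ → Submodule K (W K (Fin 3))
  | 0 => Submodule.span K {vac K (Fin 3)}
  | d + 1 => Submodule.span K {w | ∃ s a, ∃ v ∈ homDeg e d, w = creat e s a v}

theorem mem_homDeg_of_mem_multiHom [CharZero K] {l : List SymCopy} {w : W K (Fin 3)}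
    (hw : w ∈ multiHom e l) : w ∈ homDeg e l.length :=
  multiHom_le (e := e) (fun l => homDeg e l.length) (Submodule.mem_span_singleton_self _)
    (fun s _ a v hv => Submodule.subset_span ⟨s, a, v, hv, rfl⟩) l hw

theorem annih_eq_zero_of_mem_homDeg {w : W K (Fin 3)} (hw : w ∈ homDeg e 0) (t : SymCopy) (b : L) :
    annih e t b w = 0 := by
  obtain ⟨r, rfl⟩ := Submodule.mem_span_singleton.1 hw
  rw [map_smul, annih_vac, smul_zero]

theorem annih_mem_homDeg {d : ℕ} {w : W K (Fin 3)} (hw : w ∈ homDeg e (d + 1)) (t : SymCopy)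
    (b : L) : annih e t b w ∈ homDeg e d := by
  induction d generalizing w with
  | zero =>
    refine (Submodule.span_le.2 ?_ : homDeg e 1 ≤ (homDeg e 0).comap (annih e t b)) hw
    rintro _ ⟨s, a, v, hv, rfl⟩
    simp only [Submodule.comap_coe, Set.mem_preimage, annih_creat,
      annih_eq_zero_of_mem_homDeg hv, map_zero, zero_add]
    exact Submodule.smul_mem _ _ hv
  | succ d ih =>
    refine (Submodule.span_le.2 ?_ : homDeg e (d + 2) ≤ (homDeg e (d + 1)).comap (annih e t b)) hw
    rintro _ ⟨s, a, v, hv, rfl⟩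
    simp only [Submodule.comap_coe, Set.mem_preimage, annih_creat]
    exact add_mem (Submodule.subset_span ⟨s, a, _, ih hv, rfl⟩) (Submodule.smul_mem _ _ hv)

theorem eq_vacCoeff_smul {w : W K (Fin 3)} (hw : w ∈ homDeg e 0) :
    w = vacCoeff K (Fin 3) w • vac K (Fin 3) := by
  obtain ⟨r, rfl⟩ := Submodule.mem_span_singleton.1 hw
  rw [map_smul, vacCoeff_vac, smul_eq_mul, mul_one]

theorem theta_of_mem_homDeg {w : W K (Fin 3)} (hw : w ∈ homDeg e 0) (u : L) (j : ℕ) :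
    theta e u j w = 0 := by
  obtain ⟨r, rfl⟩ := Submodule.mem_span_singleton.1 hw
  rw [map_smul, theta_vac e u (by omega), smul_zero]

/-- The coefficients of a quadratic state. -/
def coeff₂ (e : Module.Basis (Fin 3) K L) (w : W K (Fin 3)) (s t : SymCopy) : L →ₗ[K] L →ₗ[K] K :=
  LinearMap.mk₂ K (fun a b => vacCoeff K (Fin 3) (annih e s a (annih e t b w)))
    (by simp) (by simp) (by simp) (by simp)

theorem coeff₂_apply (w : W K (Fin 3)) (s t : SymCopy) (a b : L) :
    coeff₂ e w s t a b = vacCoeff K (Fin 3) (annih e s a (annih e t b w)) := rfl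

/-- The coefficients of a cubic state. -/
def coeff₃ (e : Module.Basis (Fin 3) K L) (w : W K (Fin 3)) (s t r : SymCopy) :
    L →ₗ[K] L →ₗ[K] L →ₗ[K] K :=
  LinearMap.mk₂ K (fun a b => vacCoeff K (Fin 3) ∘ₗ (annih e s a * annih e t b) ∘ₗ
      (annih e r).flip w)
    (by intros; ext; simp) (by intros; ext; simp) (by intros; ext; simp) (by intros; ext; simp)

theorem coeff₃_apply (w : W K (Fin 3)) (s t r : SymCopy) (a b c : L) :
    coeff₃ e w s t r a b c =
      vacCoeff K (Fin 3) (annih e s a (annih e t b (annih e r c w))) := rfl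

theorem coeff₃_swap₁₂ (w : W K (Fin 3)) (s t r : SymCopy) (a b c : L) :
    coeff₃ e w s t r a b c = coeff₃ e w t s r b a c := by
  rw [coeff₃_apply, annih_annih, coeff₃_apply]

theorem coeff₃_swap₂₃ (w : W K (Fin 3)) (s t r : SymCopy) (a b c : L) :
    coeff₃ e w s t r a b c = coeff₃ e w s r t a c b := by
  rw [coeff₃_apply, annih_annih t r, coeff₃_apply]

/-- Two annihilation operators bring `w` down to a multiple of the vacuum, which θ kills; what
remains are the commutators of θ with these operators. -/
theorem IsSL2Basis.coeff₂_theta [CharZero K] (he : IsSL2Basis e) {w : W K (Fin 3)}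
    (hw : w ∈ homDeg e 2) {u : L} {j : ℕ} (h : theta e u j w = 0) (s t : SymCopy) (a b : L) :
    coeff₂ e w (s.shift j) t ⁅u, a⁆ b + coeff₂ e w s (t.shift j) a ⁅u, b⁆ = 0 := by
  have h0 : vacCoeff K (Fin 3) (annih e s a (annih e t b (theta e u j w))) = 0 := by
    simp only [h, map_zero]
  have hd := theta_of_mem_homDeg (annih_mem_homDeg (annih_mem_homDeg hw t b) s a) u j
  simp only [he.theta_annih, map_sub, hd, map_zero] at h0
  simp only [coeff₂_apply]
  linear_combination -h0

theorem IsSL2Basis.coeff₃_theta [CharZero K] (he : IsSL2Basis e) {w : W K (Fin 3)}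
    (hw : w ∈ homDeg e 3) {u : L} {j : ℕ} (h : theta e u j w = 0) (s t r : SymCopy) (a b c : L) :
    coeff₃ e w (s.shift j) t r ⁅u, a⁆ b c + coeff₃ e w s (t.shift j) r a ⁅u, b⁆ c +
      coeff₃ e w s t (r.shift j) a b ⁅u, c⁆ = 0 := by
  have h0 : vacCoeff K (Fin 3)
      (annih e s a (annih e t b (annih e r c (theta e u j w)))) = 0 := by
    simp only [h, map_zero]
  have hd := theta_of_mem_homDeg
    (annih_mem_homDeg (annih_mem_homDeg (annih_mem_homDeg hw r c) t b) s a) u j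
  simp only [he.theta_annih, map_sub, hd, map_zero] at h0
  simp only [coeff₃_apply]
  linear_combination -h0

theorem vacCoeff_num (s : SymCopy) (w : W K (Fin 3)) : vacCoeff K (Fin 3) (num e s w) = 0 := by
  simp only [num_apply, map_casSum, vacCoeff_creat, casSum_zero]

theorem num_annih_of_eq_smul [CharZero K] {q : SymCopy} {w : W K (Fin 3)} {c : K}
    (h : num e q w = c • w) (t : SymCopy) (b : L) :
    num e q (annih e t b w) = (c - if q = t then 1 else 0) • annih e t b w := by
  have := num_annih (e := e) q t b w
  rw [h, map_smul] at this
  rw [sub_smul, this]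
  split_ifs <;> simp

theorem cast_count_cons (q s : SymCopy) (l : List SymCopy) :
    ((s :: l).count q : K) = l.count q + if q = s then 1 else 0 := by
  rw [List.count_cons]
  by_cases h : q = s
  · simp [h]
  · simp [h, Ne.symm h]

/-- A coefficient vanishes unless its multidegree is that of the state. -/
theorem coeff₂_eq_zero [CharZero K] {l : List SymCopy} {w : W K (Fin 3)}
    (hw : w ∈ multiHom e l) (s t q : SymCopy)
    (hq : l.count q ≠ [s, t].count q) : coeff₂ e w s t = 0 := by
  ext a b
  -- After the two annihilations the state is an eigenvector of `num e q`, whose values have no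
  -- vacuum component; so either the eigenvalue or the coefficient is zero.
  have h := num_annih_of_eq_smul (num_annih_of_eq_smul (num_of_mem_multiHom q hw) t b) s a
  have h2 := congrArg (vacCoeff K (Fin 3)) h
  rw [vacCoeff_num, map_smul, smul_eq_mul, eq_comm, mul_eq_zero] at h2
  refine h2.resolve_left fun h3 => hq ?_
  have : (l.count q : K) = [s, t].count q := by
    simp only [cast_count_cons, List.count_nil, Nat.cast_zero]
    linear_combination h3
  exact_mod_cast this

theorem coeff₃_eq_zero [CharZero K] {l : List SymCopy} {w : W K (Fin 3)}
    (hw : w ∈ multiHom e l) (s t r q : SymCopy)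
    (hq : l.count q ≠ [s, t, r].count q) : coeff₃ e w s t r = 0 := by
  ext a b c
  have h := num_annih_of_eq_smul (num_annih_of_eq_smul
    (num_annih_of_eq_smul (num_of_mem_multiHom q hw) r c) t b) s a
  have h2 := congrArg (vacCoeff K (Fin 3)) h
  rw [vacCoeff_num, map_smul, smul_eq_mul, eq_comm, mul_eq_zero] at h2
  refine h2.resolve_left fun h3 => hq ?_
  have : (l.count q : K) = [s, t, r].count q := by
    simp only [cast_count_cons, List.count_nil, Nat.cast_zero]
    linear_combination h3
  exact_mod_cast this

/-- A quadratic state is determined by its coefficients. -/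
theorem quadratic_expansion [CharZero K] {s t : SymCopy} {w : W K (Fin 3)}
    (hw : w ∈ multiHom e [s, t]) : ∃ m : K, m ≠ 0 ∧
      casSum e (fun a a' => casSum e fun b b' =>
        coeff₂ e w t s b' a' • creat e s a (creat e t b (vac K (Fin 3)))) = m • w := by
  have hd : ∀ a' b', annih e t b' (annih e s a' w) =
      coeff₂ e w t s b' a' • vac K (Fin 3) := fun a' b' =>
    eq_vacCoeff_smul (annih_mem_homDeg (annih_mem_homDeg (mem_homDeg_of_mem_multiHom hw) s a') t b')
  -- The double sum counts first the factors from `s`, then those from `t` after one factor is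
  -- removed: `m` is 2 if the copies agree and 1 otherwise.
  refine ⟨([s, t].count t - if t = s then 1 else 0 : K) * ([s, t].count s : K), ?_, ?_⟩
  · simp only [cast_count_cons, List.count_nil, Nat.cast_zero]
    by_cases h : t = s
    · subst h
      norm_num
    · simp [h, Ne.symm h]
  · simp only [← map_smul, ← hd, ← map_casSum]
    simp only [← num_apply, num_annih_of_eq_smul (num_of_mem_multiHom t hw), map_smul,
      casSum_smul, num_of_mem_multiHom s hw, smul_smul]

/-- A state killed by all `annih e q b` on which `num e q` has a nonzero eigenvalue is zero; this is
applied to `r`, `t` and `s` in turn. -/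
theorem cubic_eq_zero [CharZero K] {s t r : SymCopy} {w : W K (Fin 3)}
    (hw : w ∈ multiHom e [s, t, r]) (h : coeff₃ e w r t s = 0) : w = 0 := by
  have hd : ∀ a b c, annih e r c (annih e t b (annih e s a w)) = 0 := fun a b c => by
    rw [eq_vacCoeff_smul (annih_mem_homDeg (annih_mem_homDeg (annih_mem_homDeg
      (mem_homDeg_of_mem_multiHom hw) s a) t b) r c), ← coeff₃_apply, h]
    simp
  have h1 := fun a b => num_annih_of_eq_smul
    (num_annih_of_eq_smul (num_of_mem_multiHom r hw) s a) t b
  have h2 := fun a => num_annih_of_eq_smul (num_of_mem_multiHom t hw) s a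
  have h3 := num_of_mem_multiHom s hw
  simp only [num_apply r, hd, map_zero, casSum_zero] at h1
  have c1 : ([s, t, r].count r - (if r = s then 1 else 0) - if r = t then 1 else 0 : K) ≠ 0 := by
    simp [cast_count_cons]
  have h1' := fun a b => (smul_eq_zero.1 (h1 a b).symm).resolve_left c1
  simp only [num_apply t, h1', map_zero, casSum_zero] at h2
  have c2 : ([s, t, r].count t - (if t = s then 1 else 0) : K) ≠ 0 := by
    simp only [cast_count_cons, List.count_nil, Nat.cast_zero]
    split_ifs <;> norm_num
  have h2' := fun a => (smul_eq_zero.1 (h2 a).symm).resolve_left c2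
  simp only [num_apply s, h2', map_zero, casSum_zero] at h3
  have c3 : ([s, t, r].count s : K) ≠ 0 := by
    simp only [cast_count_cons, List.count_nil, Nat.cast_zero]
    split_ifs <;> norm_num
  exact (smul_eq_zero.1 h3.symm).resolve_left c3

end Multihomogeneous

/-! ### Closed invariants of degrees two and three. -/

section Classification

variable {K L : Type*} [Field K] [LieRing L] [LieAlgebra K L] {e : Module.Basis (Fin 3) K L}

theorem SymCopy.shift_zero (s : SymCopy) : s.shift 0 = s := by cases s <;> rfl

theorem SymCopy.shift_ne_self (s : SymCopy) : s.shift 1 ≠ s := by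
  cases s <;> simp [SymCopy.shift]

theorem SymCopy.shift_injective {s t : SymCopy} (h : s.shift 1 = t.shift 1) : s = t := by
  cases s <;> cases t <;> simp_all [SymCopy.shift]

/-- There are only two kinds of copies, hence only two copies of level zero. -/
theorem SymCopy.exists_level_pos {s t r : SymCopy} (h1 : s ≠ t) (h2 : t ≠ r) (h3 : s ≠ r) :
    0 < s.level ∨ 0 < t.level ∨ 0 < r.level := by
  by_contra! h
  simp only [Nat.le_zero] at h
  obtain ⟨hs, ht, hr⟩ := h
  have k1 : s.kind ≠ t.kind := fun hk => h1 (SymCopy.ext_iff'.2 ⟨hk, hs.trans ht.symm⟩)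
  have k2 : t.kind ≠ r.kind := fun hk => h2 (SymCopy.ext_iff'.2 ⟨hk, ht.trans hr.symm⟩)
  have k3 : s.kind ≠ r.kind := fun hk => h3 (SymCopy.ext_iff'.2 ⟨hk, hs.trans hr.symm⟩)
  revert k1 k2 k3
  cases s.kind <;> cases t.kind <;> cases r.kind <;> simp

/-- There are no nonzero `Q`-closed invariants of degree three. -/
theorem IsSL2Basis.eq_zero_of_cubic [CharZero K] (he : IsSL2Basis e) {s t r : SymCopy}
    {w : W K (Fin 3)} (hw : w ∈ multiHom e [r, t, s])
    (hθ : ∀ (u : L) (j : ℕ), theta e u j w = 0) : w = 0 := by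
  have hd := mem_homDeg_of_mem_multiHom hw
  have hinv := fun u => he.coeff₃_theta hd (hθ u 0) s t r
  simp only [SymCopy.shift_zero] at hinv
  have hone := fun u => he.coeff₃_theta hd (hθ u 1)
  have h2 : ∀ x : K, x + x = 0 → x = 0 := fun x hx => by linear_combination (1 / 2) * hx
  -- A coefficient vanishes as soon as one copy occurring in `w` is missing from its index.
  have hc : ∀ {q s' t' r' : SymCopy}, q = s ∨ q = t ∨ q = r → q ≠ s' → q ≠ t' → q ≠ r' →
      coeff₃ e w s' t' r' = 0 := by
    intro q s' t' r' hq h1 h2 h3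
    refine coeff₃_eq_zero hw s' t' r' q ?_
    rw [List.count_eq_zero_of_not_mem (a := q) (l := [s', t', r']) (by simp [h1, h2, h3])]
    exact (List.count_pos_iff.2 (by simp only [List.mem_cons, List.not_mem_nil]; tauto)).ne'
  obtain ⟨r1, r2, r3, r4, r5⟩ := he.trilin_relations _ hinv
  refine cubic_eq_zero hw (he.trilin_eq_zero _ hinv ?_)
  -- If two copies coincide, the alternating form is also symmetric in those two arguments, hence
  -- zero.
  by_cases h12 : s = t
  · subst h12
    rw [coeff₃_swap₁₂] at r1
    exact h2 _ (by linear_combination r1)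
  by_cases h23 : t = r
  · subst h23
    rw [coeff₃_swap₂₃] at r2
    exact h2 _ (by linear_combination r2)
  by_cases h13 : s = r
  · subst h13
    rw [coeff₃_swap₁₂, coeff₃_swap₂₃, coeff₃_swap₁₂] at r3
    exact h2 _ (by linear_combination r3)
  rcases SymCopy.exists_level_pos h12 h23 h13 with h | h | h
  · obtain ⟨s', rfl⟩ := SymCopy.exists_shift_eq h
    -- The middle argument x is killed by u = x. Of the other two terms the first is the wanted
    -- entry; the third vanishes by multidegree, unless `r = s'`, when it equals the first.
    have key := hone (e 0) s' t r (e 1) (e 0) (e 1)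
    rw [lie_self, LinearMap.map_zero, LinearMap.zero_apply, add_zero, he.lie_xy] at key
    by_cases hr : r = s'
    · subst hr
      rw [coeff₃_swap₁₂ w r, coeff₃_swap₂₃ w t, coeff₃_swap₁₂ w t] at key
      exact h2 _ key
    · rwa [hc (q := s'.shift 1) (Or.inl rfl) (SymCopy.shift_ne_self s') h12
        (fun h => hr (SymCopy.shift_injective h).symm), LinearMap.zero_apply, LinearMap.zero_apply,
        LinearMap.zero_apply, add_zero] at key
  · obtain ⟨t', rfl⟩ := SymCopy.exists_shift_eq h
    -- The same argument with x in the first slot, which u = x kills; alternation (`r1`) carries the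
    -- resulting entry to the wanted one.
    have key := hone (e 0) s t' r (e 0) (e 1) (e 1)
    rw [lie_self, map_zero, LinearMap.zero_apply, LinearMap.zero_apply, zero_add, he.lie_xy] at key
    suffices coeff₃ e w s (t'.shift 1) r (e 0) (e 2) (e 1) = 0 by
      linear_combination r1 - this
    by_cases hr : r = t'
    · subst hr
      rw [coeff₃_swap₂₃ w s r] at key
      exact h2 _ key
    · rwa [hc (q := t'.shift 1) (Or.inr (Or.inl rfl)) (Ne.symm h12) (SymCopy.shift_ne_self t')
        (fun h => hr (SymCopy.shift_injective h).symm), LinearMap.zero_apply, LinearMap.zero_apply,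
        LinearMap.zero_apply, add_zero] at key
  · obtain ⟨r', rfl⟩ := SymCopy.exists_shift_eq h
    have key := hone (e 0) s t r' (e 0) (e 1) (e 1)
    rw [lie_self, map_zero, LinearMap.zero_apply, LinearMap.zero_apply, zero_add, he.lie_xy] at key
    suffices coeff₃ e w s t (r'.shift 1) (e 0) (e 1) (e 2) = 0 by
      linear_combination this - r5
    by_cases hr : t = r'
    · subst hr
      rw [coeff₃_swap₂₃ w s (t.shift 1)] at key
      exact h2 _ key
    · rwa [hc (q := r'.shift 1) (Or.inr (Or.inr rfl)) (Ne.symm h13)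
        (fun h => hr (SymCopy.shift_injective h).symm) (SymCopy.shift_ne_self r'),
        LinearMap.zero_apply, LinearMap.zero_apply, LinearMap.zero_apply, zero_add] at key

/-- The quadratic invariant built from two copies. -/
def quad (e : Module.Basis (Fin 3) K L) (s t : SymCopy) : W K (Fin 3) :=
  casSum e fun a b => creat e s a (creat e t b (vac K (Fin 3)))

theorem quad_comm (s t : SymCopy) : quad e s t = quad e t s := by
  rw [quad, ← casSum_swap]
  simp only [creat_creat s t]
  rfl

theorem quad_beta_beta (n m : ℕ) : quad e (.beta n) (.beta m) =
    str e [.beta (-n - 1) (e 2), .beta (-m - 1) (e 2)] (vac K (Fin 3))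
      + (2 : K) • str e [.beta (-n - 1) (e 0), .beta (-m - 1) (e 1)] (vac K (Fin 3))
      + (2 : K) • str e [.beta (-n - 1) (e 1), .beta (-m - 1) (e 0)] (vac K (Fin 3)) := by
  simp only [quad, casSum, str, List.map_cons, List.map_nil, List.prod_cons, List.prod_nil, mul_one,
    Module.End.mul_apply, creat, SymCopy.kind, SymCopy.level, cur_false]
  abel

theorem quad_gamma_gamma [CharZero K] (n m : ℕ) : quad e (.gamma n) (.gamma m) =
    str e [.gamma (-n) (e.coord 2), .gamma (-m) (e.coord 2)] (vac K (Fin 3))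
      + (1 / 2 : K) • str e [.gamma (-n) (e.coord 0), .gamma (-m) (e.coord 1)] (vac K (Fin 3))
      + (1 / 2 : K) • str e [.gamma (-n) (e.coord 1), .gamma (-m) (e.coord 0)] (vac K (Fin 3)) := by
  simp only [quad, casSum, str, List.map_cons, List.map_nil, List.prod_cons, List.prod_nil, mul_one,
    Module.End.mul_apply, creat, SymCopy.kind, SymCopy.level, cur_true, ← gammaOp_apply, phi_x,
    phi_y, phi_h, map_smul, LinearMap.smul_apply, smul_smul]
  norm_num
  abel

theorem quad_beta_gamma [CharZero K] (n m : ℕ) : quad e (.beta n) (.gamma m) =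
    str e [.beta (-n - 1) (e 2), .gamma (-m) (e.coord 2)] (vac K (Fin 3))
      + str e [.beta (-n - 1) (e 0), .gamma (-m) (e.coord 0)] (vac K (Fin 3))
      + str e [.beta (-n - 1) (e 1), .gamma (-m) (e.coord 1)] (vac K (Fin 3)) := by
  simp only [quad, casSum, str, List.map_cons, List.map_nil, List.prod_cons, List.prod_nil, mul_one,
    Module.End.mul_apply, creat, SymCopy.kind, SymCopy.level, cur_true, ← gammaOp_apply, phi_x,
    phi_y, phi_h, cur_false, map_smul, LinearMap.smul_apply, smul_smul]
  norm_num
  abel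

theorem op_beta_comm (n m : ℤ) (u u' : L) (w : W K (Fin 3)) :
    op e (.beta n u) (op e (.beta m u') w) = op e (.beta m u') (op e (.beta n u) w) :=
  op_op_of_contraction_eq_zero rfl (Or.inl rfl) w

theorem op_gamma_comm (n m : ℤ) (u u' : Module.Dual K L) (w : W K (Fin 3)) :
    op e (.gamma n u) (op e (.gamma m u') w) = op e (.gamma m u') (op e (.gamma n u) w) :=
  op_op_of_contraction_eq_zero rfl (Or.inl rfl) w

/-- The copies from which the five closed states are built. -/
def closedPair : Fin 5 → SymCopy × SymCopy :=
  ![(.beta 0, .beta 0), (.beta 0, .beta 1), (.gamma 0, .gamma 0), (.gamma 0, .gamma 1),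
    (.beta 0, .gamma 0)]

theorem v_eq_quad [CharZero K] (i : Fin 5) :
    v e i = quad e (closedPair i).1 (closedPair i).2 := by
  fin_cases i
  · simp [v, closedPair, quad_beta_beta, str, op_beta_comm _ _ (e 1) (e 0)]
    module
  · simp [v, closedPair, quad_beta_beta, str]
  · simp [v, closedPair, quad_gamma_gamma, str, op_gamma_comm _ _ (e.coord 1) (e.coord 0)]
    module
  · simp [v, closedPair, quad_gamma_gamma, str]
  · simp [v, closedPair, quad_beta_gamma, str]

/-- A quadratic state that is annihilated by the positive loops is one of the five. -/
theorem IsSL2Basis.exists_eq_smul_v [CharZero K] (he : IsSL2Basis e) {s t : SymCopy}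
    {w : W K (Fin 3)} (h0 : w ≠ 0) (hw : w ∈ multiHom e [s, t])
    (hθ : ∀ (u : L) (j : ℕ), theta e u j w = 0) : ∃ i, ∃ a : K, a ≠ 0 ∧ w = a • v e i := by
  have hd := mem_homDeg_of_mem_multiHom hw
  have hinv := fun u => he.coeff₂_theta hd (hθ u 0) t s
  simp only [SymCopy.shift_zero] at hinv
  have hone := fun u => he.coeff₂_theta hd (hθ u 1)
  have hb := he.bilin_eq _ hinv
  obtain ⟨m, hm, hexp⟩ := quadratic_expansion hw
  set c := coeff₂ e w t s (e 2) (e 2) with hcdef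
  -- The coefficient form is `c` times `phi`, and contracting `phi` with one of the two Casimir
  -- tensors in the expansion leaves `quad`.
  have hq : c • quad e s t = m • w := by
    rw [← hexp, quad, ← casSum_smul]
    congr 1
    funext a a'
    simp only [hb, mul_smul, casSum_smul]
    congr 1
    exact (casSum_phi_smul ((LinearMap.compr₂ (creat e t) (creat e s a)).flip
      (vac K (Fin 3))) a').symm
  have hc0 : c ≠ 0 := fun hc =>
    h0 ((smul_eq_zero.1 (hq.symm.trans (by rw [hc, zero_smul]))).resolve_left hm)
  have hwq : w = (c / m) • quad e s t := by
    rw [div_eq_inv_mul, mul_smul, hq, inv_smul_smul₀ hm]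
  have hcount : ∀ {q s' t' : SymCopy}, q = s ∨ q = t → q ≠ s' → q ≠ t' →
      coeff₂ e w s' t' = 0 := by
    intro q s' t' hq h1 h2
    refine coeff₂_eq_zero hw s' t' q ?_
    rw [List.count_eq_zero_of_not_mem (a := q) (l := [s', t']) (by simp [h1, h2])]
    exact (List.count_pos_iff.2 (by simp only [List.mem_cons, List.not_mem_nil]; tauto)).ne'
  -- With u = x and arguments h, y one term is S(h, [x,y]) = S(h,h) = `c`. The other involves the
  -- copies `t.shift 1` and `s'`, and vanishes by multidegree unless `t = s'`.
  have hs : ∀ s', s'.shift 1 = s → t = s' := by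
    rintro s' rfl
    by_contra hne
    have key := hone (e 0) t s' (e 2) (e 1)
    rw [he.lie_xy, hcount (q := s'.shift 1) (Or.inl rfl)
      (fun h => hne (SymCopy.shift_injective h).symm) (SymCopy.shift_ne_self s'),
      LinearMap.zero_apply, LinearMap.zero_apply, zero_add] at key
    exact hc0 key
  have ht : ∀ t', t'.shift 1 = t → s = t' := by
    rintro t' rfl
    by_contra hne
    have key := hone (e 0) t' s (e 1) (e 2)
    rw [he.lie_xy, hcount (q := t'.shift 1) (s' := t') (Or.inr rfl)
      (SymCopy.shift_ne_self t') (fun h => hne (SymCopy.shift_injective h).symm),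
      LinearMap.zero_apply, LinearMap.zero_apply, add_zero] at key
    exact hc0 key
  -- Both levels zero leaves three unordered pairs; one positive level determines the other copy, of
  -- the same kind and one level lower. Two positive levels would each have to exceed the other by
  -- one.
  have hfin : ∃ i, quad e s t = v e i := by
    simp only [v_eq_quad]
    rcases Nat.eq_zero_or_pos s.level with hs0 | hs0
    · rcases Nat.eq_zero_or_pos t.level with ht0 | ht0
      · cases s <;> cases t <;> simp only [SymCopy.level] at hs0 ht0 <;> subst hs0 <;> subst ht0
        · exact ⟨0, rfl⟩
        · exact ⟨4, rfl⟩
        · exact ⟨4, quad_comm _ _⟩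
        · exact ⟨2, rfl⟩
      · obtain ⟨t', rfl⟩ := SymCopy.exists_shift_eq ht0
        obtain rfl := ht t' rfl
        cases s <;> simp only [SymCopy.level] at hs0 <;> subst hs0
        · exact ⟨1, rfl⟩
        · exact ⟨3, rfl⟩
    · obtain ⟨s', rfl⟩ := SymCopy.exists_shift_eq hs0
      obtain rfl := hs s' rfl
      rcases Nat.eq_zero_or_pos t.level with ht0 | ht0
      · cases t <;> simp only [SymCopy.level] at ht0 <;> subst ht0
        · exact ⟨1, quad_comm _ _⟩
        · exact ⟨3, quad_comm _ _⟩
      · obtain ⟨t', rfl⟩ := SymCopy.exists_shift_eq ht0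
        have := congrArg SymCopy.level (ht t' rfl)
        simp only [SymCopy.level_shift] at this
        omega
  obtain ⟨i, hi⟩ := hfin
  exact ⟨i, c / m, div_ne_zero hc0 hm, by rw [← hi, hwq]⟩

theorem creat_mem_multiHom {l : List SymCopy} {w : W K (Fin 3)} (hw : w ∈ multiHom e l)
    (s : SymCopy) (a : L) : creat e s a w ∈ multiHom e (s :: l) := by
  refine (Submodule.span_le.2 ?_ : multiHom e l ≤ (multiHom e (s :: l)).comap (creat e s a)) hw
  rintro _ ⟨gs, hgs, rfl⟩
  refine Submodule.subset_span ?_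
  cases s with
  | beta n => exact ⟨.beta (-n - 1) a :: gs, .cons ⟨a, rfl⟩ hgs, by simp [str]; rfl⟩
  | gamma n => exact ⟨.gamma (-n) (phi e a) :: gs, .cons ⟨phi e a, rfl⟩ hgs, by simp [str]; rfl⟩

theorem vac_mem_multiHom : vac K (Fin 3) ∈ multiHom e [] :=
  Submodule.subset_span ⟨[], .nil, by simp [str]⟩

theorem casSum_mem {p : Submodule K (W K (Fin 3))} {F : L → L → W K (Fin 3)}
    (h : ∀ a b, F a b ∈ p) : casSum e F ∈ p :=
  add_mem (add_mem (p.smul_mem _ (h _ _)) (p.smul_mem _ (h _ _))) (h _ _)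

theorem quad_mem_multiHom (s t : SymCopy) : quad e s t ∈ multiHom e [s, t] :=
  casSum_mem fun a b => creat_mem_multiHom (creat_mem_multiHom vac_mem_multiHom t b) s a

theorem annih_quad [CharZero K] (s t : SymCopy) (b : L) : annih e s b (quad e s t) =
    (1 + if s = t then 1 else 0 : K) • creat e t b (vac K (Fin 3)) := by
  have e1 : casSum e (fun a c => phi e b a • creat e t c (vac K (Fin 3))) =
      creat e t b (vac K (Fin 3)) := by
    rw [casSum_swap fun c a => phi e b a • creat e t c (vac K (Fin 3))]
    simp only [phi_symm e b]
    exact casSum_phi_smul ((creat e t).flip (vac K (Fin 3))) b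
  have e2 : casSum e (fun a c => phi e b c • creat e s a (vac K (Fin 3))) =
      creat e s b (vac K (Fin 3)) := by
    simp only [phi_symm e b]
    exact casSum_phi_smul ((creat e s).flip (vac K (Fin 3))) b
  simp only [quad, map_casSum, annih_creat, annih_vac, map_zero, zero_add, map_smul, if_true,
    casSum_add, e1]
  split_ifs with hst
  · subst hst
    rw [e2]
    module
  · simp only [zero_smul, casSum_zero, zero_add, add_zero, one_smul]

theorem coeff₂_quad [CharZero K] (s t : SymCopy) (a b : L) : coeff₂ e (quad e s t) t s a b =
    (1 + if s = t then 1 else 0 : K) * phi e a b := by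
  rw [coeff₂_apply, annih_quad, map_smul, annih_creat, annih_vac, map_zero, if_pos rfl, zero_add,
    map_smul, map_smul, vacCoeff_vac, smul_eq_mul, smul_eq_mul, mul_one]

theorem quad_ne_zero [CharZero K] (s t : SymCopy) : quad e s t ≠ 0 := by
  intro h
  have h1 := coeff₂_quad (e := e) s t (e 2) (e 2)
  rw [h, coeff₂_apply] at h1
  simp only [map_zero, phi_h, Module.Basis.coord_apply, Module.Basis.repr_self,
    Finsupp.single_eq_same, mul_one] at h1
  split_ifs at h1 <;> norm_num at h1

theorem IsSL2Basis.theta_quad [CharZero K] (he : IsSL2Basis e) (s t : SymCopy) (u : L) {j : ℤ}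
    (hj : 0 ≤ j) : theta e u j (quad e s t) = casSum e fun a b =>
      cur e s.kind (s.level - j) ⁅u, a⁆ (creat e t b (vac K (Fin 3))) +
        creat e s a (cur e t.kind (t.level - j) ⁅u, b⁆ (vac K (Fin 3))) := by
  simp only [quad, map_casSum, creat, he.theta_cur, theta_vac e u hj, map_zero, zero_add, add_comm]

theorem IsSL2Basis.isInvariant_quad [CharZero K] (he : IsSL2Basis e) (s t : SymCopy) :
    IsInvariant e (quad e s t) := fun u => by
  rw [he.theta_quad s t u le_rfl]
  simp only [sub_zero]
  exact he.casSum_lie (biOp (creat e s) (creat e t) (vac K (Fin 3))) u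

theorem IsSL2Basis.isPureSymGen_quad [CharZero K] (he : IsSL2Basis e) (s t : SymCopy) :
    IsPureSymGen e 2 (quad e s t) :=
  ⟨quad_ne_zero s t, he.isInvariant_quad s t, [s, t], rfl, quad_mem_multiHom s t⟩

/-- Lowering a level-zero current gives an annihilation operator, which commutes with currents of
its own kind. Lowering level one by `j = 1` gives a product of two level-zero currents, symmetric
and so cancelled by `casSum_lie_left`. Only the mixed pair produces a contraction. -/
theorem IsSL2Basis.theta_quad_closedPair [CharZero K] (he : IsSL2Basis e) (i : Fin 5) (u : L)
    {j : ℤ} (hj : 0 ≤ j) : theta e u j (quad e (closedPair i).1 (closedPair i).2) = 0 := by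
  rcases hj.eq_or_lt with rfl | hj'
  · exact he.isInvariant_quad _ _ u
  have same : ∀ (k : Bool) (n m : ℤ) (a b : L), n < 0 →
      cur e k n a (cur e k m b (vac K (Fin 3))) = 0 := fun k n m a b hn => by
    rw [cur_cur_same, cur_vac k hn, map_zero]
  have level_zero : ∀ k : Bool, casSum e (fun a b =>
      cur e k (0 - j) ⁅u, a⁆ (cur e k 0 b (vac K (Fin 3))) +
        cur e k 0 a (cur e k (0 - j) ⁅u, b⁆ (vac K (Fin 3)))) = 0 := fun k => by
    simp only [same k (0 - j) 0 _ _ (by omega), cur_vac k (show 0 - j < 0 by omega), map_zero,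
      add_zero, casSum_zero]
  have level_one : ∀ k : Bool, casSum e (fun a b =>
      cur e k (0 - j) ⁅u, a⁆ (cur e k 1 b (vac K (Fin 3))) +
        cur e k 0 a (cur e k (1 - j) ⁅u, b⁆ (vac K (Fin 3)))) = 0 := fun k => by
    simp only [same k (0 - j) 1 _ _ (by omega), zero_add]
    rcases (show j = 1 ∨ 1 - j < 0 by omega) with rfl | h
    · rw [← casSum_swap]
      simp only [sub_self]
      exact he.casSum_lie_left (biOp (cur e k 0) (cur e k 0) (vac K (Fin 3))).flip
        (fun a b => by
          simp only [LinearMap.flip_apply, biOp_apply]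
          exact cur_cur_same k 0 0 b a _) u
    · simp only [cur_vac k h, map_zero, casSum_zero]
  rw [he.theta_quad _ _ u hj]
  fin_cases i
  · exact level_zero false
  · exact level_one false
  · exact level_zero true
  · exact level_one true
  · have h1 : ∀ a b, cur e false (0 - j) ⁅u, a⁆ (cur e true 0 b (vac K (Fin 3))) =
        (if j = 1 then (-1 : K) else 0) • phi e b ⁅u, a⁆ • vac K (Fin 3) := fun a b => by
      have := cur_true_cur_false (e := e) 0 (0 - j) b ⁅u, a⁆ (vac K (Fin 3))
      rw [cur_vac false (by omega), map_zero] at this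
      rw [eq_neg_of_add_eq_zero_left this.symm]
      by_cases hj1 : j = 1
      · subst hj1
        norm_num
      · rw [if_neg (by omega), if_neg hj1]
        simp
    -- The contraction in the mixed case is the trace of ad u, which is zero.
    have h2 : casSum e (fun a b => phi e b ⁅u, a⁆ • vac K (Fin 3)) = 0 := by
      have h3 : casSum e (fun a b => phi e ⁅u, a⁆ b) = 0 :=
        he.casSum_lie_left (phi e) (phi_symm e) u
      have h4 := map_casSum (e := e) (LinearMap.toSpanSingleton K _ (vac K (Fin 3)))
        (fun a b => phi e ⁅u, a⁆ b)
      rw [h3, map_zero] at h4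
      simp only [phi_symm e _ ⁅u, _⁆]
      exact h4.symm
    change casSum e (fun a b => cur e false (0 - j) ⁅u, a⁆ (cur e true 0 b (vac K (Fin 3))) +
        cur e false 0 a (cur e true (0 - j) ⁅u, b⁆ (vac K (Fin 3)))) = 0
    simp only [h1, cur_vac true (show 0 - j < 0 by omega), map_zero, add_zero, casSum_smul, h2,
      smul_zero]

theorem IsSL2Basis.Q_v [CharZero K] (he : IsSL2Basis e) (i : Fin 5) : Q e (v e i) = 0 := by
  rw [v_eq_quad]
  exact (isBosonic_of_mem_multiHom (quad_mem_multiHom _ _)).Q_eq_zero e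
    fun u j hj => he.theta_quad_closedPair i u hj

theorem IsSL2Basis.isPureSymGen_v [CharZero K] (he : IsSL2Basis e) (i : Fin 5) :
    IsPureSymGen e 2 (v e i) := by
  rw [v_eq_quad]
  exact he.isPureSymGen_quad _ _

theorem IsPureSymGen.smul {d : ℕ} {w : W K (Fin 3)} (hw : IsPureSymGen e d w) {a : K} (ha : a ≠ 0) :
    IsPureSymGen e d (a • w) := by
  obtain ⟨h0, hi, s, hs, hm⟩ := hw
  exact ⟨smul_ne_zero ha h0, fun u => by rw [map_smul, hi u, smul_zero], s, hs,
    Submodule.smul_mem _ _ hm⟩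

/-- The closed purely symmetric invariants of degrees two and three. -/
theorem IsSL2Basis.closed_pureSymGen [CharZero K] (he : IsSL2Basis e) :
    {w : W K (Fin 3) | (IsPureSymGen e 2 w ∨ IsPureSymGen e 3 w) ∧ Q e w = 0} =
      {w | ∃ i : Fin 5, ∃ a : K, a ≠ 0 ∧ w = a • v e i} := by
  ext w
  constructor
  · rintro ⟨hw, hQ⟩
    have hθ : IsBosonic w → ∀ (u : L) (j : ℕ), theta e u j w = 0 := fun hb u j =>
      hb.theta_eq_zero e hQ u (by omega)
    rcases hw with ⟨h0, -, l, hl, hm⟩ | ⟨h0, -, l, hl, hm⟩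
    · obtain ⟨s, t, rfl⟩ := List.length_eq_two.1 hl
      exact he.exists_eq_smul_v h0 hm (hθ (isBosonic_of_mem_multiHom hm))
    · obtain ⟨r, t, s, rfl⟩ := List.length_eq_three.1 hl
      exact (h0 (he.eq_zero_of_cubic hm (hθ (isBosonic_of_mem_multiHom hm)))).elim
  · rintro ⟨i, a, ha, rfl⟩
    exact ⟨Or.inl ((he.isPureSymGen_v i).smul ha), by rw [map_smul, he.Q_v, smul_zero]⟩

end Classification

/-! ### Infinite families, linear independence and the relations between the states. -/

section Families

variable {K L : Type*} [Field K] [LieRing L] [LieAlgebra K L] {e : Module.Basis (Fin 3) K L}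

/-- The alternating sum of a trilinear expression over the basis. -/
def altSum {M : Type*} [AddCommGroup M] (e : Module.Basis (Fin 3) K L) (F : L → L → L → M) : M :=
  F (e 0) (e 1) (e 2) - F (e 0) (e 2) (e 1) + F (e 1) (e 2) (e 0) - F (e 1) (e 0) (e 2) +
    F (e 2) (e 0) (e 1) - F (e 2) (e 1) (e 0)

theorem map_altSum {M N : Type*} [AddCommGroup M] [Module K M] [AddCommGroup N] [Module K N]
    (T : M →ₗ[K] N) (F : L → L → L → M) :
    T (altSum e F) = altSum e fun a b c => T (F a b c) := by
  simp [altSum]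

theorem altSum_mem {M : Type*} [AddCommGroup M] [Module K M] {p : Submodule K M}
    {F : L → L → L → M} (h : ∀ a b c, F a b c ∈ p) : altSum e F ∈ p :=
  sub_mem (add_mem (sub_mem (add_mem (sub_mem (h _ _ _) (h _ _ _)) (h _ _ _)) (h _ _ _))
    (h _ _ _)) (h _ _ _)

/-- On the top exterior power ad u acts by its trace, which is zero. -/
theorem IsSL2Basis.altSum_lie {M : Type*} [AddCommGroup M] [Module K M] (he : IsSL2Basis e)
    (T : L →ₗ[K] L →ₗ[K] L →ₗ[K] M) (u : L) :
    altSum e (fun a b c => T ⁅u, a⁆ b c + T a ⁅u, b⁆ c + T a b ⁅u, c⁆) = 0 := by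
  obtain ⟨u₁, u₂, u₃, rfl⟩ := exists_eq_smul_add e u
  simp only [altSum, add_lie, smul_lie, lie_self, he.lie_xy, he.lie_hx, he.lie_hy,
    he.lie_yx, he.lie_xh, he.lie_yh, map_add, map_smul, map_neg, map_zero, LinearMap.add_apply,
    LinearMap.smul_apply, LinearMap.neg_apply, LinearMap.zero_apply]
  module

/-- The cubic invariant built from three copies. -/
def cubic (e : Module.Basis (Fin 3) K L) (s t r : SymCopy) : W K (Fin 3) :=
  altSum e fun a b c => creat e s a (creat e t b (creat e r c (vac K (Fin 3))))

theorem cubic_mem_multiHom (s t r : SymCopy) : cubic e s t r ∈ multiHom e [s, t, r] :=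
  altSum_mem fun a b c => creat_mem_multiHom
    (creat_mem_multiHom (creat_mem_multiHom vac_mem_multiHom r c) t b) s a

theorem IsSL2Basis.isInvariant_cubic [CharZero K] (he : IsSL2Basis e) (s t r : SymCopy) :
    IsInvariant e (cubic e s t r) := fun u => by
  let T : L →ₗ[K] L →ₗ[K] L →ₗ[K] W K (Fin 3) :=
    LinearMap.mk₂ K (fun a b => (creat e s a * creat e t b) ∘ₗ (creat e r).flip (vac K (Fin 3)))
      (by intros; ext; simp) (by intros; ext; simp) (by intros; ext; simp) (by intros; ext; simp)
  have hT : ∀ a b c, T a b c = creat e s a (creat e t b (creat e r c (vac K (Fin 3)))) :=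
    fun _ _ _ => rfl
  have hθ : ∀ (s : SymCopy) (a : L) (w : W K (Fin 3)),
      theta e u 0 (creat e s a w) = creat e s a (theta e u 0 w) + creat e s ⁅u, a⁆ w :=
    fun s a w => by
      have := he.theta_cur s.kind s.level 0 u a w
      rwa [sub_zero] at this
  rw [← he.altSum_lie T u, cubic, map_altSum]
  congr 1
  funext a b c
  simp only [hT, hθ, theta_vac e u le_rfl, map_add, map_zero, zero_add]
  abel

theorem cubic_ne_zero [CharZero K] {s t r : SymCopy} (hst : s ≠ t) (htr : t ≠ r) (hsr : s ≠ r) :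
    cubic e s t r ≠ 0 := fun h => by
  -- `phi` pairs x with y and h with itself, so (y, x, h) selects the single term (x, y, h) of the
  -- alternating sum.
  have h1 : annih e s (e 1) (annih e t (e 0) (annih e r (e 2) (cubic e s t r))) = 0 := by
    simp only [h, map_zero]
  simp only [cubic, altSum, map_add, map_sub, annih_creat, annih_vac, map_smul, hst.symm,
    htr.symm, hsr.symm, if_true, if_false, zero_smul, add_zero, map_zero, zero_add, phi_x,
    phi_y, phi_h, LinearMap.smul_apply, Module.Basis.coord_apply, Module.Basis.repr_self,
    Finsupp.single_apply] at h1
  have h2 := congrArg (vacCoeff K (Fin 3)) h1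
  simp [vacCoeff_vac] at h2

theorem IsSL2Basis.isPureSymGen_cubic [CharZero K] (he : IsSL2Basis e) {s t r : SymCopy}
    (hst : s ≠ t) (htr : t ≠ r) (hsr : s ≠ r) : IsPureSymGen e 3 (cubic e s t r) :=
  ⟨cubic_ne_zero hst htr hsr, he.isInvariant_cubic s t r, [s, t, r], rfl,
    cubic_mem_multiHom s t r⟩

/-- Proportional nonzero states have the same multidegree. -/
theorem count_eq_of_span_eq [CharZero K] {l l' : List SymCopy} {w w' : W K (Fin 3)}
    (hw : w ∈ multiHom e l) (hw' : w' ∈ multiHom e l') (h0 : w ≠ 0)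
    (h : Submodule.span K {w} = Submodule.span K {w'}) (s : SymCopy) :
    l.count s = l'.count s := by
  obtain ⟨c, rfl⟩ := Submodule.mem_span_singleton.1 (h ▸ Submodule.mem_span_singleton_self w)
  have h1 := num_of_mem_multiHom s hw
  rw [num_of_mem_multiHom s (Submodule.smul_mem _ c hw')] at h1
  exact_mod_cast (smul_left_injective K h0 h1).symm

theorem IsSL2Basis.infinite_pureSymGen [CharZero K] (he : IsSL2Basis e) {d : ℕ}
    (hd : d = 2 ∨ d = 3) : {l : Submodule K (W K (Fin 3)) |
      ∃ w, IsPureSymGen e d w ∧ l = Submodule.span K {w}}.Infinite := by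
  rcases hd with rfl | rfl
  · refine Set.infinite_of_injective_forall_mem
      (f := fun n => Submodule.span K {quad e (.beta n) (.beta n)}) (fun n m h => ?_)
      fun n => ⟨_, he.isPureSymGen_quad _ _, rfl⟩
    have := count_eq_of_span_eq (quad_mem_multiHom _ _) (quad_mem_multiHom _ _)
      (quad_ne_zero _ _) h (.beta n)
    by_contra hnm
    simp [Ne.symm hnm] at this
  -- The shift by 2 keeps the three copies distinct, as a nonzero alternating cubic requires.
  · have h1 : ∀ n, SymCopy.beta 1 ≠ .beta (n + 2) := fun n => by simp
    have h2 : ∀ n, SymCopy.beta 0 ≠ .beta (n + 2) := fun n => by simp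
    have h0 : SymCopy.beta 0 ≠ .beta 1 := by simp
    refine Set.infinite_of_injective_forall_mem
      (f := fun n => Submodule.span K {cubic e (.beta 0) (.beta 1) (.beta (n + 2))})
      (fun n m h => ?_) fun n => ⟨_, he.isPureSymGen_cubic h0 (h1 n) (h2 n), rfl⟩
    have := count_eq_of_span_eq (cubic_mem_multiHom _ _ _) (cubic_mem_multiHom _ _ _)
      (cubic_ne_zero h0 (h1 n) (h2 n)) h (.beta (n + 2))
    by_contra hnm
    simp [Ne.symm hnm] at this

theorem linearIndependent_v [CharZero K] : LinearIndependent K (v e) := by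
  -- The number of β_{-1} factors plus three times the number of γ_0 factors: the weight 3 makes the
  -- five eigenvalues distinct.
  let μ : Fin 5 → ℕ := ![2, 1, 6, 3, 4]
  have hμ : Function.Injective fun i => (μ i : K) :=
    Nat.cast_injective.comp (by decide : Function.Injective μ)
  refine Module.End.eigenvectors_linearIndependent' (num e (.beta 0) + (3 : K) • num e (.gamma 0))
    (fun i => (μ i : K)) hμ (v e) fun i => ⟨?_, ?_⟩
  · rw [Module.End.mem_eigenspace_iff, v_eq_quad, LinearMap.add_apply, LinearMap.smul_apply,
      num_of_mem_multiHom _ (quad_mem_multiHom _ _), num_of_mem_multiHom _ (quad_mem_multiHom _ _),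
      smul_smul, ← add_smul]
    congr 1
    fin_cases i <;> simp [closedPair, μ] <;> norm_num
  · rw [v_eq_quad]
    exact quad_ne_zero _ _

theorem phiInv_coord (e : Module.Basis (Fin 3) K L) (i : Fin 3) :
    phiInv e (e.coord i) = ![(2 : K) • e 1, (2 : K) • e 0, e 2] i := by
  rw [phiInv, ← Module.Basis.coe_dualBasis, Module.Basis.constr_basis]

theorem op_beta_smul (n : ℤ) (r : K) (u : L) :
    op e (.beta n (r • u)) = r • op e (.beta n u) := (betaOp e n).map_smul r u

theorem op_b_op_bosonic {g : Gen K L} (hg : g.isOdd = false) (n : ℤ) (a : L)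
    (w : W K (Fin 3)) : op e (.b n a) (op e g w) = op e g (op e (.b n a) w) :=
  op_op_of_contraction_eq_zero (by cases g <;> simp_all [contraction, Gen.isOdd]) (Or.inr hg) w

theorem op_c_op_bosonic {g : Gen K L} (hg : g.isOdd = false) (n : ℤ) (f : Module.Dual K L)
    (w : W K (Fin 3)) : op e (.c n f) (op e g w) = op e g (op e (.c n f) w) :=
  op_op_of_contraction_eq_zero (by cases g <;> simp_all [contraction, Gen.isOdd]) (Or.inr hg) w

/-- Writes t, and next h, as the Casimir sum of b_{-1}^a X^b with X a level-zero current, so that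
one argument treats both. -/
theorem tState_eq (e : Module.Basis (Fin 3) K L) :
    tState e = casSum e fun a b => bOp e (-1) a (creat e (.beta 0) b (vac K (Fin 3))) := by
  simp only [tState, str, List.map_cons, List.map_nil, List.prod_cons, List.prod_nil, mul_one,
    Module.End.mul_apply, Fin.sum_univ_three, phiInv_coord, casSum, bOp_apply, creat,
    SymCopy.kind, SymCopy.level, cur_false, op_b_op_bosonic (e := e) (g := .beta _ _) rfl]
  simp [op_beta_smul]

theorem hState_eq [CharZero K] (e : Module.Basis (Fin 3) K L) :
    hState e = casSum e fun a b => bOp e (-1) a (creat e (.gamma 0) b (vac K (Fin 3))) := by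
  simp only [hState, str, List.map_cons, List.map_nil, List.prod_cons, List.prod_nil, mul_one,
    Module.End.mul_apply, bOp_apply, creat,
    SymCopy.kind, SymCopy.level, cur_true, op_b_op_bosonic (e := e) (g := .gamma _ _) rfl]
  refine (sum_coord_eq_casSum (biOp (gammaOp e 0) (bOp e (-1)) (vac K (Fin 3)))).trans ?_
  exact casSum_swap _

theorem rState_eq [CharZero K] (e : Module.Basis (Fin 3) K L) : rState e =
    casSum e fun a b => cOp e (-1) (phi e a) (creat e (.gamma 0) b (vac K (Fin 3))) := by
  simp only [rState, str, List.map_cons, List.map_nil, List.prod_cons, List.prod_nil, mul_one,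
    Module.End.mul_apply, cOp_apply, creat,
    SymCopy.kind, SymCopy.level, cur_true, op_c_op_bosonic (e := e) (g := .gamma _ _) rfl]
  exact sum_coord_eq_casSum
    (biOp (gammaOp e 0 ∘ₗ phi e) (cOp e (-1)) (vac K (Fin 3))).flip

theorem koszul_v_zero [CharZero K] : koszul e (v e 0) = (2 : K) • tState e := by
  rw [v_eq_quad, tState_eq, quad, map_casSum, two_smul]
  -- The derivation h hits either factor of ββ; the symmetry of the tensor identifies the two
  -- results.
  nth_rewrite 2 [← casSum_swap]
  rw [← casSum_add]
  congr 1
  funext a b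
  simp only [closedPair, Matrix.cons_val_zero, creat, SymCopy.kind, SymCopy.level, cur_false,
    koszul_beta, koszul_vac, map_zero, zero_add, bOp_apply, op_b_op_bosonic (e := e)
      (g := .beta _ _) rfl]
  simp

theorem koszul_v_four [CharZero K] : koszul e (v e 4) = hState e := by
  rw [v_eq_quad, hState_eq, quad, map_casSum]
  congr 1
  funext a b
  change koszul e (op e (.beta (-(0 : ℕ) - 1) a) (op e (.gamma (-(0 : ℕ)) (phi e b))
      (vac K (Fin 3)))) =
    op e (.b (-1) a) (op e (.gamma (-(0 : ℕ)) (phi e b)) (vac K (Fin 3)))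
  simp [koszul_beta, koszul_gamma, koszul_vac]

theorem vir_v_one [CharZero K] : vir e 1 (v e 1) = (2 : K) • v e 0 := by
  rw [v_eq_quad, v_eq_quad, quad, quad, map_casSum, ← casSum_smul]
  congr 1
  funext a b
  change vir e 1 (op e (.beta (-(0 : ℕ) - 1) a) (op e (.beta (-(1 : ℕ) - 1) b) (vac K (Fin 3)))) =
    (2 : K) • op e (.beta (-(0 : ℕ) - 1) a) (op e (.beta (-(0 : ℕ) - 1) b) (vac K (Fin 3)))
  -- L_1 turns β_{-1} into β_0, which annihilates the vacuum; only 2β_{-1}, coming from β_{-2},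
  -- survives.
  have h : op e (.beta 0 a) (op e (.beta (-2) b) (vac K (Fin 3))) = 0 := by
    rw [op_beta_comm, op_vac e (by simp [Gen.isCreation]), map_zero]
  simp [vir_beta, vir_vac, h]

/-- Since [k, γ_n] = n c_n, the factor γ_0 contributes nothing and γ_{-1} becomes -c_{-1}. -/
theorem homot_v_three [CharZero K] : homot e (v e 3) = -rState e := by
  rw [v_eq_quad, rState_eq, quad, map_casSum, ← casSum_neg, ← casSum_swap]
  congr 1
  funext a b
  change homot e (op e (.gamma (-(0 : ℕ)) (phi e b))
      (op e (.gamma (-(1 : ℕ)) (phi e a)) (vac K (Fin 3)))) =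
    -op e (.c (-1) (phi e a)) (op e (.gamma (-(0 : ℕ)) (phi e b)) (vac K (Fin 3)))
  rw [op_c_op_bosonic rfl]
  simp [homot_gamma, homot_vac]

theorem v_two_mem_classical : v e 2 ∈ classical e := by
  refine add_mem ?_ ?_
  · exact Submodule.subset_span ⟨_, by simp, rfl⟩
  · exact Submodule.subset_span ⟨_, by simp, rfl⟩

end Families

/-! ### Closedness of t, h and r. -/

section Closed

variable {K L : Type*} [Field K] [LieRing L] [LieAlgebra K L] {e : Module.Basis (Fin 3) K L}

theorem creat_beta_zero : creat e (.beta 0) = betaOp e (-1) := by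
  rw [creat, SymCopy.kind, SymCopy.level, cur]
  norm_num

theorem creat_gamma_zero : creat e (.gamma 0) = gammaOp e 0 ∘ₗ phi e := by
  rw [creat, SymCopy.kind, SymCopy.level, cur]
  norm_num

/-- At level zero a positive loop lowers the current to an annihilation operator, so only j = 0
contributes. -/
theorem IsSL2Basis.Q_creat_vac [CharZero K] (he : IsSL2Basis e) {s : SymCopy} (hs : s.level = 0)
    (b : L) : Q e (creat e s b (vac K (Fin 3))) =
      ∑ u, cOp e 0 (e.coord u) (creat e s ⁅e u, b⁆ (vac K (Fin 3))) := by
  have hb : IsBosonic (cur e s.kind 0 b (vac K (Fin 3))) := isBosonic_vac.cur _ _ _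
  have hθ : ∀ (u : L) (j : ℤ), 0 ≤ j → theta e u j (cur e s.kind 0 b (vac K (Fin 3))) =
      cur e s.kind (0 - j) ⁅u, b⁆ (vac K (Fin 3)) := fun u j hj => by
    rw [he.theta_cur, theta_vac e u hj, map_zero, zero_add]
  rw [creat, hs, Nat.cast_zero]
  rw [hb.Q_apply e, finsum_eq_single _ 0]
  · rw [if_pos le_rfl]
    simp only [hθ _ 0 le_rfl, cOp_apply, neg_zero, sub_zero]
  · intro j hj
    split_ifs with h
    · refine Finset.sum_eq_zero fun u _ => ?_
      rw [hθ _ j h, cur_vac _ (by omega), map_zero]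
    · rfl

theorem theta_neg_one_vac (a : L) : theta e a (-1) (vac K (Fin 3)) =
    ∑ v, (betaOp e (-1) ⁅a, e v⁆ (gammaOp e 0 (e.coord v) (vac K (Fin 3))) +
      bOp e (-1) ⁅a, e v⁆ (cOp e 0 (e.coord v) (vac K (Fin 3)))) := by
  change ∑ᶠ m, thetaTerm e a (-1) m (vac K (Fin 3)) = _
  -- Both factors are creation operators only if m - 1 < 0 and m ≥ 0.
  rw [finsum_eq_single _ 0]
  · simp [thetaTerm, nord, Gen.isCreation, betaOp_apply, gammaOp_apply, bOp_apply, cOp_apply]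
  · intro m hm
    simp only [thetaTerm, LinearMap.sum_apply, LinearMap.add_apply]
    refine Finset.sum_eq_zero fun v _ => ?_
    rw [nord_vac, nord_vac, add_zero] <;>
    · simp [Gen.isCreation]
      omega

theorem casSum_sum {M ι : Type*} [AddCommGroup M] [Module K M] (s : Finset ι)
    (F : ι → L → L → M) :
    casSum e (fun a b => ∑ i ∈ s, F i a b) = ∑ i ∈ s, casSum e (F i) := by
  simp only [casSum, Finset.sum_add_distrib, Finset.smul_sum]

/-- Reversing (a, b, c, d) exchanges and flips the two symmetric tensors, so the sum equals its own
negative. -/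
theorem casSum_casSum_eq_zero {M : Type*} [AddCommGroup M] [Module K M] [CharZero K]
    {G : L → L → L → L → M} (h : ∀ a b c d, G a b c d = -G d c b a) :
    casSum e (fun a b => casSum e fun c d => G a b c d) = 0 := by
  have h1 : casSum e (fun a b => casSum e fun c d => G a b c d) =
      -casSum e (fun a b => casSum e fun c d => G d c b a) := by
    simp only [← casSum_neg, ← h]
  have h2 : casSum e (fun a b => casSum e fun c d => G d c b a) =
      casSum e (fun a b => casSum e fun c d => G a b c d) := by
    rw [casSum_comm, ← casSum_swap]
    congr 1
    funext a b
    exact casSum_swap fun c d => G a b c d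
  rw [h2, eq_neg_iff_add_eq_zero, ← two_smul K] at h1
  exact (smul_eq_zero.1 h1).resolve_left two_ne_zero

/-- `∑_{(a,b)} ∑_v β_{-1}^{[a,v]} γ_0^{v'} X^b 1 = 0` for the copies `X` of level zero. -/
theorem IsSL2Basis.casSum_beta_gamma [CharZero K] (he : IsSL2Basis e) {s : SymCopy}
    (hs : s.level = 0) : casSum e (fun a b => ∑ v, creat e s b
      (betaOp e (-1) ⁅a, e v⁆ (gammaOp e 0 (e.coord v) (vac K (Fin 3))))) = 0 := by
  have h1 : ∀ a b : L, ∑ v, creat e s b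
      (betaOp e (-1) ⁅a, e v⁆ (gammaOp e 0 (e.coord v) (vac K (Fin 3)))) =
      casSum e fun c d => creat e s b (creat e (.beta 0) ⁅a, d⁆
        (creat e (.gamma 0) c (vac K (Fin 3)))) := fun a b => by
    let F : Module.Dual K L →ₗ[K] L →ₗ[K] W K (Fin 3) := LinearMap.mk₂ K (fun f d =>
      creat e s b (betaOp e (-1) ⁅a, d⁆ (gammaOp e 0 f (vac K (Fin 3)))))
      (by simp) (by simp) (by simp) (by simp)
    rw [creat_beta_zero, creat_gamma_zero]
    exact sum_coord_eq_casSum F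
  simp only [h1]
  -- For β the two β-currents commute and `casSum_lie_left` applies for each fixed `c`, `d`. For γ,
  -- reversing the four indices exchanges the two γ's and changes the sign of the bracket.
  cases s with
  | beta n =>
    simp only [SymCopy.level] at hs
    subst hs
    have key : ∀ c d, casSum e (fun a b => creat e (.beta 0) b (creat e (.beta 0) ⁅a, d⁆
        (creat e (.gamma 0) c (vac K (Fin 3))))) = 0 := fun c d => by
      have := he.casSum_lie_left (biOp (creat e (.beta 0)) (creat e (.beta 0))
        (creat e (.gamma 0) c (vac K (Fin 3))))
        (fun a b => by simp only [biOp_apply]; exact creat_creat _ _ _ _ _) d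
      rw [← neg_eq_zero, ← casSum_neg, ← this]
      refine congrArg (casSum e) (funext fun a => funext fun b => ?_)
      rw [biOp_apply, creat_creat (.beta 0) (.beta 0) b, ← lie_skew d a, map_neg,
        LinearMap.neg_apply]
    rw [casSum_comm]
    simp only [key, casSum_zero]
  | gamma n =>
    simp only [SymCopy.level] at hs
    subst hs
    refine casSum_casSum_eq_zero fun a b c d => ?_
    rw [creat_creat, creat_creat (.gamma 0) (.gamma 0), creat_creat (.beta 0) (.gamma 0),
      ← lie_skew d a, map_neg, LinearMap.neg_apply, map_neg,
      neg_neg]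

/-- By {Q, b_{-1}^a} = θ(a_{-1}) three pieces arise besides b_{-1}^a Q X^b 1. The raised current
X_1^{[a,b]} dies by antisymmetry, the βγ part of θ(a_{-1})1 by `casSum_beta_gamma`, and the bc part
cancels b_{-1}^a Q X^b 1 by invariance of the tensor. -/
theorem IsSL2Basis.Q_b_creat [CharZero K] (he : IsSL2Basis e) {s : SymCopy} (hs : s.level = 0) :
    Q e (casSum e fun a b => bOp e (-1) a (creat e s b (vac K (Fin 3)))) = 0 := by
  have hbX : ∀ (a b : L) (w : W K (Fin 3)),
      bOp e (-1) a (creat e s b w) = creat e s b (bOp e (-1) a w) := fun a b w => by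
    cases s <;> exact op_b_op_bosonic rfl _ _ _
  have hcX : ∀ (f : Module.Dual K L) (b : L) (w : W K (Fin 3)),
      cOp e 0 f (creat e s b w) = creat e s b (cOp e 0 f w) := fun f b w => by
    cases s <;> exact op_c_op_bosonic rfl _ _ _
  have hQb : ∀ a w, Q e (bOp e (-1) a w) = theta e a (-1) w - bOp e (-1) a (Q e w) := fun a w => by
    rw [bOp_apply, op_b_Q]
    abel
  have hθ : ∀ a b, theta e a (-1) (creat e s b (vac K (Fin 3))) =
      creat e s b (theta e a (-1) (vac K (Fin 3))) + cur e s.kind 1 ⁅a, b⁆ (vac K (Fin 3)) :=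
    fun a b => by
      rw [creat, he.theta_cur, hs]
      rfl
  have h1 : casSum e (fun a b => cur e s.kind 1 ⁅a, b⁆ (vac K (Fin 3))) = 0 := by
    simp only [casSum, lie_self, he.lie_xy, he.lie_yx, map_neg, map_zero, LinearMap.neg_apply,
      LinearMap.zero_apply]
    module
  have h2 : ∀ v, casSum e (fun a b => creat e s b (bOp e (-1) ⁅a, e v⁆
      (cOp e 0 (e.coord v) (vac K (Fin 3))))) = casSum e (fun a b =>
        creat e s ⁅e v, b⁆ (bOp e (-1) a (cOp e 0 (e.coord v) (vac K (Fin 3))))) := fun v => by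
    have := he.casSum_lie (biOp (bOp e (-1)) (creat e s) (cOp e 0 (e.coord v) (vac K (Fin 3))))
      (e v)
    simp only [biOp_apply, hbX, casSum_add] at this
    rw [eq_comm, ← sub_eq_zero, sub_eq_add_neg, ← casSum_neg, ← this, add_comm]
    congr 1
    congr 1
    funext a b
    rw [← lie_skew, map_neg, LinearMap.neg_apply, map_neg, neg_neg]
  have h3 : casSum e (fun a b => ∑ v, creat e s b (bOp e (-1) ⁅a, e v⁆
      (cOp e 0 (e.coord v) (vac K (Fin 3))))) = casSum e (fun a b => ∑ v,
        creat e s ⁅e v, b⁆ (bOp e (-1) a (cOp e 0 (e.coord v) (vac K (Fin 3))))) := by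
    simp only [casSum_sum, h2]
  rw [map_casSum]
  simp only [hQb, hθ, he.Q_creat_vac hs, theta_neg_one_vac, map_sum, map_add,
    Finset.sum_add_distrib, sub_eq_add_neg, casSum_add, casSum_neg, h1, he.casSum_beta_gamma hs]
  simp only [hcX, hbX, h3]
  simp

/-- If γ_{-i} (or c_{-i}) and c_{-j} annihilate, then i, j < 0, so the factor of mode i + j is a
creation operator. -/
theorem vacCoeff_QTerm (p : ℤ × ℤ) (w : W K (Fin 3)) :
    vacCoeff K (Fin 3) (QTerm e p w) = 0 := by
  simp only [QTerm, LinearMap.sum_apply, LinearMap.add_apply, LinearMap.smul_apply, map_sum,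
    map_add,
    map_smul]
  refine Finset.sum_eq_zero fun u _ => Finset.sum_eq_zero fun v _ => ?_
  rw [vacCoeff_nord, vacCoeff_nord, smul_zero, add_zero] <;>
  · simp [Gen.isCreation]
    omega

theorem functional_Q (ψ : W K (Fin 3) →ₗ[K] K) (w : W K (Fin 3)) :
    ψ (Q e w) = ∑ᶠ p, ψ (QTerm e p w) := map_finsum ψ (locFin_Q e w)

theorem functional_Q_eq_zero {ψ : W K (Fin 3) →ₗ[K] K} {w : W K (Fin 3)}
    (h : ∀ p, ψ (QTerm e p w) = 0) : ψ (Q e w) = 0 := by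
  rw [functional_Q]
  exact finsum_eq_zero_of_forall_eq_zero h

theorem functional_Q_eq_single {ψ : W K (Fin 3) →ₗ[K] K} {w : W K (Fin 3)} (p₀ : ℤ × ℤ)
    (h : ∀ p, p ≠ p₀ → ψ (QTerm e p w) = 0) : ψ (Q e w) = ψ (QTerm e p₀ w) := by
  rw [functional_Q]
  exact finsum_eq_single _ _ h

theorem op_gamma_QTerm (n : ℤ) (f : Module.Dual K L) (p : ℤ × ℤ) (w : W K (Fin 3)) :
    op e (.gamma n f) (QTerm e p w) = QTerm e p (op e (.gamma n f) w) +
      if n + (p.1 + p.2) = 0 then ∑ u, ∑ v, f ⁅e u, e v⁆ •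
        nord e [.gamma (-p.1) (e.coord v), .c (-p.2) (e.coord u)] w else 0 := by
  have := congrArg (fun A : Module.End K (W K (Fin 3)) => A w) (op_gamma_mul_QTerm e n f p)
  simp only [Module.End.mul_apply, LinearMap.add_apply] at this
  rw [this]
  split_ifs <;> simp only [LinearMap.sum_apply, LinearMap.smul_apply, LinearMap.zero_apply]

theorem op_beta_QTerm (n : ℤ) (x : L) (p : ℤ × ℤ) (w : W K (Fin 3)) :
    op e (.beta n x) (QTerm e p w) = QTerm e p (op e (.beta n x) w) +
      if n = p.1 then
        -∑ u, nord e [.beta (p.1 + p.2) ⁅e u, x⁆, .c (-p.2) (e.coord u)] w else 0 := by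
  have := congrArg (fun A : Module.End K (W K (Fin 3)) => A w) (op_beta_mul_QTerm e n x p)
  simp only [Module.End.mul_apply, LinearMap.add_apply] at this
  rw [this]
  split_ifs <;> simp only [LinearMap.sum_apply, LinearMap.neg_apply, LinearMap.zero_apply]

theorem op_c_QTerm (n : ℤ) (f : Module.Dual K L) (p : ℤ × ℤ) (w : W K (Fin 3)) :
    op e (.c n f) (QTerm e p w) = -QTerm e p (op e (.c n f) w) +
      if n + (p.1 + p.2) = 0 then ∑ u, ∑ v, (1 / 2 * f ⁅e u, e v⁆) •
        nord e [.c (-p.1) (e.coord v), .c (-p.2) (e.coord u)] w else 0 := by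
  have := congrArg (fun A : Module.End K (W K (Fin 3)) => A w) (op_c_mul_QTerm e n f p)
  simp only [Module.End.mul_apply, LinearMap.add_apply, LinearMap.smul_apply, neg_one_smul] at this
  rw [this]
  split_ifs <;> simp only [LinearMap.sum_apply, LinearMap.smul_apply, LinearMap.zero_apply]

/-- On bosonic states {Q, c_{-1}^f} is a sum of products c_0 c_{-1} that encodes the coadjoint
action on f. It cancels the same action on γ_0, produced by `Q_creat_vac`, by invariance of the
tensor. -/
theorem IsSL2Basis.Q_rState [CharZero K] (he : IsSL2Basis e) : Q e (rState e) = 0 := by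
  have hw : ∀ b, IsBosonic (creat e (.gamma 0) b (vac K (Fin 3))) :=
    fun b => isBosonic_vac.cur _ _ _
  have hcX : ∀ n (f : Module.Dual K L) (b : L) (w : W K (Fin 3)),
      cOp e n f (creat e (.gamma 0) b w) = creat e (.gamma 0) b (cOp e n f w) :=
    fun n f b w => op_c_op_bosonic rfl _ _ _
  have hcc : ∀ n m (f g : Module.Dual K L) (w : W K (Fin 3)),
      cOp e n f (cOp e m g w) = -cOp e m g (cOp e n f w) := fun n m f g w => by
    have := congrArg (fun A : Module.End K (W K (Fin 3)) => A w) (op_mul_op e (.c n f) (.c m g))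
    simpa [koszulSign, contraction, Gen.isOdd, cOp_apply] using this
  have hQc : ∀ (a : L) {w : W K (Fin 3)}, IsBosonic w → Q e (cOp e (-1) (phi e a) w) =
      -cOp e (-1) (phi e a) (Q e w) +
        ∑ v, cOp e 0 (e.coord v) (cOp e (-1) (phi e ⁅e v, a⁆) w) := fun a w hw => by
    have h := map_locSum (locFin_Q e) (op e (.c (-1) (phi e a))) (-1) _
      (op_c_mul_QTerm e (-1) (phi e a)) w
    have h1 : ∑ᶠ p : ℤ × ℤ, (if -1 + (p.1 + p.2) = 0 then
        ∑ u, ∑ v, (1 / 2 * phi e a ⁅e u, e v⁆) •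
          nord e [.c (-p.1) (e.coord v), .c (-p.2) (e.coord u)] else 0 : Module.End K _) w =
        ∑ v, cOp e 0 (e.coord v) (cOp e (-1) (phi e ⁅e v, a⁆) w) := by
      have hf : ∀ v, ∑ u, phi e a ⁅e u, e v⁆ • cOp e (-1) (e.coord u) =
          cOp e (-1) (phi e ⁅e v, a⁆) := fun v => by
        rw [← sum_smul_map_coord e (cOp e (-1)) (phi e ⁅e v, a⁆)]
        refine Finset.sum_congr rfl fun u _ => ?_
        rw [he.phi_lie, ← lie_skew, map_neg]
      -- The two c-modes add up to -1, and a positive one kills `w`; the two remaining terms are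
      -- equal and absorb the factor 1/2.
      rw [finsum_eq_sum_of_support_subset (s := {(0, 1), (1, 0)})]
      · rw [Finset.sum_pair (by simp)]
        simp only [← hf, LinearMap.sum_apply, LinearMap.smul_apply, map_sum, map_smul]
        rw [Finset.sum_comm (f := fun v u => phi e a ⁅e u, e v⁆ •
          cOp e 0 (e.coord v) (cOp e (-1) (e.coord u) w))]
        have h10 : ∀ u v, nord e [.c (-(1 : ℤ)) (e.coord v), .c (-(0 : ℤ)) (e.coord u)] w =
            -cOp e 0 (e.coord u) (cOp e (-1) (e.coord v) w) := fun u v => by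
          rw [← hcc]
          simp [nord, Gen.isCreation, cOp_apply]
        have h01 : ∀ u v, nord e [.c (-(0 : ℤ)) (e.coord v), .c (-(1 : ℤ)) (e.coord u)] w =
            cOp e 0 (e.coord v) (cOp e (-1) (e.coord u) w) := fun u v => by
          simp [nord, Gen.isCreation, cOp_apply]
        rw [if_pos (by norm_num), if_pos (by norm_num)]
        simp only [LinearMap.sum_apply, LinearMap.smul_apply, h01, h10]
        conv_lhs =>
          arg 2
          rw [Finset.sum_comm]
        simp only [← Finset.sum_add_distrib]
        refine Finset.sum_congr rfl fun u _ => Finset.sum_congr rfl fun v _ => ?_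
        rw [← lie_skew (e u) (e v), map_neg]
        module
      · intro p hp
        by_contra hn
        refine hp ?_
        beta_reduce
        split_ifs with h
        · have hp' : p.1 < 0 ∨ p.2 < 0 := by
            by_contra! h0
            refine hn ?_
            rcases p with ⟨i, j⟩
            simp only at h h0
            rcases (show (i = 0 ∧ j = 1) ∨ (i = 1 ∧ j = 0) by omega) with
              ⟨rfl, rfl⟩ | ⟨rfl, rfl⟩ <;>
              simp
          simp only [LinearMap.sum_apply, LinearMap.smul_apply]
          refine Finset.sum_eq_zero fun u _ => Finset.sum_eq_zero fun v _ => ?_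
          rw [hw.nord_eq_zero e (by simpa [Gen.isOdd, Gen.isCreation] using hp'), smul_zero]
        · rfl
    rw [h1] at h
    change op e (.c (-1) (phi e a)) (Q e w) =
      (-1 : K) • Q e (op e (.c (-1) (phi e a)) w) + _ at h
    change Q e (op e (.c (-1) (phi e a)) w) = -op e (.c (-1) (phi e a)) (Q e w) + _
    rw [h]
    module
  have h2 : ∀ v, casSum e (fun a b => creat e (.gamma 0) b (cOp e 0 (e.coord v)
      (cOp e (-1) (phi e ⁅e v, a⁆) (vac K (Fin 3))))) = -casSum e (fun a b =>
        creat e (.gamma 0) ⁅e v, b⁆ (cOp e 0 (e.coord v)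
          (cOp e (-1) (phi e a) (vac K (Fin 3))))) := fun v => by
    let S : L →ₗ[K] L →ₗ[K] W K (Fin 3) := LinearMap.mk₂ K (fun a b => creat e (.gamma 0) b
        (cOp e 0 (e.coord v) (cOp e (-1) (phi e a) (vac K (Fin 3)))))
      (by simp) (by simp) (by simp) (by simp)
    rw [eq_neg_iff_add_eq_zero, ← casSum_add]
    exact he.casSum_lie S (e v)
  rw [rState_eq, map_casSum]
  simp only [hQc _ (hw _), he.Q_creat_vac (s := .gamma 0) rfl]
  simp only [casSum_add, map_sum, casSum_sum, hcc (-1) 0, hcX, h2, Finset.sum_neg_distrib,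
    map_neg, neg_neg,
    add_neg_cancel]

end Closed

/-! ### Vacuum coefficients of annihilation operators applied to Q w. -/

section NonExact

variable {K L : Type*} [Field K] [LieRing L] [LieAlgebra K L] {e : Module.Basis (Fin 3) K L}

theorem vacCoeff_op_nord {g a b : Gen K L} (ha : contraction g a = 0) (hb : contraction g b = 0)
    (h : a.isCreation = true ∨ b.isCreation = true) (w : W K (Fin 3)) :
    vacCoeff K (Fin 3) (op e g (nord e [a, b] w)) = 0 := by
  have := congrArg (fun A : Module.End K (W K (Fin 3)) => A w) (op_mul_nord_pair e g a b)
  simp only [ha, hb, mul_zero, zero_smul, add_zero, Module.End.mul_apply,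
    LinearMap.smul_apply] at this
  rw [this, map_smul, vacCoeff_nord e (by simpa using h), smul_zero]

/-- The contraction leaves a γc pair of total mode 1, while two annihilating modes would add up to
at least 2. -/
theorem vacCoeff_gamma_one_QTerm (f : Module.Dual K L) (p : ℤ × ℤ) (w : W K (Fin 3)) :
    vacCoeff K (Fin 3) (op e (.gamma 1 f) (QTerm e p w)) = 0 := by
  rw [op_gamma_QTerm, map_add, vacCoeff_QTerm, zero_add]
  split_ifs with h
  · simp only [map_sum, map_smul]
    refine Finset.sum_eq_zero fun u _ => Finset.sum_eq_zero fun v _ => ?_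
    rw [vacCoeff_nord e (by simp [Gen.isCreation]; omega), smul_zero]
  · exact map_zero _

theorem vacCoeff_beta_zero_QTerm (x : L) (p : ℤ × ℤ) (w : W K (Fin 3)) :
    vacCoeff K (Fin 3) (op e (.beta 0 x) (QTerm e p w)) = 0 := by
  rw [op_beta_QTerm, map_add, vacCoeff_QTerm, zero_add]
  split_ifs with h
  · simp only [map_sum, map_neg]
    rw [neg_eq_zero]
    refine Finset.sum_eq_zero fun u _ => ?_
    rw [vacCoeff_nord e (by simp [Gen.isCreation]; omega)]
  · exact map_zero _

theorem vacCoeff_gamma_gamma_QTerm (f g : Module.Dual K L) (p : ℤ × ℤ) (w : W K (Fin 3)) :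
    vacCoeff K (Fin 3) (op e (.gamma 1 f) (op e (.gamma 1 g) (QTerm e p w))) = 0 := by
  rw [op_gamma_QTerm, map_add, map_add, vacCoeff_gamma_one_QTerm, zero_add]
  split_ifs with h
  · simp only [map_sum, map_smul]
    refine Finset.sum_eq_zero fun u _ => Finset.sum_eq_zero fun v _ => ?_
    rw [vacCoeff_op_nord rfl rfl (by simp [Gen.isCreation]; omega), smul_zero]
  · simp only [map_zero]

theorem vacCoeff_beta_beta_QTerm (x y : L) (p : ℤ × ℤ) (w : W K (Fin 3)) :
    vacCoeff K (Fin 3) (op e (.beta 0 x) (op e (.beta 0 y) (QTerm e p w))) = 0 := by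
  rw [op_beta_QTerm, map_add, map_add, vacCoeff_beta_zero_QTerm, zero_add]
  split_ifs with h
  · simp only [map_sum, map_neg]
    rw [neg_eq_zero]
    refine Finset.sum_eq_zero fun u _ => ?_
    rw [vacCoeff_op_nord rfl rfl (by simp [Gen.isCreation]; omega)]
  · simp only [map_zero]

theorem vacCoeff_op_c_QTerm {g : Gen K L}
    (hg : ∀ p w, vacCoeff K (Fin 3) (op e g (QTerm e p w)) = 0)
    (hc : ∀ n f, contraction g (.c n f) = 0) (f : Module.Dual K L) (p : ℤ × ℤ) (w : W K (Fin 3)) :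
    vacCoeff K (Fin 3) (op e g (op e (.c 1 f) (QTerm e p w))) = 0 := by
  rw [op_c_QTerm, map_add, map_add, map_neg, map_neg, hg, neg_zero, zero_add]
  split_ifs with h
  · simp only [map_sum, map_smul]
    refine Finset.sum_eq_zero fun u _ => Finset.sum_eq_zero fun v _ => ?_
    rw [vacCoeff_op_nord (hc _ _) (hc _ _) (by simp [Gen.isCreation]; omega), smul_zero]
  · simp only [map_zero]

/-- Contracting with γ_2 leaves a pair of total mode 2, and γ_1 c_1 is the only such pair without a
creation operator. -/
theorem vacCoeff_gamma_two_Q (f g : Module.Dual K L) (w : W K (Fin 3)) :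
    vacCoeff K (Fin 3) (op e (.gamma 1 f) (op e (.gamma 2 g) (Q e w))) =
      ∑ u, ∑ v, g ⁅e u, e v⁆ • vacCoeff K (Fin 3) (op e (.gamma 1 f)
        (op e (.c 1 (e.coord u)) (op e (.gamma 1 (e.coord v)) w))) := by
  have h := functional_Q_eq_single (e := e) (w := w)
    (ψ := vacCoeff K (Fin 3) ∘ₗ op e (.gamma 1 f) ∘ₗ op e (.gamma 2 g)) (-1, -1) fun p hp => by
      rw [LinearMap.comp_apply, LinearMap.comp_apply, op_gamma_QTerm, map_add, map_add,
        vacCoeff_gamma_one_QTerm, zero_add]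
      split_ifs with h
      · simp only [map_sum, map_smul]
        refine Finset.sum_eq_zero fun u _ => Finset.sum_eq_zero fun v _ => ?_
        rw [vacCoeff_op_nord rfl rfl, smul_zero]
        simp only [Gen.isCreation, decide_eq_true_eq]
        by_contra! h2
        exact hp (Prod.ext (by simp only; omega) (by simp only; omega))
      · simp only [map_zero]
  simp only [LinearMap.comp_apply] at h
  rw [h, op_gamma_QTerm, map_add, map_add, vacCoeff_gamma_one_QTerm, zero_add, if_pos (by norm_num)]
  simp only [map_sum, map_smul]
  simp [nord, Gen.isCreation, Gen.isOdd, -Module.Basis.coord_apply]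

/-- Contracting with β_1 leaves β_{1+j} c_{-j}; both factors annihilate only for j = -1. -/
theorem vacCoeff_op_beta_one_Q {g : Gen K L}
    (hg : ∀ p w, vacCoeff K (Fin 3) (op e g (QTerm e p w)) = 0)
    (h1 : ∀ n x, contraction g (.beta n x) = 0) (h2 : ∀ n f, contraction g (.c n f) = 0)
    (x : L) (w : W K (Fin 3)) :
    vacCoeff K (Fin 3) (op e g (op e (.beta 1 x) (Q e w))) =
      -∑ u, vacCoeff K (Fin 3) (op e g
        (op e (.c 1 (e.coord u)) (op e (.beta 0 ⁅e u, x⁆) w))) := by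
  have h := functional_Q_eq_single (e := e) (w := w)
    (ψ := vacCoeff K (Fin 3) ∘ₗ op e g ∘ₗ op e (.beta 1 x)) (1, -1) fun p hp => by
      rw [LinearMap.comp_apply, LinearMap.comp_apply, op_beta_QTerm, map_add, map_add,
        hg, zero_add]
      split_ifs with h
      · simp only [map_sum, map_neg]
        rw [neg_eq_zero]
        refine Finset.sum_eq_zero fun u _ => ?_
        rw [vacCoeff_op_nord (h1 _ _) (h2 _ _)]
        simp only [Gen.isCreation, decide_eq_true_eq]
        by_contra! h2
        exact hp (Prod.ext (by simp only; omega) (by simp only; omega))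
      · simp only [map_zero]
  simp only [LinearMap.comp_apply] at h
  rw [h, op_beta_QTerm, map_add, map_add, hg, zero_add, if_pos rfl]
  simp only [map_sum, map_neg]
  simp [nord, Gen.isCreation, Gen.isOdd, -Module.Basis.coord_apply]

theorem vacCoeff_beta_one_Q (x : L) (w : W K (Fin 3)) :
    vacCoeff K (Fin 3) (op e (.beta 1 x) (Q e w)) =
      -∑ u, vacCoeff K (Fin 3) (op e (.c 1 (e.coord u)) (op e (.beta 0 ⁅e u, x⁆) w)) := by
  have h := functional_Q_eq_single (e := e) (w := w)
    (ψ := vacCoeff K (Fin 3) ∘ₗ op e (.beta 1 x)) (1, -1) fun p hp => by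
      rw [LinearMap.comp_apply, op_beta_QTerm, map_add, vacCoeff_QTerm, zero_add]
      split_ifs with h
      · simp only [map_sum, map_neg]
        rw [neg_eq_zero]
        refine Finset.sum_eq_zero fun u _ => ?_
        rw [vacCoeff_nord]
        simp only [List.mem_cons, List.not_mem_nil, or_false, exists_eq_or_imp, exists_eq_left,
          Gen.isCreation, decide_eq_true_eq]
        by_contra! h2
        exact hp (Prod.ext (by simp only; omega) (by simp only; omega))
      · simp only [map_zero]
  simp only [LinearMap.comp_apply] at h
  rw [h, op_beta_QTerm, map_add, vacCoeff_QTerm, zero_add, if_pos rfl]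
  simp only [map_sum, map_neg]
  simp [nord, Gen.isCreation, Gen.isOdd, -Module.Basis.coord_apply]

/-- Here both operators contract in succession: γ_1 with the β of `Q`, then β_0 with the remaining
γ_0, which leaves c_1. -/
theorem vacCoeff_beta_gamma_Q (x : L) (f : Module.Dual K L) (w : W K (Fin 3)) :
    vacCoeff K (Fin 3) (op e (.beta 0 x) (op e (.gamma 1 f) (Q e w))) =
      -∑ u, f ⁅e u, x⁆ • vacCoeff K (Fin 3) (op e (.c 1 (e.coord u)) w) := by
  have hT : ∀ p : ℤ × ℤ, 1 + (p.1 + p.2) = 0 → ∀ u v, vacCoeff K (Fin 3) (op e (.beta 0 x)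
      (nord e [.gamma (-p.1) (e.coord v), .c (-p.2) (e.coord u)] w)) =
      if p.1 = 0 then -(e.coord v x * vacCoeff K (Fin 3) (op e (.c 1 (e.coord u)) w)) else 0 := by
    intro p hp u v
    have := congrArg (fun A : Module.End K (W K (Fin 3)) => A w)
      (op_mul_nord_pair e (.beta 0 x) (.gamma (-p.1) (e.coord v)) (.c (-p.2) (e.coord u)))
    simp only [Module.End.mul_apply, LinearMap.add_apply, LinearMap.smul_apply] at this
    rw [this, map_add, map_add, map_smul, map_smul, map_smul,
      vacCoeff_nord e (by simp [Gen.isCreation]; omega)]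
    by_cases h0 : p.1 = 0
    · have h1 : -p.2 = 1 := by omega
      simp [contraction, h0, h1]
    · simp [contraction, h0]
  have h := functional_Q_eq_single (e := e) (w := w)
    (ψ := vacCoeff K (Fin 3) ∘ₗ op e (.beta 0 x) ∘ₗ op e (.gamma 1 f)) (0, -1) fun p hp => by
      rw [LinearMap.comp_apply, LinearMap.comp_apply, op_gamma_QTerm, map_add, map_add,
        vacCoeff_beta_zero_QTerm, zero_add]
      split_ifs with h
      · have h0 : ¬ p.1 = 0 := fun h0 => hp (Prod.ext h0 (by simp only; omega))
        simp only [map_sum, map_smul, hT p h, if_neg h0, smul_zero, Finset.sum_const_zero]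
      · simp only [map_zero]
  simp only [LinearMap.comp_apply] at h
  have hs : ∀ u, ∑ v, f ⁅e u, e v⁆ * e.coord v x = f ⁅e u, x⁆ := fun u => by
    have := sum_coord_smul_map e (f ∘ₗ (LieAlgebra.ad K L (e u) : L →ₗ[K] L)) x
    simpa [mul_comm] using this
  rw [h, op_gamma_QTerm, map_add, map_add, vacCoeff_beta_zero_QTerm, zero_add,
    if_pos (by norm_num)]
  simp only [map_sum, map_smul, hT (0, -1) (by norm_num), if_true, ← hs, Finset.sum_smul,
    ← Finset.sum_neg_distrib]
  refine Finset.sum_congr rfl fun u _ => Finset.sum_congr rfl fun v _ => ?_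
  simp only [smul_eq_mul]
  ring

theorem vacCoeff_theta_zero (x : L) (w : W K (Fin 3)) :
    vacCoeff K (Fin 3) (theta e x 0 w) = 0 := by
  change vacCoeff K (Fin 3) (∑ᶠ m, thetaTerm e x 0 m w) = 0
  rw [map_finsum _ (locFin_theta e x 0 w)]
  refine finsum_eq_zero_of_forall_eq_zero fun m => ?_
  simp only [thetaTerm, LinearMap.sum_apply, LinearMap.add_apply, map_sum, map_add]
  refine Finset.sum_eq_zero fun v _ => ?_
  rw [vacCoeff_nord, vacCoeff_nord, add_zero] <;>
  · simp [Gen.isCreation]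
    omega

theorem vacCoeff_theta_one (x : L) (w : W K (Fin 3)) :
    vacCoeff K (Fin 3) (theta e x 1 w) = ∑ v, (vacCoeff K (Fin 3)
      (op e (.gamma 1 (e.coord v)) (op e (.beta 0 ⁅x, e v⁆) w)) -
        vacCoeff K (Fin 3) (op e (.c 1 (e.coord v)) (op e (.b 0 ⁅x, e v⁆) w))) := by
  change vacCoeff K (Fin 3) (∑ᶠ m, thetaTerm e x 1 m w) = _
  rw [map_finsum _ (locFin_theta e x 1 w), finsum_eq_single _ (-1)]
  · simp only [thetaTerm, LinearMap.sum_apply, LinearMap.add_apply, map_sum, map_add]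
    refine Finset.sum_congr rfl fun v _ => ?_
    simp [nord, Gen.isCreation, Gen.isOdd, -Module.Basis.coord_apply, sub_eq_add_neg]
  · intro m hm
    simp only [thetaTerm, LinearMap.sum_apply, LinearMap.add_apply, map_sum, map_add]
    refine Finset.sum_eq_zero fun v _ => ?_
    rw [vacCoeff_nord, vacCoeff_nord, add_zero] <;>
    · simp [Gen.isCreation]
      omega

end NonExact

/-! ### Functionals vanishing on exact states, and non-exactness. -/

section Obstructions

variable {K L : Type*} [Field K] [LieRing L] [LieAlgebra K L] {e : Module.Basis (Fin 3) K L}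

theorem IsSL2Basis.casSum_lie_left_apply {V N : Type*} [AddCommGroup V] [Module K V]
    [AddCommGroup N] [Module K N] (he : IsSL2Basis e) {A : L →ₗ[K] Module.End K V}
    (hA : ∀ a b w, A a (A b w) = A b (A a w)) (ψ : V →ₗ[K] N) (w : V) (u : L) :
    casSum e (fun a b => ψ (A ⁅u, a⁆ (A b w))) = 0 :=
  he.casSum_lie_left ((biOp A A w).compr₂ ψ)
    (fun a b => by rw [LinearMap.compr₂_apply, biOp_apply, hA, LinearMap.compr₂_apply,
      biOp_apply]) u

theorem vacCoeff_op_op_Q {A B : Module.End K (W K (Fin 3))} {w : W K (Fin 3)}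
    (h : ∀ p, vacCoeff K (Fin 3) (A (B (QTerm e p w))) = 0) :
    vacCoeff K (Fin 3) (A (B (Q e w))) = 0 :=
  functional_Q_eq_zero (ψ := vacCoeff K (Fin 3) ∘ₗ A ∘ₗ B) h

theorem annih_beta (n : ℕ) (a : L) (w : W K (Fin 3)) :
    annih e (.beta n) a w = op e (.gamma (n + 1) (phi e a)) w := by
  rw [annih_apply]
  simp [SymCopy.kind, SymCopy.level, cur_true, add_comm]

theorem annih_gamma (n : ℕ) (a : L) (w : W K (Fin 3)) :
    annih e (.gamma n) a w = -op e (.beta n a) w := by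
  rw [annih_apply]
  simp [SymCopy.kind, SymCopy.level, cur_false]

theorem op_gamma_neg (n : ℤ) (f : Module.Dual K L) (w : W K (Fin 3)) :
    op e (.gamma n (-f)) w = -op e (.gamma n f) w := by
  rw [← gammaOp_apply, map_neg, LinearMap.neg_apply, gammaOp_apply]

/-- The surviving term has γ_1^{φ[u,a]} γ_1^{φ(b)}, whose factors commute, so `casSum_lie_left`
cancels it. -/
theorem IsSL2Basis.casSum_gamma_gamma_Q [CharZero K] (he : IsSL2Basis e) (w : W K (Fin 3)) :
    casSum e (fun a b => vacCoeff K (Fin 3)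
      (op e (.gamma 1 (phi e b)) (op e (.gamma 2 (phi e a)) (Q e w)))) = 0 := by
  have h : ∀ a b, vacCoeff K (Fin 3)
      (op e (.gamma 1 (phi e b)) (op e (.gamma 2 (phi e a)) (Q e w))) =
      -∑ u, vacCoeff K (Fin 3) (op e (.c 1 (e.coord u))
        (op e (.gamma 1 (phi e ⁅e u, a⁆)) (op e (.gamma 1 (phi e b)) w))) := fun a b => by
    rw [vacCoeff_gamma_two_Q, ← Finset.sum_neg_distrib]
    refine Finset.sum_congr rfl fun u _ => ?_
    have := sum_smul_map_coord e ((gammaOp e 1).flip w) (-phi e ⁅e u, a⁆)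
    simp only [LinearMap.flip_apply, gammaOp_apply, LinearMap.neg_apply, he.phi_lie, neg_neg,
      op_gamma_neg] at this
    rw [op_gamma_comm, ← map_neg, ← map_neg, ← map_neg, ← this]
    simp only [map_sum, map_smul]
    refine Finset.sum_congr rfl fun v _ => ?_
    rw [op_c_op_bosonic rfl, op_c_op_bosonic rfl, op_c_op_bosonic rfl]
  simp only [h, casSum_neg, casSum_sum]
  rw [neg_eq_zero]
  refine Finset.sum_eq_zero fun u _ => ?_
  exact he.casSum_lie_left_apply (A := gammaOp e 1 ∘ₗ phi e) (fun _ _ _ => op_gamma_comm _ _ _ _ _)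
    (vacCoeff K (Fin 3) ∘ₗ op e (.c 1 (e.coord u))) w (e u)

theorem IsSL2Basis.casSum_beta_beta_Q [CharZero K] (he : IsSL2Basis e) (w : W K (Fin 3)) :
    casSum e (fun a b => vacCoeff K (Fin 3) (op e (.beta 0 b) (op e (.beta 1 a) (Q e w)))) = 0 := by
  simp only [vacCoeff_op_beta_one_Q (g := .beta 0 _) (vacCoeff_beta_zero_QTerm _) (fun _ _ => rfl)
      (fun _ _ => rfl),
    casSum_neg, casSum_sum]
  rw [neg_eq_zero]
  refine Finset.sum_eq_zero fun u _ => ?_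
  have hc : ∀ a b, op e (.beta 0 b) (op e (.c 1 (e.coord u)) (op e (.beta 0 a) w)) =
      op e (.c 1 (e.coord u)) (op e (.beta 0 a) (op e (.beta 0 b) w)) := fun a b => by
    rw [← op_c_op_bosonic rfl, op_beta_comm]
  simp only [hc]
  exact he.casSum_lie_left_apply (A := betaOp e 0) (fun _ _ _ => op_beta_comm _ _ _ _ _)
    (vacCoeff K (Fin 3) ∘ₗ op e (.c 1 (e.coord u))) w (e u)

theorem IsSL2Basis.casSum_beta_gamma_Q [CharZero K] (he : IsSL2Basis e) (w : W K (Fin 3)) :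
    casSum e (fun a b => vacCoeff K (Fin 3)
      (op e (.beta 0 a) (op e (.gamma 1 (phi e b)) (Q e w)))) = 0 := by
  simp only [vacCoeff_beta_gamma_Q, casSum_neg, casSum_sum]
  rw [neg_eq_zero]
  refine Finset.sum_eq_zero fun u _ => ?_
  have h := map_casSum (e := e) (LinearMap.toSpanSingleton K K
    (vacCoeff K (Fin 3) (op e (.c 1 (e.coord u)) w))) (fun a b => phi e ⁅e u, a⁆ b)
  rw [he.casSum_lie_left (phi e) (phi_symm e) (e u), map_zero] at h
  simp only [phi_symm e _ ⁅e u, _⁆]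
  exact h.symm

/-- For two equal copies each coefficient already vanishes on exact states; for the other three
pairs only the contraction with the invariant tensor does. -/
theorem IsSL2Basis.casSum_coeff₂_Q [CharZero K] (he : IsSL2Basis e) (i : Fin 5)
    (w : W K (Fin 3)) :
    casSum e (fun a b => coeff₂ e (Q e w) (closedPair i).2 (closedPair i).1 a b) = 0 := by
  have hβ : ∀ a, annih e (.beta 0) a = op e (.gamma 1 (phi e a)) := fun a =>
    LinearMap.ext fun w => by simpa using annih_beta (e := e) 0 a w
  have hγ : ∀ a, annih e (.gamma 0) a = -op e (.beta 0 a) := fun a =>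
    LinearMap.ext fun w => by simpa using annih_gamma (e := e) 0 a w
  have hβ' : ∀ a, annih e (.beta 1) a = op e (.gamma 2 (phi e a)) := fun a =>
    LinearMap.ext fun w => by simpa using annih_beta (e := e) 1 a w
  have hγ' : ∀ a, annih e (.gamma 1) a = -op e (.beta 1 a) := fun a =>
    LinearMap.ext fun w => by simpa using annih_gamma (e := e) 1 a w
  fin_cases i
  · change casSum e (fun a b => vacCoeff K (Fin 3)
      (annih e (.beta 0) a (annih e (.beta 0) b (Q e w)))) = 0
    have h : ∀ a b, vacCoeff K (Fin 3) (op e (.gamma 1 (phi e a))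
        (op e (.gamma 1 (phi e b)) (Q e w))) = 0 := fun a b =>
      vacCoeff_op_op_Q fun p => vacCoeff_gamma_gamma_QTerm _ _ _ _
    simp only [hβ, h, casSum_zero]
  · change casSum e (fun a b => vacCoeff K (Fin 3)
      (annih e (.beta 1) a (annih e (.beta 0) b (Q e w)))) = 0
    simp only [hβ, hβ', op_gamma_comm 2 1, he.casSum_gamma_gamma_Q]
  · change casSum e (fun a b => vacCoeff K (Fin 3)
      (annih e (.gamma 0) a (annih e (.gamma 0) b (Q e w)))) = 0
    have h : ∀ a b, vacCoeff K (Fin 3) (op e (.beta 0 a) (op e (.beta 0 b) (Q e w))) = 0 :=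
      fun a b => vacCoeff_op_op_Q fun p => vacCoeff_beta_beta_QTerm _ _ _ _
    simp only [hγ, LinearMap.neg_apply, map_neg, neg_neg, h, casSum_zero]
  · change casSum e (fun a b => vacCoeff K (Fin 3)
      (annih e (.gamma 1) a (annih e (.gamma 0) b (Q e w)))) = 0
    simp only [hγ, hγ', LinearMap.neg_apply, map_neg, neg_neg, op_beta_comm 1 0,
      he.casSum_beta_beta_Q]
  · change casSum e (fun a b => vacCoeff K (Fin 3)
      (annih e (.gamma 0) a (annih e (.beta 0) b (Q e w)))) = 0
    simp only [hγ, hβ, LinearMap.neg_apply, map_neg, casSum_neg, he.casSum_beta_gamma_Q, neg_zero]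

theorem casSum_phi [CharZero K] : casSum e (fun a b => phi e a b) = 3 := by
  simp [casSum, phi_x, phi_y, phi_h]
  norm_num

/-- None of the five closed states is exact. -/
theorem IsSL2Basis.v_notMem_range_Q [CharZero K] (he : IsSL2Basis e) (i : Fin 5) :
    v e i ∉ LinearMap.range (Q e) := by
  rintro ⟨w, hw⟩
  have h := he.casSum_coeff₂_Q i w
  -- On the state itself the functional is 3 = dim ℓ, or 6 when the two copies coincide.
  simp only [hw, v_eq_quad, coeff₂_quad] at h
  change casSum e (fun a b => (_ : K) • phi e a b) = 0 at h
  rw [casSum_smul, casSum_phi, smul_eq_mul] at h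
  split_ifs at h <;> norm_num at h

theorem op_c_op_b (n m : ℤ) (f : Module.Dual K L) (a : L) (w : W K (Fin 3)) :
    op e (.c n f) (op e (.b m a) w) =
      -op e (.b m a) (op e (.c n f) w) + (if n + m = 0 then f a else 0) • w := by
  have := congrArg (fun A : Module.End K (W K (Fin 3)) => A w) (op_mul_op e (.c n f) (.b m a))
  simpa [koszulSign, contraction, Gen.isOdd, ite_apply, apply_ite] using this

theorem op_b_op_c (n m : ℤ) (f : Module.Dual K L) (a : L) (w : W K (Fin 3)) :
    op e (.b m a) (op e (.c n f) w) =
      -op e (.c n f) (op e (.b m a) w) + (if n + m = 0 then f a else 0) • w := by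
  rw [op_c_op_b]
  abel

theorem casSum_phi_mul [CharZero K] (F : L →ₗ[K] K) (b : L) :
    casSum e (fun a c => phi e b a * F c) = F b := by
  have := casSum_phi_smul (e := e) F b
  rw [← casSum_swap] at this
  simpa only [phi_symm e b, smul_eq_mul] using this

/-- The pairing of `∑ b_{-1}^a X^b 1` with the dual annihilation operators. -/
theorem vacCoeff_annih_c_b [CharZero K] (s : SymCopy) (a b : L) :
    vacCoeff K (Fin 3) (annih e s a (op e (.c 1 (phi e b))
      (casSum e fun c d => bOp e (-1) c (creat e s d (vac K (Fin 3)))))) = phi e b a := by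
  have hcX : ∀ d, op e (.c 1 (phi e b)) (creat e s d (vac K (Fin 3))) = 0 := fun d =>
    (isBosonic_vac.cur s.kind s.level d).op_eq_zero e rfl (by simp [Gen.isCreation])
  simp only [map_casSum, bOp_apply, op_c_op_b, hcX, map_zero, neg_zero, zero_add,
    add_neg_cancel, if_true, map_smul, annih_creat, annih_vac, vacCoeff_vac, smul_eq_mul, mul_one]
  exact casSum_phi_mul (phi e a) b |>.trans (phi_symm e a b)

/-- Here one matrix entry suffices as functional: testing with h twice gives φ(h)(h) = 1. -/
theorem b_creat_notMem_range_Q [CharZero K] {s : SymCopy}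
    (hs : ∀ a p w, vacCoeff K (Fin 3) (annih e s a (op e (.c 1 (phi e (e 2)))
      (QTerm e p w))) = 0) :
    (casSum e fun c d => bOp e (-1) c (creat e s d (vac K (Fin 3)))) ∉ LinearMap.range (Q e) := by
  rintro ⟨w, hw⟩
  have h := vacCoeff_op_op_Q fun p => hs (e 2) p w
  rw [hw, vacCoeff_annih_c_b, phi_h, Module.Basis.coord_apply, Module.Basis.repr_self,
    Finsupp.single_eq_same] at h
  exact one_ne_zero h

theorem tState_notMem_range_Q [CharZero K] : tState e ∉ LinearMap.range (Q e) := by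
  rw [tState_eq]
  refine b_creat_notMem_range_Q fun a p w => ?_
  rw [annih_beta]
  exact vacCoeff_op_c_QTerm (fun p w => by simpa using vacCoeff_gamma_one_QTerm _ p w)
    (fun _ _ => rfl) _ _ _

theorem hState_notMem_range_Q [CharZero K] : hState e ∉ LinearMap.range (Q e) := by
  rw [hState_eq]
  refine b_creat_notMem_range_Q fun a p w => ?_
  rw [annih_gamma, map_neg, neg_eq_zero]
  exact vacCoeff_op_c_QTerm (fun p w => by simpa using vacCoeff_beta_zero_QTerm _ p w)
    (fun _ _ => rfl) _ _ _

/-- The functional detecting `r`, on exact states. -/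
theorem IsSL2Basis.casSum_beta_b_Q [CharZero K] (he : IsSL2Basis e) (w : W K (Fin 3)) :
    casSum e (fun a b => vacCoeff K (Fin 3) (op e (.beta 0 a) (op e (.b 1 b) (Q e w)))) +
      casSum e (fun a b => vacCoeff K (Fin 3) (op e (.beta 1 a) (op e (.b 0 b) (Q e w)))) = 0 := by
  have hβ0 : ∀ a w, vacCoeff K (Fin 3) (op e (.beta 0 a) (Q e w)) = 0 := fun a w =>
    functional_Q_eq_zero (ψ := vacCoeff K (Fin 3) ∘ₗ op e (.beta 0 a))
      fun p => vacCoeff_beta_zero_QTerm _ _ _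
  have hβθ : ∀ n j a b w, op e (.beta n a) (theta e b j w) =
      theta e b j (op e (.beta n a) w) - op e (.beta (j + n) ⁅b, a⁆) w := fun n j a b w => by
    rw [theta_beta]
    abel
  -- Moving β past θ leaves this commutator in both sums; the bracket is antisymmetric and the
  -- tensor symmetric.
  have hanti : casSum e (fun a b => vacCoeff K (Fin 3) (op e (.beta 1 ⁅b, a⁆) w)) = 0 := by
    simp only [casSum, lie_self, he.lie_xy, he.lie_yx, ← betaOp_apply, map_neg, map_zero,
      LinearMap.neg_apply, LinearMap.zero_apply]
    module
  have h1 : casSum e (fun a b => vacCoeff K (Fin 3) (op e (.beta 0 a) (op e (.b 1 b) (Q e w)))) =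
      -∑ v, casSum e (fun a b => vacCoeff K (Fin 3) (op e (.c 1 (e.coord v))
        (op e (.b 0 ⁅b, e v⁆) (op e (.beta 0 a) w)))) := by
    have hS : ∀ v, casSum e (fun a b => vacCoeff K (Fin 3) (op e (.gamma 1 (e.coord v))
        (op e (.beta 0 ⁅b, e v⁆) (op e (.beta 0 a) w)))) = 0 := fun v => by
      have := he.casSum_lie_left_apply (A := betaOp e 0) (fun _ _ _ => op_beta_comm _ _ _ _ _)
        (vacCoeff K (Fin 3) ∘ₗ op e (.gamma 1 (e.coord v))) w (e v)
      rw [← neg_eq_zero, ← casSum_neg, ← casSum_swap, ← this]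
      refine congrArg (casSum e) (funext fun a => funext fun b => ?_)
      rw [← betaOp_apply, ← lie_skew, map_neg, LinearMap.neg_apply, map_neg, map_neg, neg_neg,
        LinearMap.comp_apply, betaOp_apply e 0 b]
    simp only [op_b_Q, map_add, map_neg, hβ0, neg_zero, zero_add, hβθ, vacCoeff_theta_one,
      sub_eq_add_neg, casSum_add, casSum_neg, add_zero,
      hanti, casSum_sum, hS, Finset.sum_neg_distrib]
  have h2 : casSum e (fun a b => vacCoeff K (Fin 3) (op e (.beta 1 a) (op e (.b 0 b) (Q e w)))) =
      ∑ u, casSum e (fun a b => vacCoeff K (Fin 3) (op e (.c 1 (e.coord u))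
        (op e (.beta 0 ⁅e u, a⁆) (op e (.b 0 b) w)))) := by
    simp only [op_b_Q, map_add, map_neg, hβθ, map_sub, vacCoeff_theta_zero, vacCoeff_beta_one_Q,
      neg_neg, zero_add, zero_sub, casSum_add, casSum_neg, hanti, neg_zero, add_zero, casSum_sum]
  -- Neither sum need vanish alone. Together they are the action of each basis vector on both slots
  -- of c_1 β_0^a b_0^b, which kills the invariant tensor.
  rw [h1, h2, neg_add_eq_sub, ← Finset.sum_sub_distrib]
  refine Finset.sum_eq_zero fun v _ => ?_
  have := he.casSum_lie ((biOp (betaOp e 0) (bOp e 0) w).compr₂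
    (vacCoeff K (Fin 3) ∘ₗ op e (.c 1 (e.coord v)))) (e v)
  rw [← this, sub_eq_add_neg, ← casSum_neg, ← casSum_add]
  refine congrArg (casSum e) (funext fun a => funext fun b => ?_)
  simp only [LinearMap.compr₂_apply, biOp_apply, LinearMap.comp_apply]
  rw [← bOp_apply e 0 ⁅b, e v⁆, ← lie_skew b (e v), map_neg, LinearMap.neg_apply, map_neg,
    map_neg, neg_neg, bOp_apply,
    op_b_op_bosonic rfl]
  rfl

/-- b_0 has no contraction with c_{-1}, so the second sum of `casSum_beta_b_Q` vanishes on r, while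
the first equals -3. -/
theorem IsSL2Basis.rState_notMem_range_Q [CharZero K] (he : IsSL2Basis e) :
    rState e ∉ LinearMap.range (Q e) := by
  rintro ⟨w, hw⟩
  have h := he.casSum_beta_b_Q w
  have hbX : ∀ (n : ℕ) (b d : L), op e (.b n b) (creat e (.gamma 0) d (vac K (Fin 3))) = 0 :=
    fun n b d => (isBosonic_vac.cur _ _ d).op_eq_zero e rfl (by simp [Gen.isCreation])
  have hβ : ∀ a w, op e (.beta 0 a) w = -annih e (.gamma 0) a w := fun a w => by
    rw [annih_gamma, neg_neg, Nat.cast_zero]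
  have h1 : ∀ b, op e (.b 1 b) (rState e) = creat e (.gamma 0) b (vac K (Fin 3)) := fun b => by
    have := hbX 1 b
    rw [Nat.cast_one] at this
    rw [rState_eq]
    simp only [map_casSum, cOp_apply, op_b_op_c, this, map_zero, neg_zero, zero_add,
      neg_add_cancel, if_true]
    simp only [phi_symm e _ b]
    rw [← casSum_swap]
    simp only [phi_symm e b]
    exact casSum_phi_smul ((creat e (.gamma 0)).flip (vac K (Fin 3))) b
  have h0 : ∀ b, op e (.b 0 b) (rState e) = 0 := fun b => by
    have := hbX 0 b
    rw [Nat.cast_zero] at this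
    rw [rState_eq]
    simp [map_casSum, cOp_apply, op_b_op_c, this, casSum_zero]
  rw [hw] at h
  simp only [h0, h1, map_zero, casSum_zero, add_zero, hβ, annih_creat, annih_vac, if_true, map_neg,
    zero_add, map_smul, vacCoeff_vac, smul_eq_mul, mul_one, casSum_neg, casSum_phi] at h
  norm_num at h

end Obstructions

end VOWA

end

theorem theorem4 {K : Type*} [Field K] [IsAlgClosed K] [CharZero K]
    {L : Type*} [LieRing L] [LieAlgebra K L] (e : Module.Basis (Fin 3) K L)
    (hxy : ⁅e 0, e 1⁆ = e 2) (hhx : ⁅e 2, e 0⁆ = (2 : K) • e 0)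
    (hhy : ⁅e 2, e 1⁆ = (-2 : K) • e 1) :
    (∀ d : ℕ, d = 2 ∨ d = 3 →
      {l : Submodule K (VOWA.W K (Fin 3)) |
        ∃ w, VOWA.IsPureSymGen e d w ∧ l = Submodule.span K {w}}.Infinite) ∧
    {w : VOWA.W K (Fin 3) |
        (VOWA.IsPureSymGen e 2 w ∨ VOWA.IsPureSymGen e 3 w) ∧ VOWA.Q e w = 0} =
      {w | ∃ i : Fin 5, ∃ a : K, a ≠ 0 ∧ w = a • VOWA.v e i} ∧
    LinearIndependent K (VOWA.v e) ∧
    (∀ i : Fin 5, VOWA.v e i ∉ LinearMap.range (VOWA.Q e)) ∧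
    VOWA.koszul e (VOWA.v e 0) = (2 : K) • VOWA.tState e ∧
    VOWA.vir e 1 (VOWA.v e 1) = (2 : K) • VOWA.v e 0 ∧
    VOWA.v e 2 ∈ VOWA.classical e ∧
    VOWA.homot e (VOWA.v e 3) = -VOWA.rState e ∧
    VOWA.koszul e (VOWA.v e 4) = VOWA.hState e ∧
    (∀ w ∈ ({VOWA.tState e, VOWA.rState e, VOWA.hState e} : Set (VOWA.W K (Fin 3))),
      VOWA.Q e w = 0 ∧ w ∉ LinearMap.range (VOWA.Q e)) := by
  have he : VOWA.IsSL2Basis e := ⟨hxy, hhx, hhy⟩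
  refine ⟨fun d hd => he.infinite_pureSymGen hd, he.closed_pureSymGen,
    VOWA.linearIndependent_v, he.v_notMem_range_Q, VOWA.koszul_v_zero, VOWA.vir_v_one,
    VOWA.v_two_mem_classical, VOWA.homot_v_three, VOWA.koszul_v_four, ?_⟩
  rintro w (rfl | rfl | rfl)
  · exact ⟨by rw [VOWA.tState_eq]; exact he.Q_b_creat rfl, VOWA.tState_notMem_range_Q⟩
  · exact ⟨he.Q_rState, he.rState_notMem_range_Q⟩
  · exact ⟨by rw [VOWA.hState_eq]; exact he.Q_b_creat rfl, VOWA.hState_notMem_range_Q⟩
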